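/- Let $n\ge 1$ and $k\ge 1$ be integers, let $b,q\in\mathbb{R}$ with $q\le 1$, and let $R_\rho, R_f, f_{\max}\in\mathbb{R}$, $f_{\min}>0$, $\rho_{\min}>0$. There is a constant $C$, depending only on $n,k,b,q,R_\rho,R_f,f_{\min},f_{\max},\rho_{\min}$, with the following property. Let $\mathbf{p}$ be an integer with $1\le\mathbf{p}\le n$ and $k\le N:=\binom{n}{\mathbf{p}}$. For $\kappa\in\mathbb{R}^n$ let $\Lambda(\kappa)\in\mathbb{R}^N$ be the vector with the entries $\kappa_{i_1}+\cdots+\kappa_{i_{\mathbf{p}}}$, $1\le i_1<\cdots<i_{\mathbf{p}}\le n$, and let $\sigma_j$ be the $j$-th elementary symmetric function. Let $M=\{X(x)=\rho(x)x : x\in\mathbb{S}^n\}\subset\mathbb{R}^{n+1}$ be a closed star-shaped hypersurface with radial function $\rho\in C^4(\mathbb{S}^n)$, outer unit normal $\nu$ and principal curvatures $\kappa=(\kappa_1,\dots,\kappa_n)$ (positive for round spheres centered at the origin), and let $f\in C^2(\mathbb{S}^n)$. Suppose that $$\rho\ge\rho_{\min},\qquad |\rho|_{C^1(\mathbb{S}^n)}\le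 R_\rho,\qquad f_{\min}\le f\le f_{\max},\qquad |f|_{C^2(\mathbb{S}^n)}\le R_f,$$ where $|g|_{C^1}=\max(\sup|g|,\sup|\nabla g|)$ and $|g|_{C^2}=\max(|g|_{C^1},\sup|\nabla^2 g|)$ (with the norm of $\nabla^2 g$ as a bilinear form) for the round metric. Suppose that $M$ is $(\mathbf{p},k)$-convex, that is, $\sigma_j(\Lambda(\kappa))>0$ on $M$ for all $1\le j\le k$, and that $$\sigma_k(\Lambda(\kappa))=f\Big(\frac{X}{|X|}\Big)\,|X|^b\,\langle X,\nu\rangle^q\qquad\text{for all } X\in M.$$ Then the mean curvature of $M$ satisfies $$\sigma_1(H)=\kappa_1+\cdots+\kappa_n\le C\qquad\text{on } M.$$ -/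

import Mathlib

open scoped Manifold ContDiff InnerProductSpace

noncomputable section

namespace StarShapedHypersurface

/-- The Euclidean space `ℝⁿ⁺¹`. -/
abbrev Ambient (n : ℕ) : Type := EuclideanSpace ℝ (Fin (n + 1))

/-- The round unit sphere `𝕊ⁿ ⊂ ℝⁿ⁺¹`. -/
abbrev Sph (n : ℕ) : Type := Metric.sphere (0 : Ambient n) 1

instance factFinrank (n : ℕ) : Fact (Module.finrank ℝ (Ambient n) = n + 1) :=
  ⟨finrank_euclideanSpace_fin⟩

variable {n : ℕ}

/-- The extension `y ↦ g (y / |y|)` of a map `g` on `𝕊ⁿ` to `ℝⁿ⁺¹ ∖ {0}`, constant along rays.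
Restricted to the affine tangent plane `x + T_x𝕊ⁿ` it is `g` in the central projection chart
around `x`. Its first and second derivatives at `x`, applied to vectors tangent to `𝕊ⁿ` at `x`, are
the first and second covariant derivatives of `g` for the round metric. -/
def radialExt {F : Type*} [Zero F] (g : Sph n → F) (y : Ambient n) : F :=
  if hy : y = 0 then 0 else g ⟨‖y‖⁻¹ • y, by simp [norm_smul, hy]⟩

/-- The tangent space `T_x𝕊ⁿ = x^⊥`. -/
abbrev tangent (x : Sph n) : Submodule ℝ (Ambient n) := (ℝ ∙ (x : Ambient n))ᗮ

/-- First derivative of a map on the sphere, applied to a vector of `ℝⁿ⁺¹`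
(only its values on tangent vectors are used). -/
def D1 {F : Type*} [NormedAddCommGroup F] [NormedSpace ℝ F] (g : Sph n → F) (x : Sph n)
    (v : Ambient n) : F :=
  fderiv ℝ (radialExt g) x v

/-- Second covariant derivative of a map on the sphere, applied to two tangent vectors. -/
def D2 {F : Type*} [NormedAddCommGroup F] [NormedSpace ℝ F] (g : Sph n → F) (x : Sph n)
    (v w : Ambient n) : F :=
  fderiv ℝ (fderiv ℝ (radialExt g)) x v w

/-- The gradient `∇g(x) ∈ T_x𝕊ⁿ ⊂ ℝⁿ⁺¹` of a function on the sphere. -/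
def sphGrad (g : Sph n → ℝ) (x : Sph n) : Ambient n :=
  gradient (radialExt g) x

/-- `|g|_{C¹} ≤ R`, for the norm `|g|_{C¹} = max (sup |g|, sup |∇g|)` on `𝕊ⁿ`. -/
def C1NormLE (g : Sph n → ℝ) (R : ℝ) : Prop :=
  ∀ x, |g x| ≤ R ∧ ‖sphGrad g x‖ ≤ R

/-- `|g|_{C²} ≤ R`, for the norm `|g|_{C²} = max (sup |g|, sup |∇g|, sup |∇²g|)` on `𝕊ⁿ`, where
`|∇²g|` is the norm of the Hessian as a bilinear form. -/
def C2NormLE (g : Sph n → ℝ) (R : ℝ) : Prop :=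
  C1NormLE g R ∧
    ∀ x, ∀ v ∈ tangent x, ∀ w ∈ tangent x, |D2 g x v w| ≤ R * ‖v‖ * ‖w‖

/-- Position vector `X(x) = ρ(x) x` of the star-shaped hypersurface with radial function `ρ`. -/
def position (ρ : Sph n → ℝ) (x : Sph n) : Ambient n := ρ x • (x : Ambient n)

/-- The outer unit normal `ν = (ρ x - ∇ρ) / √(ρ² + |∇ρ|²)` at `X(x)`. -/
def normal (ρ : Sph n → ℝ) (x : Sph n) : Ambient n :=
  (√(ρ x ^ 2 + ‖sphGrad ρ x‖ ^ 2))⁻¹ • (ρ x • (x : Ambient n) - sphGrad ρ x)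

/-- An orthonormal frame `e₁, …, eₙ` of `T_x𝕊ⁿ`. -/
def frame (x : Sph n) : OrthonormalBasis (Fin n) ℝ (tangent x) :=
  OrthonormalBasis.fromOrthogonalSpanSingleton n (ne_zero_of_mem_unit_sphere x)

/-- Matrix `g_{ij} = ⟨X_i, X_j⟩` of the first fundamental form. -/
def firstForm (ρ : Sph n → ℝ) (x : Sph n) : Matrix (Fin n) (Fin n) ℝ :=
  Matrix.of fun i j => ⟪D1 (position ρ) x (frame x i), D1 (position ρ) x (frame x j)⟫_ℝ

/-- Matrix `h_{ij} = -⟨X_{ij}, ν⟩` of the second fundamental form. -/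
def secondForm (ρ : Sph n → ℝ) (x : Sph n) : Matrix (Fin n) (Fin n) ℝ :=
  Matrix.of fun i j => -⟪D2 (position ρ) x (frame x i) (frame x j), normal ρ x⟫_ℝ

/-- The principal curvatures `κ₁, …, κₙ` at `X(x)`: the roots `t`, with multiplicity, of
`det (h_{ij} - t g_{ij}) = 0`. -/
def principalCurvatures (ρ : Sph n → ℝ) (x : Sph n) : Multiset ℝ :=
  (Matrix.det ((secondForm ρ x).map Polynomial.C -
    (Polynomial.X : Polynomial ℝ) • (firstForm ρ x).map Polynomial.C)).roots

/-- `Λ(κ)`: the sums `κ_{i₁} + ⋯ + κ_{i_p}` over all `i₁ < ⋯ < i_p`, with multiplicity. -/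
def Lam (p : ℕ) (κ : Multiset ℝ) : Multiset ℝ := (κ.powersetCard p).map Multiset.sum

/-- `(p,k)`-convexity: `σ_j(Λ(κ)) > 0` for `1 ≤ j ≤ k` at every point of the hypersurface. -/
def IsPKConvex (p k : ℕ) (ρ : Sph n → ℝ) : Prop :=
  ∀ x, ∀ j, 1 ≤ j → j ≤ k → 0 < (Lam p (principalCurvatures ρ x)).esymm j

/-- The curvature equation `σ_k(Λ(κ)) = f(X/|X|) |X|^b ⟨X, ν⟩^q`; here `X/|X| = x` as `ρ > 0`. -/
def SolvesCurvatureEq (p k : ℕ) (b q : ℝ) (f ρ : Sph n → ℝ) : Prop :=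
  ∀ x, (Lam p (principalCurvatures ρ x)).esymm k =
    f x * ‖position ρ x‖ ^ b * ⟪position ρ x, normal ρ x⟫_ℝ ^ q

end StarShapedHypersurface

end

/-! Write `u = ⟨X, ν⟩`, let `H` be the mean curvature, and look at a maximum point of `w = log H -
log u`. For `k ≥ 2`, divide the equation by `σ_1(Λ)`, a binomial coefficient times `H`. With `β =
1/(k-1)`, the operator `G = (σ_k/σ_1)^β` of `Λ(κ)` then equals `exp (β (log f + b log |X| + (q-1)
log u - w - const))`. At the maximum the second derivatives of `-w` are nonnegative, so the unknown
`H` on the right-hand side only helps.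

`G` is homogeneous of degree one and superadditive on the Gårding cone, being the geometric mean of
the quotients `σ_{j+1}/σ_j`, each of which is superadditive (`Gar.add_and_Q_superadditive`,
`G_superadditive`). Hence its gradient `F` at the principal curvatures of the maximum point is
nonnegative and satisfies `G(μ) ≤ ∑ F_i μ_i` on the cone, with equality at that point
(`exists_supergradient`). By Schur–Horn the same linear function of the diagonal entries of the
second fundamental form dominates `G` of its eigenvalues (`G_eigenvalues_le`). No eigenvalue has to
be differentiated: the difference of the two sides of this bound has a local minimum along every
line, and the first and second order conditions there replace the differentiated equation.

The hypersurface is the level set `{P = 1}` of the 1-homogeneous function `P(y) = |y| / ρ(y/|y|)`.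
It is written as a `C⁴` graph over its tangent hyperplane, and ordinary derivatives in principal
directions replace covariant ones (`exists_graph`, `graph_geometry`, `hasJet_graphShape`). When the
Hessian of `w` is contracted with `F`, the fourth derivatives and the terms `∑ F_i κ_i²` cancel, and
`q ≤ 1` gives the remaining term in `∑ κ_i²` a favourable sign (`curvature_bound_at_max`). What is
left bounds `(∑ κ_i²)/H` by known quantities and a multiple of `1/H`. Since `∑ κ_i² ≥ H²/n`, `H` is
bounded at the maximum of `w`, and two-sided bounds on `u` carry the estimate to every point. For `k
= 1` the equation itself prescribes a multiple of `H`. -/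

/-! ### Real-rooted polynomials -/

open Polynomial in
/-- A product of real linear factors satisfies the Laguerre inequality `p p'' ≤ p'²`. -/
theorem laguerre_multiset_prod (m : Multiset ℝ) (x : ℝ) :
    (m.map fun r => X - C r).prod.eval x *
        (derivative (derivative (m.map fun r => X - C r).prod)).eval x ≤
      (derivative (m.map fun r => X - C r).prod).eval x ^ 2 := by
  induction m using Multiset.induction_on with
  | empty => simp
  | cons r m ih =>
    simp only [Multiset.map_cons, Multiset.prod_cons, derivative_mul, derivative_sub, derivative_X,
      derivative_C, sub_zero, one_mul, derivative_add, eval_add, eval_mul, eval_sub, eval_X, eval_C]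
    -- For `P = (X - r) m` one has `P'² - P P'' = m² + (x - r)² (m'² - m m'')`.
    nlinarith [sq_nonneg (eval x (m.map fun r => X - C r).prod),
      mul_le_mul_of_nonneg_left ih (sq_nonneg (x - r))]

open Polynomial in
/-- The Laguerre inequality for real-rooted polynomials. -/
theorem Polynomial.Splits.laguerre {p : ℝ[X]} (hp : p.Splits) (x : ℝ) :
    p.eval x * (derivative (derivative p)).eval x ≤ (derivative p).eval x ^ 2 := by
  rw [hp.eq_prod_roots]
  simp only [derivative_C_mul, eval_mul, eval_C]
  nlinarith [mul_le_mul_of_nonneg_left (laguerre_multiset_prod p.roots x)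
    (sq_nonneg p.leadingCoeff)]

-- Rolle, counted with multiplicity: passing to the derivative loses at most one root, and the
-- degree drops by at least one unless it is zero.
open Polynomial in
theorem Polynomial.Splits.derivative_real {p : ℝ[X]} (hp : p.Splits) : (derivative p).Splits := by
  rw [splits_iff_card_roots] at hp ⊢
  have h1 := card_roots_le_derivative p
  have h2 := natDegree_derivative_le p
  have h3 := card_roots' (derivative p)
  by_cases h : p.natDegree = 0
  · omega
  · omega

open Polynomial in
theorem Polynomial.Splits.iterate_derivative_real {p : ℝ[X]} (hp : p.Splits) (m : ℕ) :
    (derivative^[m] p).Splits := by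
  induction m with
  | zero => exact hp
  | succ m ih => rw [Function.iterate_succ_apply']; exact ih.derivative_real

/-! ### Newton's inequality and the Gårding cone -/

namespace ElemSymm

variable {ι : Type*}

/-- The elementary symmetric function of degree `j` of the numbers `l i`, `i ∈ s`. -/
def E (s : Finset ι) (j : ℕ) (l : ι → ℝ) : ℝ := ∑ t ∈ s.powersetCard j, ∏ i ∈ t, l i

theorem E_zero (s : Finset ι) (l : ι → ℝ) : E s 0 l = 1 := by simp [E]

theorem E_one (s : Finset ι) (l : ι → ℝ) : E s 1 l = ∑ i ∈ s, l i := by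
  simp [E, Finset.powersetCard_one]

theorem E_of_card_lt {s : Finset ι} {j : ℕ} (h : s.card < j) (l : ι → ℝ) : E s j l = 0 := by
  simp [E, Finset.powersetCard_eq_empty.2 h]

theorem E_eq_esymm (s : Finset ι) (j : ℕ) (l : ι → ℝ) : E s j l = (s.val.map l).esymm j := by
  rw [Finset.esymm_map_val]; rfl

theorem E_smul (s : Finset ι) (j : ℕ) (c : ℝ) (l : ι → ℝ) : E s j (c • l) = c ^ j * E s j l := by
  simp only [E, Finset.mul_sum]
  refine Finset.sum_congr rfl fun t ht => ?_
  simp [Finset.prod_mul_distrib, (Finset.mem_powersetCard.1 ht).2]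

/-- Newton's inequality, without the binomial factors. -/
theorem newton (s : Finset ι) (l : ι → ℝ) (j : ℕ) : E s (j + 2) l * E s j l ≤ E s (j + 1) l ^ 2 := by
  classical
  rcases lt_or_ge s.card (j + 2) with h | h
  · rw [E_of_card_lt h]; nlinarith [sq_nonneg (E s (j + 1) l)]
  obtain ⟨m, hm⟩ := Nat.exists_eq_add_of_le h
  open Polynomial in
  set p : ℝ[X] := ∏ i ∈ s, (X + C (l i)) with hp
  have hs : p.Splits := by
    refine Polynomial.Splits.prod fun i _ => Polynomial.Splits.X_add_C _
  -- With `m = card - j - 2`, the derivatives of `∏ (X + l i)` of orders `m`, `m + 1`, `m + 2` at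
  -- `0` are factorials times `E (j + 2)`, `E (j + 1)`, `E j`.
  have hL := (hs.iterate_derivative_real m).laguerre 0
  rw [← Function.iterate_succ_apply' Polynomial.derivative,
    ← Function.iterate_succ_apply' Polynomial.derivative] at hL
  simp only [← Polynomial.coeff_zero_eq_eval_zero, Polynomial.coeff_iterate_derivative,
    Nat.succ_eq_add_one, zero_add, nsmul_eq_mul] at hL
  have hc : ∀ a ≤ s.card, p.coeff a = E s (s.card - a) l := fun a ha => by
    rw [hp, Finset.prod_X_add_C_coeff _ _ ha]; rfl
  rw [hc _ (by omega), hc _ (by omega), hc _ (by omega), Nat.descFactorial_self,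
    Nat.descFactorial_self, Nat.descFactorial_self, show s.card - m = j + 2 by omega,
    show s.card - (m + 1) = j + 1 by omega, show s.card - (m + 1 + 1) = j by omega] at hL
  have hf : (0 : ℝ) < (m.factorial : ℝ) := by positivity
  rw [Nat.factorial_succ (m + 1), Nat.factorial_succ m] at hL
  push_cast at hL
  -- The factor `m! · (m + 2)! / (m + 1)!² = (m + 2)/(m + 1)` is at least one, so it can be
  -- discarded afterwards.
  have h2 : ((m : ℝ) + 1 + 1) * (E s (j + 2) l * E s j l) ≤ (m + 1) * E s (j + 1) l ^ 2 := by
    have : 0 < (m.factorial : ℝ) ^ 2 * (m + 1) := by positivity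
    refine le_of_mul_le_mul_left ?_ this
    nlinarith [hL]
  by_contra hcon
  push Not at hcon
  have hm0 : (0 : ℝ) ≤ m := m.cast_nonneg
  nlinarith [sq_nonneg (E s (j + 1) l), mul_nonneg hm0 (sub_nonneg.2 hcon.le)]

/-- The Gårding cone `Γ_k`. -/
def Gar (s : Finset ι) (k : ℕ) (l : ι → ℝ) : Prop := ∀ j, 1 ≤ j → j ≤ k → 0 < E s j l

theorem Gar.pos {s : Finset ι} {k : ℕ} {l : ι → ℝ} (h : Gar s k l) {j : ℕ} (hj : j ≤ k) :
    0 < E s j l := by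
  rcases Nat.eq_zero_or_pos j with rfl | h0
  · rw [E_zero]; exact one_pos
  · exact h j h0 hj

theorem Gar.mono {s : Finset ι} {k k' : ℕ} {l : ι → ℝ} (h : Gar s k l) (hk : k' ≤ k) :
    Gar s k' l := fun j h1 h2 => h j h1 (h2.trans hk)

section Erase
variable [DecidableEq ι]

theorem E_succ_erase {s : Finset ι} {i : ι} (hi : i ∈ s) (j : ℕ) (l : ι → ℝ) :
    E s (j + 1) l = E (s.erase i) (j + 1) l + l i * E (s.erase i) j l := by
  conv_lhs => rw [← Finset.insert_erase hi]
  have hn : i ∉ s.erase i := Finset.notMem_erase i s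
  unfold E
  rw [Finset.powersetCard_succ_insert hn, Finset.sum_union, Finset.sum_image, Finset.mul_sum]
  · congr 1
    refine Finset.sum_congr rfl fun t ht => ?_
    rw [Finset.prod_insert fun h => hn ((Finset.mem_powersetCard.1 ht).1 h)]
  · intro t ht t' ht' h
    have h1 : i ∉ t := fun h => hn ((Finset.mem_powersetCard.1 ht).1 h)
    have h2 : i ∉ t' := fun h => hn ((Finset.mem_powersetCard.1 ht').1 h)
    rw [← Finset.erase_insert h1, ← Finset.erase_insert h2, h]
  · rw [Finset.disjoint_left]
    rintro t ht ht'
    obtain ⟨t', -, rfl⟩ := Finset.mem_image.1 ht'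
    exact hn ((Finset.mem_powersetCard.1 ht).1 (Finset.mem_insert_self i t'))

theorem mul_E_erase {s : Finset ι} {i : ι} (hi : i ∈ s) (j : ℕ) (l : ι → ℝ) :
    l i * E (s.erase i) j l =
      ∑ t ∈ s.powersetCard (j + 1), if i ∈ t then ∏ a ∈ t, l a else 0 := by
  have h1 := E_succ_erase hi j l
  have h2 : E (s.erase i) (j + 1) l =
      ∑ t ∈ s.powersetCard (j + 1), if i ∈ t then 0 else ∏ a ∈ t, l a := by
    unfold E
    rw [Finset.sum_ite, Finset.sum_const_zero, zero_add]
    refine Finset.sum_congr ?_ fun _ _ => rfl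
    ext t
    simp only [Finset.mem_powersetCard, Finset.mem_filter, Finset.subset_erase]
    tauto
  have h3 : E s (j + 1) l = (∑ t ∈ s.powersetCard (j + 1), if i ∈ t then ∏ a ∈ t, l a else 0) +
      ∑ t ∈ s.powersetCard (j + 1), if i ∈ t then 0 else ∏ a ∈ t, l a := by
    rw [← Finset.sum_add_distrib]
    refine Finset.sum_congr rfl fun t _ => ?_
    split_ifs <;> simp
  linarith

theorem sum_mul_E_erase (s : Finset ι) (j : ℕ) (l : ι → ℝ) :
    ∑ i ∈ s, l i * E (s.erase i) j l = (j + 1) * E s (j + 1) l := by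
  rw [Finset.sum_congr rfl fun i hi => mul_E_erase hi j l, Finset.sum_comm, E, Finset.mul_sum]
  refine Finset.sum_congr rfl fun t ht => ?_
  obtain ⟨hts, htc⟩ := Finset.mem_powersetCard.1 ht
  rw [← Finset.sum_filter, Finset.sum_const, Finset.filter_mem_eq_inter,
    Finset.inter_eq_right.2 hts, htc]
  simp

/-- Let `a > 0`, `b`, `c` be consecutive symmetric functions with `l i` left out. If `b ≤ 0`, then
`b + l i * a > 0` forces `l i > 0`. Together with `c + l i * b > 0` this gives `c a > -(l i) a b ≥
b²`, against Newton's inequality. -/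
theorem Gar.erase {s : Finset ι} {k : ℕ} {l : ι → ℝ} (h : Gar s (k + 1) l) {i : ι} (hi : i ∈ s) :
    Gar (s.erase i) k l := by
  have key : ∀ j ≤ k, 0 < E (s.erase i) j l := by
    intro j
    induction j with
    | zero => intro _; rw [E_zero]; exact one_pos
    | succ j ih =>
      intro hj
      have h0 := ih (by omega)
      have h1 := h.pos (show j + 1 ≤ k + 1 by omega)
      have h2 := h.pos (show j + 1 + 1 ≤ k + 1 by omega)
      rw [E_succ_erase hi] at h1 h2
      have hN := newton (s.erase i) l j
      by_contra hcon
      push Not at hcon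
      have hl : 0 < l i := by
        by_contra hl
        push Not at hl
        nlinarith [mul_nonneg (neg_nonneg.2 hl) h0.le]
      nlinarith [mul_nonneg (neg_nonneg.2 hcon) h1.le, mul_pos h2 h0]
  exact fun j _ hj => key j hj

end Erase
end ElemSymm

/-- Mahler's inequality: the geometric mean is superadditive. -/
theorem geom_mean_superadditive {ι : Type*} (s : Finset ι) (hs : s.Nonempty) (a b : ι → ℝ)
    (ha : ∀ i ∈ s, 0 < a i) (hb : ∀ i ∈ s, 0 < b i) :
    (∏ i ∈ s, a i) ^ (s.card : ℝ)⁻¹ + (∏ i ∈ s, b i) ^ (s.card : ℝ)⁻¹ ≤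
      (∏ i ∈ s, (a i + b i)) ^ (s.card : ℝ)⁻¹ := by
  have hc : (0 : ℝ) < s.card := by exact_mod_cast hs.card_pos
  -- Arithmetic–geometric mean for the ratios `c i / (a i + b i)`. For `c = a` and `c = b` the
  -- right-hand sides add up to the full geometric mean.
  have key : ∀ c : ι → ℝ, (∀ i ∈ s, 0 < c i) → (∏ i ∈ s, c i) ^ (s.card : ℝ)⁻¹ ≤
      (∏ i ∈ s, (a i + b i)) ^ (s.card : ℝ)⁻¹ * ∑ i ∈ s, (s.card : ℝ)⁻¹ * (c i / (a i + b i)) := by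
    intro c hcp
    have hp : ∀ i ∈ s, 0 < a i + b i := fun i hi => add_pos (ha i hi) (hb i hi)
    have h := Real.geom_mean_le_arith_mean_weighted s (fun _ => (s.card : ℝ)⁻¹)
      (fun i => c i / (a i + b i)) (fun _ _ => by positivity)
      (by simp [hc.ne']) (fun i hi => (div_pos (hcp i hi) (hp i hi)).le)
    rw [Real.finsetProd_rpow _ _ (fun i hi => (div_pos (hcp i hi) (hp i hi)).le),
      Finset.prod_div_distrib, Real.div_rpow (Finset.prod_nonneg fun i hi => (hcp i hi).le)
      (Finset.prod_nonneg fun i hi => (hp i hi).le),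
      div_le_iff₀ (Real.rpow_pos_of_pos (Finset.prod_pos hp) _)] at h
    linarith
  have h1 := key a ha
  have h2 := key b hb
  have h3 : ∑ i ∈ s, (s.card : ℝ)⁻¹ * (a i / (a i + b i)) +
      ∑ i ∈ s, (s.card : ℝ)⁻¹ * (b i / (a i + b i)) = 1 := by
    rw [← Finset.sum_add_distrib, Finset.sum_congr rfl (g := fun _ => (s.card : ℝ)⁻¹)]
    · simp [hc.ne']
    · intro i hi
      have := add_pos (ha i hi) (hb i hi)
      field_simp
  calc _ ≤ _ := add_le_add h1 h2
    _ = _ := by rw [← mul_add, h3, mul_one]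

/-! ### Superadditivity of quotients of symmetric functions -/

namespace ElemSymm
variable {ι : Type*}

theorem sq_div_add_le {a b x y z : ℝ} (hx : 0 < x) (hy : 0 < y) (hz : x + y ≤ z) :
    (a + b) ^ 2 / z ≤ a ^ 2 / x + b ^ 2 / y := by
  calc (a + b) ^ 2 / z ≤ (a + b) ^ 2 / (x + y) := by gcongr
    _ ≤ a ^ 2 / x + b ^ 2 / y := by
      rw [div_add_div _ _ hx.ne' hy.ne', div_le_div_iff₀ (by positivity) (by positivity)]
      nlinarith [sq_nonneg (a * y - b * x), mul_pos hx hy]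

/-- The quotient `σ_{k+1} / σ_k`. -/
noncomputable def Q (s : Finset ι) (k : ℕ) (l : ι → ℝ) : ℝ := E s (k + 1) l / E s k l

/-- This recursion expresses the next quotient through quotients with one variable fewer.
Superadditivity passes through it because `x² / y` is subadditive in `(x, y)` and decreasing in `y >
0`. -/
theorem Q_succ_eq [DecidableEq ι] {s : Finset ι} {k : ℕ} {l : ι → ℝ} (h1 : 0 < E s (k + 1) l)
    (h2 : ∀ i ∈ s, 0 < E (s.erase i) k l) :
    (k + 2) * Q s (k + 1) l = ∑ i ∈ s, (l i - l i ^ 2 / (l i + Q (s.erase i) k l)) := by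
  have h := sum_mul_E_erase s (k + 1) l
  push_cast at h
  rw [Q, ← mul_div_assoc, show (k : ℝ) + 2 = k + 1 + 1 by ring, ← h, Finset.sum_div]
  refine Finset.sum_congr rfl fun i hi => ?_
  have h3 := h2 i hi
  have h4 := E_succ_erase hi k l
  have h5 : l i + Q (s.erase i) k l = E s (k + 1) l / E (s.erase i) k l := by
    rw [Q, h4]; field_simp; ring
  rw [h5]
  field_simp
  rw [h4]; ring

/-- Both claims are proved in one induction. Superadditivity of the lower quotients on the erased
sets feeds `Q_succ_eq`; the resulting lower bound makes the next quotient of `l + m` positive, and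
this is the one missing condition for `l + m` to lie in the next cone. -/
theorem Gar.add_and_Q_superadditive (k : ℕ) : ∀ (s : Finset ι) (l m : ι → ℝ), Gar s (k + 1) l →
    Gar s (k + 1) m → Gar s (k + 1) (l + m) ∧ Q s k l + Q s k m ≤ Q s k (l + m) := by
  classical
  induction k with
  | zero =>
    intro s l m hl hm
    have h1 := hl 1 le_rfl le_rfl
    have h2 := hm 1 le_rfl le_rfl
    rw [E_one] at h1 h2
    refine ⟨fun j hj hj' => ?_, ?_⟩
    · obtain rfl : j = 1 := by omega
      rw [E_one]
      simpa [Finset.sum_add_distrib] using add_pos h1 h2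
    · simp [Q, E_one, E_zero, Finset.sum_add_distrib]
  | succ k ih =>
    intro s l m hl hm
    have hs := (ih s l m (hl.mono (by omega)) (hm.mono (by omega))).1
    have he := fun i (hi : i ∈ s) => ih (s.erase i) l m (hl.erase hi) (hm.erase hi)
    have hQ : Q s (k + 1) l + Q s (k + 1) m ≤ Q s (k + 1) (l + m) := by
      have hk : (0 : ℝ) < k + 2 := by positivity
      refine le_of_mul_le_mul_left ?_ hk
      rw [mul_add, Q_succ_eq (hl.pos (by omega)) fun i hi => (hl.erase hi).pos (by omega),
        Q_succ_eq (hm.pos (by omega)) fun i hi => (hm.erase hi).pos (by omega),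
        Q_succ_eq (hs.pos (by omega)) fun i hi => (he i hi).1.pos (by omega),
        ← Finset.sum_add_distrib]
      refine Finset.sum_le_sum fun i hi => ?_
      have hy : ∀ l' : ι → ℝ, Gar s (k + 1 + 1) l' → 0 < l' i + Q (s.erase i) k l' := by
        intro l' h'
        have h1 := (h'.erase hi).pos (show k ≤ k + 1 by omega)
        have h2 := h'.pos (show k + 1 ≤ k + 1 + 1 by omega)
        rw [E_succ_erase hi] at h2
        rw [Q, ← mul_pos_iff_of_pos_right h1]
        field_simp
        linarith
      have := sq_div_add_le (a := l i) (b := m i) (hy l hl) (hy m hm)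
        (z := (l + m) i + Q (s.erase i) k (l + m)) (by
          have := (he i hi).2
          simp only [Pi.add_apply]; linarith)
      simp only [Pi.add_apply] at this ⊢
      linarith
    refine ⟨fun j hj hj' => ?_, hQ⟩
    rcases Nat.lt_or_ge j (k + 2) with h | h
    · exact hs j hj (by omega)
    · obtain rfl : j = k + 1 + 1 := by omega
      have h1 : 0 < Q s (k + 1) (l + m) := lt_of_lt_of_le (add_pos
        (div_pos (hl.pos (by omega)) (hl.pos (by omega)))
        (div_pos (hm.pos (by omega)) (hm.pos (by omega)))) hQ
      have h2 := hs.pos (show k + 1 ≤ k + 1 by omega)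
      rw [Q, div_pos_iff_of_pos_right h2] at h1
      exact h1

theorem Gar.add {s : Finset ι} {k : ℕ} {l m : ι → ℝ} (hl : Gar s k l) (hm : Gar s k m) :
    Gar s k (l + m) := by
  cases k with
  | zero => intro j h1 h2; omega
  | succ k => exact (Gar.add_and_Q_superadditive k s l m hl hm).1

theorem Gar.smul {s : Finset ι} {k : ℕ} {l : ι → ℝ} (hl : Gar s k l) {c : ℝ} (hc : 0 < c) :
    Gar s k (c • l) := fun j h1 h2 => by
  rw [E_smul]; exact mul_pos (pow_pos hc j) (hl j h1 h2)

/-- The function `(σ_{m+2} / σ_1)^{1/(m+1)}`. -/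
noncomputable def G (s : Finset ι) (m : ℕ) (l : ι → ℝ) : ℝ :=
  (E s (m + 2) l / E s 1 l) ^ ((m + 1 : ℕ) : ℝ)⁻¹

theorem prod_Q {s : Finset ι} {m : ℕ} {l : ι → ℝ} (hl : Gar s (m + 2) l) :
    ∏ j ∈ Finset.range (m + 1), Q s (j + 1) l = E s (m + 2) l / E s 1 l := by
  induction m with
  | zero => simp [Q]
  | succ m ih =>
    rw [Finset.prod_range_succ, ih (hl.mono (by omega)), Q]
    have := hl.pos (show m + 2 ≤ m + 1 + 2 by omega)
    have := hl.pos (show 1 ≤ m + 1 + 2 by omega)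
    field_simp

/-- By `prod_Q`, `G` is the geometric mean of `m + 1` superadditive quotients, so Mahler's
inequality applies. -/
theorem G_superadditive {s : Finset ι} {m : ℕ} {l l' : ι → ℝ} (hl : Gar s (m + 2) l)
    (hl' : Gar s (m + 2) l') : G s m l + G s m l' ≤ G s m (l + l') := by
  have hpos : ∀ l : ι → ℝ, Gar s (m + 2) l → ∀ j ∈ Finset.range (m + 1), 0 < Q s (j + 1) l := by
    intro l hl j hj
    rw [Finset.mem_range] at hj
    exact div_pos (hl.pos (by omega)) (hl.pos (by omega))
  have h := geom_mean_superadditive (Finset.range (m + 1)) (by simp) _ _ (hpos l hl) (hpos l' hl')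
  rw [Finset.card_range, prod_Q hl, prod_Q hl'] at h
  refine h.trans ?_
  rw [G, ← prod_Q (hl.add hl')]
  refine Real.rpow_le_rpow (Finset.prod_nonneg fun j hj => ?_)
    (Finset.prod_le_prod (fun j hj => ?_) fun j hj => ?_) (by positivity)
  · exact (add_pos (hpos l hl j hj) (hpos l' hl' j hj)).le
  · exact (add_pos (hpos l hl j hj) (hpos l' hl' j hj)).le
  · rw [Finset.mem_range] at hj
    exact (Gar.add_and_Q_superadditive (j + 1) s l l' (hl.mono (by omega))
      (hl'.mono (by omega))).2

theorem G_pos {s : Finset ι} {m : ℕ} {l : ι → ℝ} (hl : Gar s (m + 2) l) : 0 < G s m l :=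
  Real.rpow_pos_of_pos (div_pos (hl.pos le_rfl) (hl.pos (by omega))) _

theorem G_smul {s : Finset ι} {m : ℕ} {l : ι → ℝ} (hl : Gar s (m + 2) l) {c : ℝ} (hc : 0 < c) :
    G s m (c • l) = c * G s m l := by
  have h : E s (m + 2) (c • l) / E s 1 (c • l) = c ^ (m + 1) * (E s (m + 2) l / E s 1 l) := by
    have := hl.pos (show 1 ≤ m + 2 by omega)
    rw [E_smul, E_smul]; field_simp; ring
  rw [G, h, Real.mul_rpow (by positivity) (div_pos (hl.pos le_rfl) (hl.pos (by omega))).le,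
    Real.pow_rpow_inv_natCast hc.le (by omega), G]

theorem differentiable_E [Fintype ι] (s : Finset ι) (j : ℕ) : Differentiable ℝ (E s j) := by
  unfold E
  fun_prop

theorem differentiableAt_G [Fintype ι] {s : Finset ι} {m : ℕ} {l : ι → ℝ} (hl : Gar s (m + 2) l) :
    DifferentiableAt ℝ (G s m) l := by
  have h1 := hl.pos (show 1 ≤ m + 2 by omega)
  have h2 := hl.pos (show m + 2 ≤ m + 2 from le_rfl)
  unfold G
  simp only [div_eq_mul_inv]
  exact (((differentiable_E s _).differentiableAt).mul
    (((differentiable_E s _).differentiableAt).inv h1.ne')).rpow_const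
    (Or.inl (mul_pos h2 (inv_pos.2 h1)).ne')

end ElemSymm

/-! ### The operator on sums of curvatures: supergradient and Schur–Horn -/

open StarShapedHypersurface

namespace ElemSymm
variable {n : ℕ}

/-- The subsets of `Fin n` with `p` elements. -/
abbrev idx (n p : ℕ) : Finset (Finset (Fin n)) := Finset.univ.powersetCard p

/-- The sums of `κ` over the subsets of `Fin n`. -/
def sums (κ : Fin n → ℝ) (t : Finset (Fin n)) : ℝ := ∑ i ∈ t, κ i

theorem sums_add (κ μ : Fin n → ℝ) : sums (κ + μ) = sums κ + sums μ := by
  funext t; simp [sums, Finset.sum_add_distrib]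

theorem sums_smul (c : ℝ) (κ : Fin n → ℝ) : sums (c • κ) = c • sums κ := by
  funext t; simp [sums, Finset.mul_sum]

theorem esymm_Lam (p j : ℕ) (κ : Fin n → ℝ) :
    (Lam p (Finset.univ.val.map κ)).esymm j = E (idx n p) j (sums κ) := by
  rw [E_eq_esymm]
  congr 1
  rw [Lam, Multiset.powersetCard_map, Multiset.map_map]
  change _ = Multiset.map _ (Finset.powersetCard p Finset.univ).val
  rw [← Finset.map_val_val_powersetCard, Multiset.map_map]
  rfl

/-- Each index lies in `(n - 1).choose (p - 1)` subsets of size `p`. This identity turns `σ_1(Λ)`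
into a multiple of the mean curvature. -/
theorem E_one_sums {p : ℕ} (hp : 1 ≤ p) (κ : Fin n → ℝ) :
    E (idx n p) 1 (sums κ) = ((n - 1).choose (p - 1) : ℝ) * ∑ i, κ i := by
  obtain ⟨j, rfl⟩ := Nat.exists_eq_add_of_le' hp
  have h1 : ∀ i : Fin n, (∑ t ∈ idx n (j + 1), if i ∈ t then (1 : ℝ) else 0) =
      (n - 1).choose j := fun i => by
    have h := mul_E_erase (Finset.mem_univ i) j (fun _ => (1 : ℝ))
    simp only [Finset.prod_const_one] at h
    rw [← h, E]
    simp
  have h2 : ∀ t : Finset (Fin n), sums κ t = ∑ i, (if i ∈ t then (1 : ℝ) else 0) * κ i := fun t => by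
    simp [sums]
  rw [E_one, Finset.sum_congr rfl fun t _ => h2 t, Finset.sum_comm, Finset.mul_sum]
  refine Finset.sum_congr rfl fun i _ => ?_
  rw [← Finset.sum_mul, h1, Nat.add_sub_cancel]

theorem E_sums_perm (p j : ℕ) (κ : Fin n → ℝ) (σ : Equiv.Perm (Fin n)) :
    E (idx n p) j (sums (κ ∘ σ)) = E (idx n p) j (sums κ) := by
  rw [← esymm_Lam, ← esymm_Lam]
  congr 2
  rw [← Multiset.map_map]
  congr 1
  have := Finset.map_univ_equiv σ
  exact congrArg Finset.val this

theorem differentiable_sums : Differentiable ℝ (sums (n := n)) := by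
  unfold sums
  fun_prop

/-- `F` is the gradient at `κ`. Differentiating `G(κ + tμ) ≥ G(κ) + t G(μ)` at `t = 0` gives the
upper bound, homogeneity gives Euler's relation, and `F i ≥ 0` because the coordinate vectors lie in
the closure of the cone. -/
theorem exists_supergradient {p m : ℕ} (hp : 1 ≤ p) {κ : Fin n → ℝ}
    (hκ : Gar (idx n p) (m + 2) (sums κ)) :
    ∃ F : Fin n → ℝ, (∀ i, 0 ≤ F i) ∧ ∑ i, F i * κ i = G (idx n p) m (sums κ) ∧
      ∀ μ : Fin n → ℝ, Gar (idx n p) (m + 2) (sums μ) →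
        G (idx n p) m (sums μ) ≤ ∑ i, F i * μ i := by
  set g : (Fin n → ℝ) → ℝ := fun μ => G (idx n p) m (sums μ) with hg
  have hd : DifferentiableAt ℝ g κ :=
    DifferentiableAt.comp (g := G (idx n p) m) κ (differentiableAt_G hκ)
      differentiable_sums.differentiableAt
  set L := fderiv ℝ g κ with hL
  have hline : ∀ μ, HasDerivAt (fun t : ℝ => g (κ + t • μ)) (L μ) 0 := fun μ => by
    have h1 : HasDerivAt (fun t : ℝ => κ + t • μ) μ 0 := by
      simpa using ((hasDerivAt_id (0 : ℝ)).smul_const μ).const_add κ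
    have h2 : HasFDerivAt g L (κ + (0 : ℝ) • μ) := by simpa using hd.hasFDerivAt
    exact h2.comp_hasDerivAt 0 h1
  have hsuper : ∀ μ, Gar (idx n p) (m + 2) (sums μ) → g μ ≤ L μ := by
    intro μ hμ
    have h1 : HasDerivWithinAt (fun t : ℝ => g (κ + t • μ) - t * g μ) (L μ - g μ) (Set.Ici 0) 0 := by
      simpa using ((hline μ).fun_sub ((hasDerivAt_id (0 : ℝ)).mul_const (g μ))).hasDerivWithinAt
    have h2 : ∀ t ∈ Set.Ici (0 : ℝ), g (κ + (0 : ℝ) • μ) - 0 * g μ ≤ g (κ + t • μ) - t * g μ := by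
      intro t ht
      rcases (Set.mem_Ici.1 ht).eq_or_lt with rfl | ht
      · simp
      · have := G_superadditive hκ (hμ.smul ht)
        rw [G_smul hμ ht, ← sums_smul, ← sums_add] at this
        simp only [zero_smul, add_zero, zero_mul, sub_zero]
        simp only [hg]
        linarith
    have h3 : (0 : ℝ) ≤ L μ - g μ := by
      have : (nhdsWithin (0 : ℝ) (Set.Ici 0 \ {0})).NeBot := by
        rw [Set.Ici_sdiff_left]; infer_instance
      refine ge_of_tendsto (hasDerivWithinAt_iff_tendsto_slope.1 h1) ?_
      filter_upwards [self_mem_nhdsWithin] with t ht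
      have ht0 : 0 < t := lt_of_le_of_ne ht.1 (Ne.symm ht.2)
      rw [slope_def_field]
      exact div_nonneg (sub_nonneg.2 (h2 t ht0.le)) (by simpa using ht0.le)
    linarith
  have hsum : ∀ μ : Fin n → ℝ, L μ = ∑ i, L (Pi.single i 1) * μ i := fun μ => by
    conv_lhs => rw [pi_eq_sum_univ' μ]
    simp only [map_sum, map_smul, smul_eq_mul]
    refine Finset.sum_congr rfl fun i _ => ?_
    rw [mul_comm]
  refine ⟨fun i => L (Pi.single i 1), fun i => ?_, ?_, fun μ hμ => ?_⟩
  · have hpos : ∀ ε : ℝ, 0 < ε → 0 ≤ L (Pi.single i 1) + ε * L 1 := by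
      intro ε hε
      -- All entries of this vector are positive, and so are all its `p`-sums. The index sets of the
      -- symmetric functions are nonempty because those functions are positive at `κ`.
      have hmem : Gar (idx n p) (m + 2) (sums (Pi.single i 1 + ε • (1 : Fin n → ℝ))) := by
        intro j h1 h2
        refine Finset.sum_pos (fun T hT => Finset.prod_pos fun t ht => ?_) ?_
        · have hc := (Finset.mem_powersetCard.1 ((Finset.mem_powersetCard.1 hT).1 ht)).2
          refine Finset.sum_pos (fun a _ => ?_) (Finset.card_pos.1 (by omega))
          have : (0 : ℝ) ≤ (Pi.single i 1 : Fin n → ℝ) a := by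
            by_cases h : a = i
            · subst h; simp
            · simp [h]
          simp only [Pi.add_apply, Pi.smul_apply, Pi.one_apply, smul_eq_mul, mul_one]
          linarith
        · by_contra hne
          rw [Finset.not_nonempty_iff_eq_empty] at hne
          have := hκ j h1 h2
          simp [E, hne] at this
      have := (G_pos hmem).le.trans (hsuper _ hmem)
      simpa using this
    by_contra hneg
    push Not at hneg
    -- This `ε` makes `ε * L 1` at most half of `-L (Pi.single i 1)`, so the sum in `hpos` would be
    -- negative.
    have h1 := hpos (-L (Pi.single i 1) / (2 * (|L 1| + 1))) (by
      have := abs_nonneg (L 1); apply div_pos <;> linarith)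
    have h2 : -L (Pi.single i 1) / (2 * (|L 1| + 1)) * L 1 ≤ -L (Pi.single i 1) / 2 := by
      rw [div_mul_eq_mul_div, div_le_div_iff₀ (by positivity) (by norm_num)]
      nlinarith [le_abs_self (L 1), abs_nonneg (L 1)]
    linarith
  · rw [← hsum]
    have h1 := hline κ
    have h2 : HasDerivAt (fun t : ℝ => (1 + t) * g κ) (g κ) 0 := by
      simpa using ((hasDerivAt_id (0 : ℝ)).const_add 1).mul_const (g κ)
    refine h1.unique (h2.congr_of_eventuallyEq ?_)
    filter_upwards [lt_mem_nhds (show (-1 : ℝ) < 0 by norm_num)] with t ht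
    have := G_smul hκ (show 0 < 1 + t by linarith)
    rw [← sums_smul, add_smul, one_smul] at this
    exact this
  · rw [← hsum]; exact hsuper μ hμ

/-- Comparison of a concave symmetric function of the eigenvalues with a linear function of the
diagonal entries (Schur–Horn). -/
theorem G_eigenvalues_le {p m : ℕ} {A : Matrix (Fin n) (Fin n) ℝ} (hA : A.IsHermitian)
    (hK : Gar (idx n p) (m + 2) (sums hA.eigenvalues)) {F : Fin n → ℝ}
    (hF : ∀ μ : Fin n → ℝ, Gar (idx n p) (m + 2) (sums μ) →
      G (idx n p) m (sums μ) ≤ ∑ i, F i * μ i) :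
    G (idx n p) m (sums hA.eigenvalues) ≤ ∑ i, F i * A i i := by
  set κ := hA.eigenvalues with hκ
  -- The inequality is linear in `D`, hence by Birkhoff it need only be checked at permutation
  -- matrices, where it is the supergradient bound for the permuted eigenvalues. The diagonal of `A`
  -- comes from `D = (U i j ^ 2)`.
  have hmain : ∀ D ∈ doublyStochastic ℝ (Fin n),
      G (idx n p) m (sums κ) ≤ ∑ i, F i * ∑ j, D i j * κ j := by
    intro D hD
    rw [← SetLike.mem_coe, doublyStochastic_eq_convexHull_permMatrix] at hD
    have hconv : Convex ℝ {D : Matrix (Fin n) (Fin n) ℝ |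
        G (idx n p) m (sums κ) ≤ ∑ i, F i * ∑ j, D i j * κ j} := by
      refine convex_halfSpace_ge ⟨fun D D' => ?_, fun c D => ?_⟩ _
      · simp [add_mul, Finset.sum_add_distrib, mul_add]
      · simp only [Matrix.smul_apply, smul_eq_mul, Finset.mul_sum]
        refine Finset.sum_congr rfl fun i _ => Finset.sum_congr rfl fun j _ => by ring
    refine convexHull_min ?_ hconv hD
    rintro _ ⟨σ, rfl⟩
    have h1 : ∀ i, ∑ j, (σ.permMatrix ℝ) i j * κ j = (κ ∘ σ) i := fun i => by
      simp [Equiv.Perm.permMatrix, PEquiv.toMatrix_apply]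
    simp only [Set.mem_ofPred_eq, h1]
    have h2 : Gar (idx n p) (m + 2) (sums (κ ∘ σ)) := fun j hj hj' => by
      rw [E_sums_perm]; exact hK j hj hj'
    have h3 := hF _ h2
    rwa [G, E_sums_perm, E_sums_perm] at h3
  have hU := hA.eigenvectorUnitary.2
  set U : Matrix (Fin n) (Fin n) ℝ := hA.eigenvectorUnitary.1 with hUdef
  have h1 : U * star U = 1 := (Matrix.mem_unitaryGroup_iff).1 hU
  have h2 : star U * U = 1 := (Matrix.mem_unitaryGroup_iff').1 hU
  have hD := hmain (Matrix.of fun i j => U i j ^ 2) (by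
    rw [mem_doublyStochastic_iff_sum]
    refine ⟨fun i j => sq_nonneg _, fun i => ?_, fun j => ?_⟩
    · have := congrFun (congrFun h1 i) i
      simpa [Matrix.mul_apply, Matrix.star_eq_conjTranspose, sq] using this
    · have := congrFun (congrFun h2 j) j
      simpa [Matrix.mul_apply, Matrix.star_eq_conjTranspose, sq] using this)
  refine hD.trans (le_of_eq (Finset.sum_congr rfl fun i _ => ?_))
  congr 1
  conv_rhs => rw [hA.spectral_theorem]
  rw [Unitary.conjStarAlgAut_apply, ← hUdef]
  simp only [Matrix.mul_apply, Matrix.of_apply, Matrix.star_eq_conjTranspose,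
    Matrix.conjTranspose_apply, star_trivial]
  refine Finset.sum_congr rfl fun j _ => ?_
  rw [← hκ]
  simp [Matrix.diagonal_apply]; ring

end ElemSymm

/-! ### Second-order jets of functions of one variable -/

open Filter Topology

/-- `f` is twice differentiable at `0` with `f 0 = a`, `f' 0 = b`, `f'' 0 = c`. -/
def HasJet (f : ℝ → ℝ) (a b c : ℝ) : Prop :=
  f 0 = a ∧ ∃ f' : ℝ → ℝ, (∀ᶠ t in 𝓝 0, HasDerivAt f (f' t) t) ∧ f' 0 = b ∧ HasDerivAt f' c 0

namespace HasJet
variable {f g : ℝ → ℝ} {a b c a' b' c' : ℝ}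

theorem value (h : HasJet f a b c) : f 0 = a := h.1

theorem hasDerivAt (h : HasJet f a b c) : HasDerivAt f b 0 := by
  obtain ⟨-, f', h1, h2, -⟩ := h
  rw [← h2]; exact h1.self_of_nhds

theorem const (a : ℝ) : HasJet (fun _ => a) a 0 0 :=
  ⟨rfl, fun _ => 0, .of_forall fun t => hasDerivAt_const t a, rfl, hasDerivAt_const _ _⟩

theorem id : HasJet (fun t => t) 0 1 0 :=
  ⟨rfl, fun _ => 1, .of_forall fun t => hasDerivAt_id t, rfl, hasDerivAt_const _ _⟩

theorem congr (h : HasJet f a b c) (hg : g =ᶠ[𝓝 0] f) : HasJet g a b c := by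
  obtain ⟨h0, f', h1, h2, h3⟩ := h
  refine ⟨hg.self_of_nhds.trans h0, f', ?_, h2, h3⟩
  filter_upwards [h1, hg.eventuallyEq_nhds] with t ht ht'
  exact ht.congr_of_eventuallyEq ht'

theorem cast (h : HasJet f a b c) (ha : a = a') (hb : b = b') (hc : c = c') :
    HasJet f a' b' c' := by subst ha hb hc; exact h

theorem add (hf : HasJet f a b c) (hg : HasJet g a' b' c') :
    HasJet (fun t => f t + g t) (a + a') (b + b') (c + c') := by
  obtain ⟨h0, f', h1, h2, h3⟩ := hf
  obtain ⟨k0, g', k1, k2, k3⟩ := hg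
  refine ⟨by simp [h0, k0], fun t => f' t + g' t, ?_, by simp [h2, k2], h3.fun_add k3⟩
  filter_upwards [h1, k1] with t ht kt using ht.fun_add kt

theorem mul (hf : HasJet f a b c) (hg : HasJet g a' b' c') :
    HasJet (fun t => f t * g t) (a * a') (b * a' + a * b') (c * a' + 2 * b * b' + a * c') := by
  have hf0 := hf.hasDerivAt
  have hg0 := hg.hasDerivAt
  obtain ⟨h0, f', h1, h2, h3⟩ := hf
  obtain ⟨k0, g', k1, k2, k3⟩ := hg
  refine ⟨by simp [h0, k0], fun t => f' t * g t + f t * g' t, ?_, by simp [h0, k0, h2, k2], ?_⟩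
  · filter_upwards [h1, k1] with t ht kt using ht.fun_mul kt
  · have := (h3.fun_mul hg0).fun_add (hf0.fun_mul k3)
    rw [h0, k0, h2, k2] at this
    exact this.congr_deriv (by ring)

theorem const_mul (k : ℝ) (hf : HasJet f a b c) :
    HasJet (fun t => k * f t) (k * a) (k * b) (k * c) :=
  ((const k).mul hf).cast rfl (by ring) (by ring)

theorem neg (hf : HasJet f a b c) : HasJet (fun t => -f t) (-a) (-b) (-c) :=
  ((hf.const_mul (-1)).cast (by ring) (by ring) (by ring)).congr (.of_forall fun t => by ring)

theorem sub (hf : HasJet f a b c) (hg : HasJet g a' b' c') :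
    HasJet (fun t => f t - g t) (a - a') (b - b') (c - c') :=
  ((hf.add hg.neg).cast (by ring) (by ring) (by ring)).congr (.of_forall fun t => by ring)

theorem sum {ι : Type*} (s : Finset ι) {f : ι → ℝ → ℝ} {a b c : ι → ℝ}
    (h : ∀ i ∈ s, HasJet (f i) (a i) (b i) (c i)) :
    HasJet (fun t => ∑ i ∈ s, f i t) (∑ i ∈ s, a i) (∑ i ∈ s, b i) (∑ i ∈ s, c i) := by
  classical
  induction s using Finset.induction_on with
  | empty => simpa using const 0
  | insert i s hi ih =>
    simp only [Finset.sum_insert hi]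
    exact (h i (Finset.mem_insert_self i s)).add
      (ih fun j hj => h j (Finset.mem_insert_of_mem hj))

theorem comp {φ φ' : ℝ → ℝ} {e : ℝ} (hf : HasJet f a b c)
    (hφ : ∀ᶠ s in 𝓝 a, HasDerivAt φ (φ' s) s) (hφ' : HasDerivAt φ' e a) :
    HasJet (fun t => φ (f t)) (φ a) (φ' a * b) (e * b ^ 2 + φ' a * c) := by
  have hf0 := hf.hasDerivAt
  obtain ⟨h0, f', h1, h2, h3⟩ := hf
  refine ⟨by simp [h0], fun t => φ' (f t) * f' t, ?_, by simp [h0, h2], ?_⟩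
  · have hc : Tendsto f (𝓝 0) (𝓝 a) := by rw [← h0]; exact hf0.continuousAt
    filter_upwards [h1, hc.eventually hφ] with t ht kt using kt.comp t ht
  · have h4 : HasDerivAt (fun t => φ' (f t)) (e * b) 0 := by
      rw [← h0] at hφ'; exact hφ'.comp 0 hf0
    have := h4.fun_mul h3
    rw [h0, h2] at this
    exact this.congr_deriv (by ring)

theorem log (hf : HasJet f a b c) (ha : 0 < a) :
    HasJet (fun t => Real.log (f t)) (Real.log a) (b / a) (c / a - (b / a) ^ 2) := by
  refine (hf.comp (φ := Real.log) (φ' := fun s => s⁻¹) ?_ (hasDerivAt_inv ha.ne')).cast rfl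
    (by ring) (by field_simp; ring)
  filter_upwards [lt_mem_nhds ha] with s hs using Real.hasDerivAt_log hs.ne'

theorem exp (hf : HasJet f a b c) :
    HasJet (fun t => Real.exp (f t)) (Real.exp a) (Real.exp a * b) (Real.exp a * (c + b ^ 2)) :=
  (hf.comp (φ := Real.exp) (φ' := Real.exp) (.of_forall Real.hasDerivAt_exp)
    (Real.hasDerivAt_exp a)).cast rfl rfl (by ring)

theorem inv (hf : HasJet f a b c) (ha : 0 < a) :
    HasJet (fun t => (f t)⁻¹) a⁻¹ (-b / a ^ 2) (-c / a ^ 2 + 2 * b ^ 2 / a ^ 3) := by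
  have h2 : HasDerivAt (fun s : ℝ => -(s ^ 2)⁻¹) (2 * a / (a ^ 2) ^ 2) a := by
    have := ((hasDerivAt_pow 2 a).fun_inv (pow_ne_zero 2 ha.ne')).fun_neg
    exact this.congr_deriv (by push_cast; ring)
  refine (hf.comp (φ := fun s => s⁻¹) ?_ h2).cast rfl (by ring) (by field_simp; ring)
  filter_upwards [lt_mem_nhds ha] with s hs using hasDerivAt_inv hs.ne'

/-- Only `1 + |Dv|²` at a critical point of `v` is needed. The vanishing slope removes the second
derivative of the square root. -/
theorem sqrt (hf : HasJet f 1 0 c) : HasJet (fun t => √(f t)) 1 0 (c / 2) := by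
  have h1 : ∀ᶠ s in 𝓝 (1 : ℝ), HasDerivAt Real.sqrt (1 / (2 * √s)) s := by
    filter_upwards [lt_mem_nhds one_pos] with s hs using Real.hasDerivAt_sqrt hs.ne'
  have h2 : DifferentiableAt ℝ (fun s : ℝ => 1 / (2 * √s)) 1 := by
    have : DifferentiableAt ℝ Real.sqrt 1 := (Real.hasDerivAt_sqrt one_ne_zero).differentiableAt
    exact (differentiableAt_const _).fun_div (this.const_mul _) (by simp)
  exact (hf.comp h1 h2.hasDerivAt).cast (by simp) (by simp) (by simp; ring)

/-- First and second order conditions at a minimum. -/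
theorem of_isLocalMin (hf : HasJet f a b c) (hmin : IsLocalMin f 0) : b = 0 ∧ 0 ≤ c := by
  have hb : b = 0 := hmin.hasDerivAt_eq_zero hf.hasDerivAt
  refine ⟨hb, ?_⟩
  by_contra hc
  push Not at hc
  obtain ⟨h0, f', h1, h2, h3⟩ := hf
  have hd : deriv f =ᶠ[𝓝 0] f' := h1.mono fun t ht => ht.deriv
  -- If `c < 0`, the point is also a local maximum, so `f` is locally constant and `c = 0`.
  have hmax : IsLocalMax f 0 := by
    refine isLocalMax_of_deriv_deriv_neg ?_ ?_ h1.self_of_nhds.continuousAt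
    · rw [hd.deriv_eq, h3.deriv]; exact hc
    · rw [hd.self_of_nhds, h2, hb]
  have hconst : f =ᶠ[𝓝 0] fun _ => f 0 := by
    filter_upwards [hmin, hmax] with t h4 h5 using le_antisymm h5 h4
  have h6 : f' =ᶠ[𝓝 0] fun _ => 0 := by
    filter_upwards [hconst.eventuallyEq_nhds, h1] with t h4 h5
    exact h5.unique ((hasDerivAt_const t (f 0)).congr_of_eventuallyEq h4)
  have := h3.unique ((hasDerivAt_const 0 (0 : ℝ)).congr_of_eventuallyEq h6)
  exact hc.ne this

end HasJet

/-! ### The maximum principle as an algebraic inequality -/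

/-- The pointwise computation at the maximum of `log H - log u`: `T`, `Q` are the third and fourth
derivatives of the graph function, `a` is the tangential part of the position vector, `L1`, `L2`
are the derivatives of the logarithm of the prescribed function. -/
theorem curvature_bound_at_max {n : ℕ} {κ F a L1 L2 Hm HH um uu j1 j2 w2 : Fin n → ℝ}
    {T Q : Fin n → Fin n → ℝ} {H u Ψ β q : ℝ} (hH : 0 < H) (hu : 0 < u) (hΨ : 0 < Ψ)
    (hβ : 0 ≤ β) (hq : q ≤ 1) (hF : ∀ i, 0 ≤ F i) (hFκ : ∑ i, F i * κ i = Ψ)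
    (hHκ : H = ∑ i, κ i)
    (hQ : ∀ i j, Q i j = Q j i) (hHm : ∀ p, Hm p = ∑ i, T i p)
    (hHH : ∀ p, HH p = ∑ i, Q i p - H * κ p ^ 2 - 2 * κ p ^ 3)
    (huu : ∀ p, uu p = ∑ j, a j * T p j + κ p - u * κ p ^ 2)
    (hw1 : ∀ p, Hm p / H = um p / u)
    (hw2 : ∀ p, w2 p = (HH p / H - (Hm p / H) ^ 2) - (uu p / u - (um p / u) ^ 2))
    (hw2' : ∀ p, w2 p ≤ 0)
    (hj1 : ∀ m, j1 m = β * (L1 m + (q - 1) * (um m / u)))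
    (hj2 : ∀ m, j2 m = β * (L2 m + (q - 1) * (uu m / u - (um m / u) ^ 2) - w2 m))
    (hF1 : ∀ m, ∑ i, F i * T i m = Ψ * j1 m)
    (hF2 : ∀ m, Ψ * (j2 m + j1 m ^ 2) ≤
      ∑ i, F i * (Q i m - κ i * κ m ^ 2 - if i = m then 2 * κ i ^ 3 else 0)) :
    (∑ i, κ i ^ 2) / H ≤ 1 / u + β * (1 - q) / u + β * (∑ j, a j * L1 j) / u -
      β * (∑ m, L2 m) / H := by
  set A2 := ∑ i, κ i ^ 2 with hA2
  set S := ∑ j, a j * um j with hS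
  -- The second-order conditions are summed over all directions, and the squares `j1²` are dropped.
  have e1 : Ψ * ∑ m, j2 m ≤ ∑ i, F i * ∑ m, Q i m - Ψ * A2 - 2 * ∑ i, F i * κ i ^ 3 := by
    have h1 : ∑ m, Ψ * j2 m ≤ ∑ m, ∑ i, F i * (Q i m - κ i * κ m ^ 2 -
        if i = m then 2 * κ i ^ 3 else 0) :=
      Finset.sum_le_sum fun m _ => le_trans (by nlinarith [mul_nonneg hΨ.le (sq_nonneg (j1 m))])
        (hF2 m)
    rw [← Finset.mul_sum, Finset.sum_comm] at h1
    refine h1.trans (le_of_eq ?_)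
    simp only [← Finset.mul_sum, Finset.sum_sub_distrib, Finset.sum_ite_eq, Finset.mem_univ,
      if_true, ← hA2]
    rw [← hFκ, Finset.sum_mul, Finset.mul_sum, ← Finset.sum_sub_distrib, ← Finset.sum_sub_distrib]
    exact Finset.sum_congr rfl fun i _ => by ring
  -- The symmetry of `Q` turns the fourth-derivative term into the one in `e1`; the cubic terms
  -- agree as well.
  have e2 : ∑ p, F p * HH p = ∑ i, F i * ∑ m, Q i m - H * ∑ i, F i * κ i ^ 2 -
      2 * ∑ i, F i * κ i ^ 3 := by
    rw [Finset.mul_sum, Finset.mul_sum, ← Finset.sum_sub_distrib, ← Finset.sum_sub_distrib]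
    refine Finset.sum_congr rfl fun p _ => ?_
    rw [hHH, Finset.sum_congr rfl fun i _ => hQ i p]
    ring
  have e3 : ∑ p, F p * uu p = Ψ * (∑ j, a j * j1 j) + Ψ - u * ∑ i, F i * κ i ^ 2 := by
    have h1 : ∑ p, F p * ∑ j, a j * T p j = Ψ * ∑ j, a j * j1 j := by
      simp only [Finset.mul_sum]
      rw [Finset.sum_comm]
      refine Finset.sum_congr rfl fun j _ => ?_
      rw [show Ψ * (a j * j1 j) = a j * (Ψ * j1 j) by ring, ← hF1, Finset.mul_sum]
      exact Finset.sum_congr rfl fun i _ => by ring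
    rw [← h1, ← hFκ, Finset.mul_sum, ← Finset.sum_add_distrib, ← Finset.sum_sub_distrib]
    exact Finset.sum_congr rfl fun p _ => by rw [huu]; ring
  -- The first-order condition `hw1` makes the squared gradients in `w2` cancel, leaving a pure
  -- second-order inequality.
  have e4 : (∑ p, F p * HH p) / H - (∑ p, F p * uu p) / u ≤ 0 := by
    rw [Finset.sum_div, Finset.sum_div, ← Finset.sum_sub_distrib]
    refine Finset.sum_nonpos fun p _ => ?_
    have h1 := hw2' p
    rw [hw2, hw1] at h1
    have h2 : HH p / H - uu p / u ≤ 0 := by linarith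
    have := mul_nonneg (hF p) (neg_nonneg.2 h2)
    have h3 : F p * HH p / H - F p * uu p / u = -(F p * -(HH p / H - uu p / u)) := by ring
    rw [h3]; linarith
  -- The derivatives of `H` in `∑ uu` are replaced by derivatives of `u` through `hw1`.
  have e5 : (∑ m, uu m) / u = H / u ^ 2 * S + H / u - A2 := by
    have h1 : ∑ m, uu m = ∑ j, a j * (H * (um j / u)) + H - u * A2 := by
      have h2 : ∑ m, ∑ j, a j * T m j = ∑ j, a j * (H * (um j / u)) := by
        rw [Finset.sum_comm]
        refine Finset.sum_congr rfl fun j _ => ?_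
        rw [← hw1, ← Finset.mul_sum, ← hHm]
        field_simp
      rw [← h2, hHκ, hA2, Finset.mul_sum, ← Finset.sum_add_distrib, ← Finset.sum_sub_distrib]
      exact Finset.sum_congr rfl fun p _ => by rw [huu]
    have h2 : ∑ j, a j * (H * (um j / u)) = H / u * S := by
      rw [hS, Finset.mul_sum]
      exact Finset.sum_congr rfl fun j _ => by ring
    rw [h1, h2]
    field_simp
  -- Here `-w2 ≥ 0` is the gain from dividing by `σ_1`; the square of `um / u` has the right sign
  -- because `q ≤ 1`.
  have e6 : β * (∑ m, L2 m - (1 - q) * ((∑ m, uu m) / u)) ≤ ∑ m, j2 m := by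
    rw [Finset.sum_div, Finset.mul_sum, ← Finset.sum_sub_distrib, Finset.mul_sum]
    refine Finset.sum_le_sum fun m _ => ?_
    rw [hj2]
    refine mul_le_mul_of_nonneg_left ?_ hβ
    nlinarith [hw2' m, mul_nonneg (sub_nonneg.2 hq) (sq_nonneg (um m / u))]
  have e7 : ∑ j, a j * j1 j = β * (∑ j, a j * L1 j - (1 - q) * S / u) := by
    rw [hS, Finset.mul_sum, Finset.sum_div, ← Finset.sum_sub_distrib, Finset.mul_sum]
    exact Finset.sum_congr rfl fun j _ => by rw [hj1]; ring
  -- Combining `e1`–`e4` cancels the fourth derivatives, the cubic terms and both copies of `∑ F i *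
  -- κ i ^ 2`; `Ψ > 0` is then divided out.
  have e8 : (∑ m, j2 m) / H + A2 / H ≤ (∑ j, a j * j1 j + 1) / u := by
    have h1 : Ψ * ∑ m, j2 m + Ψ * A2 - H * ∑ i, F i * κ i ^ 2 ≤ ∑ p, F p * HH p := by
      rw [e2]; linarith
    have h2 := div_le_div_of_nonneg_right h1 hH.le
    rw [e3] at e4
    have h3 : (Ψ * ∑ m, j2 m + Ψ * A2 - H * ∑ i, F i * κ i ^ 2) / H -
        (Ψ * (∑ j, a j * j1 j) + Ψ - u * ∑ i, F i * κ i ^ 2) / u =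
        Ψ * (((∑ m, j2 m) / H + A2 / H) - (∑ j, a j * j1 j + 1) / u) := by
      field_simp; ring
    have h4 : Ψ * (((∑ m, j2 m) / H + A2 / H) - (∑ j, a j * j1 j + 1) / u) ≤ 0 := by
      rw [← h3]; linarith
    have := nonpos_of_mul_nonpos_right h4 hΨ
    linarith
  have e9 := div_le_div_of_nonneg_right e6 hH.le
  rw [e5] at e9
  rw [e7] at e8
  have h1 : β * (∑ m, L2 m - (1 - q) * (H / u ^ 2 * S + H / u - A2)) / H =
      β * (∑ m, L2 m) / H - β * (1 - q) * S / u ^ 2 - β * (1 - q) / u + β * (1 - q) * A2 / H := by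
    field_simp; ring
  have h2 : (β * (∑ j, a j * L1 j - (1 - q) * S / u) + 1) / u =
      β * (∑ j, a j * L1 j) / u - β * (1 - q) * S / u ^ 2 + 1 / u := by
    field_simp
  rw [h1] at e9
  rw [h2] at e8
  -- The terms with `S` cancel between `e8` and `e9`. The only leftover without a known bound is
  -- this one, and it may be discarded.
  have h3 : 0 ≤ β * (1 - q) * A2 / H := by
    have : 0 ≤ A2 := Finset.sum_nonneg fun i _ => sq_nonneg _
    have := sub_nonneg.2 hq
    positivity
  linarith

/-! ### Radial extensions and the homogeneous defining function -/

namespace StarShapedHypersurface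
variable {n : ℕ}

theorem radialExt_of_ne {F : Type*} [Zero F] (g : Sph n → F) {y : Ambient n} (hy : y ≠ 0) :
    radialExt g y = g ⟨‖y‖⁻¹ • y, by simp [norm_smul, hy]⟩ := by
  simp [radialExt, hy]

theorem sph_ne_zero (x : Sph n) : (x : Ambient n) ≠ 0 := ne_zero_of_mem_unit_sphere x

theorem sph_norm (x : Sph n) : ‖(x : Ambient n)‖ = 1 := norm_eq_of_mem_sphere x

theorem radialExt_smul_coe {F : Type*} [Zero F] (g : Sph n → F) {c : ℝ} (hc : 0 < c) (x : Sph n) :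
    radialExt g (c • (x : Ambient n)) = g x := by
  rw [radialExt_of_ne g (smul_ne_zero hc.ne' (sph_ne_zero x))]
  congr 1
  ext1
  simp [norm_smul, abs_of_pos hc, smul_smul, hc.ne']

theorem radialExt_coe {F : Type*} [Zero F] (g : Sph n → F) (x : Sph n) :
    radialExt g (x : Ambient n) = g x := by
  simpa using radialExt_smul_coe g one_pos x

/-- The radial projection of a nonzero vector to the sphere. -/
noncomputable def toSph (y : Ambient n) (hy : y ≠ 0) : Sph n := ⟨‖y‖⁻¹ • y, by simp [norm_smul, hy]⟩

theorem norm_smul_toSph (y : Ambient n) (hy : y ≠ 0) : ‖y‖ • (toSph y hy : Ambient n) = y := by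
  simp [toSph, smul_smul, norm_ne_zero_iff.2 hy]

theorem radialExt_smul {F : Type*} [Zero F] (g : Sph n → F) {c : ℝ} (hc : 0 < c) (y : Ambient n) :
    radialExt g (c • y) = radialExt g y := by
  by_cases hy : y = 0
  · simp [hy]
  · rw [← norm_smul_toSph y hy, smul_smul, radialExt_smul_coe _ (by positivity),
      radialExt_smul_coe _ (by positivity)]

theorem contDiffAt_radialExt {m : ℕ∞ω} {g : Sph n → ℝ} (hg : ContMDiff (𝓡 n) 𝓘(ℝ, ℝ) m g)
    {y : Ambient n} (hy : y ≠ 0) : ContDiffAt ℝ m (radialExt g) y := by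
  let U : TopologicalSpace.Opens (Ambient n) := ⟨{0}ᶜ, isOpen_compl_singleton⟩
  have h1 : ContMDiff 𝓘(ℝ, Ambient n) 𝓘(ℝ, Ambient n) m
      (fun z : U => ‖(z : Ambient n)‖⁻¹ • (z : Ambient n)) := by
    intro z
    have hz : (z : Ambient n) ≠ 0 := z.2
    have : ContDiffAt ℝ m (fun w : Ambient n => ‖w‖⁻¹ • w) z :=
      ((contDiffAt_norm ℝ hz).inv (norm_ne_zero_iff.2 hz)).smul contDiffAt_id
    exact (contMDiffAt_subtype_iff (U := U) (f := fun w : Ambient n => ‖w‖⁻¹ • w)).2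
      this.contMDiffAt
  have h2 := hg.comp (h1.codRestrict_sphere (n := n) fun z : U => by
    have hz : (z : Ambient n) ≠ 0 := z.2
    simp [norm_smul, hz])
  have h3 : ContMDiffAt 𝓘(ℝ, Ambient n) 𝓘(ℝ, ℝ) m (fun z : U => radialExt g z) ⟨y, hy⟩ := by
    convert h2.contMDiffAt using 1
    funext z
    exact radialExt_of_ne g z.2
  exact ((contMDiffAt_subtype_iff (U := U) (f := radialExt g)).1 h3).contDiffAt

/-- The defining function `|y| / ρ(y / |y|)`, homogeneous of degree one, with level set
`{P = 1}` the hypersurface. -/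
noncomputable def gauge (ρ : Sph n → ℝ) (y : Ambient n) : ℝ := ‖y‖ / radialExt ρ y

theorem radialExt_pos {ρ : Sph n → ℝ} (hρ : ∀ x, 0 < ρ x) {y : Ambient n} (hy : y ≠ 0) :
    0 < radialExt ρ y := by rw [radialExt_of_ne ρ hy]; exact hρ _

theorem gauge_pos {ρ : Sph n → ℝ} (hρ : ∀ x, 0 < ρ x) {y : Ambient n} (hy : y ≠ 0) :
    0 < gauge ρ y := div_pos (norm_pos_iff.2 hy) (radialExt_pos hρ hy)

theorem gauge_smul (ρ : Sph n → ℝ) {c : ℝ} (hc : 0 < c) (y : Ambient n) :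
    gauge ρ (c • y) = c * gauge ρ y := by
  rw [gauge, gauge, radialExt_smul ρ hc, norm_smul, Real.norm_of_nonneg hc.le, mul_div_assoc]

theorem contDiffAt_gauge {m : ℕ∞ω} {ρ : Sph n → ℝ} (h : ContMDiff (𝓡 n) 𝓘(ℝ, ℝ) m ρ)
    (hρ : ∀ x, 0 < ρ x) {y : Ambient n} (hy : y ≠ 0) : ContDiffAt ℝ m (gauge ρ) y :=
  (contDiffAt_norm ℝ hy).div (contDiffAt_radialExt h hy) (radialExt_pos hρ hy).ne'

theorem gauge_position {ρ : Sph n → ℝ} (hρ : ∀ x, 0 < ρ x) (x : Sph n) :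
    gauge ρ (position ρ x) = 1 := by
  rw [position, gauge_smul ρ (hρ x), gauge, radialExt_coe, sph_norm, mul_one_div_cancel (hρ x).ne']

theorem position_ne_zero {ρ : Sph n → ℝ} (hρ : ∀ x, 0 < ρ x) (x : Sph n) : position ρ x ≠ 0 :=
  smul_ne_zero (hρ x).ne' (sph_ne_zero x)

theorem position_toSph {ρ : Sph n → ℝ} {y : Ambient n} (hy : y ≠ 0)
    (h1 : gauge ρ y = 1) : position ρ (toSph y hy) = y := by
  have h2 : radialExt ρ y ≠ 0 := fun h => by simp [gauge, h] at h1
  rw [gauge, div_eq_one_iff_eq h2] at h1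
  rw [position, show ρ (toSph y hy) = radialExt ρ y from (radialExt_of_ne ρ hy).symm, ← h1,
    norm_smul_toSph]

/-- Extended along rays, the embedding is the radial projection onto the level set `{P = 1}`, so its
derivatives come from those of the gauge. -/
theorem radialExt_position {ρ : Sph n → ℝ} {y : Ambient n} (hy : y ≠ 0) :
    radialExt (position ρ) y = (gauge ρ y)⁻¹ • y := by
  rw [radialExt_of_ne _ hy, position, gauge, radialExt_of_ne _ hy, smul_smul, inv_div,
    div_eq_mul_inv]

theorem fderiv_gauge_smul (ρ : Sph n → ℝ) {c : ℝ} (hc : 0 < c) (y : Ambient n) :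
    fderiv ℝ (gauge ρ) (c • y) = fderiv ℝ (gauge ρ) y := by
  have h1 : (fun y => gauge ρ (c • y)) = c • gauge ρ := by
    funext y; simp [gauge_smul ρ hc]
  have h2 := fderiv_comp_smul (𝕜 := ℝ) (f := gauge ρ) c (x := y)
  rw [h1, fderiv_const_smul_field] at h2
  exact (smul_right_injective _ hc.ne' h2).symm

/-- Euler's relation. -/
theorem fderiv_gauge_self {ρ : Sph n → ℝ} (h : ContMDiff (𝓡 n) 𝓘(ℝ, ℝ) 4 ρ)
    (hρ : ∀ x, 0 < ρ x) {y : Ambient n} (hy : y ≠ 0) : fderiv ℝ (gauge ρ) y y = gauge ρ y := by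
  have h1 : HasDerivAt (fun t : ℝ => t • y) y 1 := by
    simpa using (hasDerivAt_id (1 : ℝ)).smul_const y
  have h2 : HasFDerivAt (gauge ρ) (fderiv ℝ (gauge ρ) y) ((1 : ℝ) • y) := by
    simpa using ((contDiffAt_gauge h hρ hy).differentiableAt (by norm_num)).hasFDerivAt
  have h3 := h2.comp_hasDerivAt 1 h1
  have h4 : HasDerivAt (fun t : ℝ => t * gauge ρ y) (gauge ρ y) 1 := by
    simpa using (hasDerivAt_id (1 : ℝ)).mul_const (gauge ρ y)
  refine h3.unique (h4.congr_of_eventuallyEq ?_)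
  filter_upwards [lt_mem_nhds one_pos] with t ht using gauge_smul ρ ht y

/-- Derivatives of a radially constant function vanish in the radial direction. -/
theorem fderiv_radialExt_self {g : Sph n → ℝ} {y : Ambient n}
    (hd : DifferentiableAt ℝ (radialExt g) y) : fderiv ℝ (radialExt g) y y = 0 := by
  have h1 : HasDerivAt (fun t : ℝ => t • y) y 1 := by
    simpa using (hasDerivAt_id (1 : ℝ)).smul_const y
  have h2 : HasFDerivAt (radialExt g) (fderiv ℝ (radialExt g) y) ((1 : ℝ) • y) := by
    simpa using hd.hasFDerivAt
  have h3 := h2.comp_hasDerivAt 1 h1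
  refine h3.unique ((hasDerivAt_const (1 : ℝ) (radialExt g y)).congr_of_eventuallyEq ?_)
  filter_upwards [lt_mem_nhds one_pos] with t ht using radialExt_smul g ht y

theorem inner_gradient {g : Ambient n → ℝ} (y v : Ambient n) :
    ⟪gradient g y, v⟫_ℝ = fderiv ℝ g y v := by
  simp [gradient]

/-- The gradient of the defining function in terms of the radial function. -/
theorem gradient_gauge {ρ : Sph n → ℝ} (h : ContMDiff (𝓡 n) 𝓘(ℝ, ℝ) 4 ρ)
    (hρ : ∀ x, 0 < ρ x) (x : Sph n) :
    gradient (gauge ρ) (position ρ x) =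
      (ρ x ^ 2)⁻¹ • (ρ x • (x : Ambient n) - sphGrad ρ x) := by
  have hx := sph_ne_zero x
  have h1 : HasFDerivAt (fun y : Ambient n => ‖y‖) (innerSL ℝ (x : Ambient n)) x := by
    have h0 := (hasStrictFDerivAt_norm_sq (x : Ambient n)).hasFDerivAt.sqrt (by simp)
    refine (h0.congr_of_eventuallyEq (.of_forall fun y => by simp)).congr_fderiv ?_
    ext v
    simp
  have h2 := ((contDiffAt_radialExt h hx).differentiableAt (by norm_num)).hasFDerivAt
  have h3 := h1.mul ((hasDerivAt_inv (by rw [radialExt_coe]; exact (hρ x).ne')).comp_hasFDerivAt _ h2)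
  refine ext_inner_right ℝ fun v => ?_
  rw [inner_gradient, position, fderiv_gauge_smul ρ (hρ x)]
  have h4 : gauge ρ = (fun y => ‖y‖) * (Inv.inv ∘ radialExt ρ) := by
    funext y; simp [gauge, div_eq_mul_inv]
  rw [h4]
  rw [h3.fderiv, inner_smul_left, inner_sub_left, inner_smul_left, sphGrad, inner_gradient,
    radialExt_coe, sph_norm]
  have := (hρ x).ne'
  simp [radialExt_coe]
  field_simp
  ring

theorem inner_sphGrad_self {g : Sph n → ℝ} {m : ℕ∞ω} (hm : m ≠ 0)
    (h : ContMDiff (𝓡 n) 𝓘(ℝ, ℝ) m g) (x : Sph n) : ⟪sphGrad g x, (x : Ambient n)⟫_ℝ = 0 := by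
  rw [sphGrad, inner_gradient, fderiv_radialExt_self]
  exact (contDiffAt_radialExt h (sph_ne_zero x)).differentiableAt hm

theorem norm_gradient_gauge {ρ : Sph n → ℝ} (h : ContMDiff (𝓡 n) 𝓘(ℝ, ℝ) 4 ρ)
    (hρ : ∀ x, 0 < ρ x) (x : Sph n) :
    ‖gradient (gauge ρ) (position ρ x)‖ = √(ρ x ^ 2 + ‖sphGrad ρ x‖ ^ 2) / ρ x ^ 2 := by
  have h1 : ‖ρ x • (x : Ambient n) - sphGrad ρ x‖ = √(ρ x ^ 2 + ‖sphGrad ρ x‖ ^ 2) := by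
    rw [eq_comm, Real.sqrt_eq_iff_mul_self_eq (by positivity) (by positivity), ← sq,
      norm_sub_sq_real, inner_smul_left, real_inner_comm, inner_sphGrad_self (by norm_num) h,
      norm_smul, sph_norm]
    simp
  rw [gradient_gauge h hρ, norm_smul, h1, norm_inv, norm_pow, Real.norm_of_nonneg (hρ x).le]
  ring

theorem normal_eq {ρ : Sph n → ℝ} (h : ContMDiff (𝓡 n) 𝓘(ℝ, ℝ) 4 ρ)
    (hρ : ∀ x, 0 < ρ x) (x : Sph n) :
    normal ρ x = ‖gradient (gauge ρ) (position ρ x)‖⁻¹ • gradient (gauge ρ) (position ρ x) := by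
  rw [norm_gradient_gauge h hρ, gradient_gauge h hρ, smul_smul, normal]
  have := (hρ x).ne'
  congr 1
  field_simp

theorem gradient_gauge_ne_zero {ρ : Sph n → ℝ} (h : ContMDiff (𝓡 n) 𝓘(ℝ, ℝ) 4 ρ)
    (hρ : ∀ x, 0 < ρ x) (x : Sph n) : 0 < ‖gradient (gauge ρ) (position ρ x)‖ := by
  have := hρ x
  rw [norm_gradient_gauge h hρ]
  positivity

/-- Euler's relation gives `⟨X, ∇P⟩ = P = 1`, so the support function is `1 / |∇P|`. -/
theorem inner_position_normal {ρ : Sph n → ℝ} (h : ContMDiff (𝓡 n) 𝓘(ℝ, ℝ) 4 ρ)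
    (hρ : ∀ x, 0 < ρ x) (x : Sph n) :
    ⟪position ρ x, normal ρ x⟫_ℝ = ‖gradient (gauge ρ) (position ρ x)‖⁻¹ := by
  rw [normal_eq h hρ, inner_smul_right, real_inner_comm, inner_gradient,
    fderiv_gauge_self h hρ (position_ne_zero hρ x), gauge_position hρ, mul_one]

end StarShapedHypersurface

/-! ### Level sets and principal curvatures as eigenvalues -/

/-- The second derivative of a composition. -/
theorem fderiv_fderiv_comp {E : Type*} [NormedAddCommGroup E] [NormedSpace ℝ E] {P : E → ℝ}
    {Y : E → E} {x : E} (hP : ContDiffAt ℝ 2 P (Y x)) (hY : ContDiffAt ℝ 2 Y x) (v w : E) :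
    fderiv ℝ (fderiv ℝ (P ∘ Y)) x v w =
      fderiv ℝ (fderiv ℝ P) (Y x) (fderiv ℝ Y x v) (fderiv ℝ Y x w) +
        fderiv ℝ P (Y x) (fderiv ℝ (fderiv ℝ Y) x v w) := by
  have h1 : fderiv ℝ (P ∘ Y) =ᶠ[𝓝 x] fun y => (fderiv ℝ P (Y y)).comp (fderiv ℝ Y y) := by
    filter_upwards [hY.eventually (by simp), hY.continuousAt.eventually (hP.eventually (by simp))]
      with y h1 h2
    exact fderiv_comp y (h2.differentiableAt (by norm_num)) (h1.differentiableAt (by norm_num))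
  have hP2 : DifferentiableAt ℝ (fderiv ℝ P) (Y x) :=
    (hP.fderiv_right (m := 1) (by norm_num)).differentiableAt (by norm_num)
  have hY2 : DifferentiableAt ℝ (fderiv ℝ Y) x :=
    (hY.fderiv_right (m := 1) (by norm_num)).differentiableAt (by norm_num)
  have h2 := (hP2.hasFDerivAt.comp x (hY.differentiableAt (by norm_num)).hasFDerivAt).clm_comp
    hY2.hasFDerivAt
  change HasFDerivAt (fun y => (fderiv ℝ P (Y y)).comp (fderiv ℝ Y y)) _ _ at h2
  rw [h1.fderiv_eq, h2.fderiv]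
  simp
  ring

/-- First and second order relations satisfied by a parametrization `Y` of a level set of `P`. -/
theorem fderiv_level_set {E : Type*} [NormedAddCommGroup E] [NormedSpace ℝ E] {P : E → ℝ}
    {Y : E → E} {x : E} {c : ℝ} (hP : ContDiffAt ℝ 2 P (Y x)) (hY : ContDiffAt ℝ 2 Y x)
    (h : ∀ᶠ y in 𝓝 x, P (Y y) = c) :
    (∀ v, fderiv ℝ P (Y x) (fderiv ℝ Y x v) = 0) ∧
    ∀ v w, fderiv ℝ (fderiv ℝ P) (Y x) (fderiv ℝ Y x v) (fderiv ℝ Y x w) +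
      fderiv ℝ P (Y x) (fderiv ℝ (fderiv ℝ Y) x v w) = 0 := by
  have h1 : P ∘ Y =ᶠ[𝓝 x] fun _ => c := h
  have h2 : fderiv ℝ (P ∘ Y) =ᶠ[𝓝 x] 0 := by simpa using h1.fderiv (𝕜 := ℝ)
  refine ⟨fun v => ?_, fun v w => ?_⟩
  · have h3 := fderiv_comp x (hP.differentiableAt (by norm_num)) (hY.differentiableAt (by norm_num))
    rw [h2.self_of_nhds] at h3
    exact (congrArg (fun L : E →L[ℝ] ℝ => L v) h3).symm
  · rw [← fderiv_fderiv_comp hP hY, h2.fderiv_eq]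
    simp

namespace StarShapedHypersurface
variable {n : ℕ}

/-- Complete an orthonormal family of `n` vectors by a unit normal. -/
theorem exists_orthonormalBasis_cons {V : Fin n → Ambient n} (hV : Orthonormal ℝ V)
    {N : Ambient n} (hN : ‖N‖ = 1) (hVN : ∀ i, ⟪V i, N⟫_ℝ = 0) :
    ∃ b : OrthonormalBasis (Fin (n + 1)) ℝ (Ambient n), b 0 = N ∧ ∀ i : Fin n, b i.succ = V i := by
  have hon : Orthonormal ℝ (Fin.cons N V : Fin (n + 1) → Ambient n) := by
    refine ⟨fun i => ?_, fun i j hij => ?_⟩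
    · refine Fin.cases ?_ (fun i => ?_) i
      · simpa using hN
      · simpa using hV.1 i
    · revert hij
      refine Fin.cases ?_ (fun i => ?_) i <;> refine Fin.cases ?_ (fun j => ?_) j <;> intro hij
      · exact absurd rfl hij
      · simpa [real_inner_comm] using hVN j
      · simpa using hVN i
      · simpa using hV.2 (fun h => hij (by rw [h]))
  have hc : Fintype.card (Fin (n + 1)) = Module.finrank ℝ (Ambient n) := by
    rw [finrank_euclideanSpace_fin, Fintype.card_fin]
  refine ⟨OrthonormalBasis.mk hon (hon.linearIndependent.span_eq_top_of_card_eq_finrank' hc).ge,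
    ?_, fun i => ?_⟩
  · simp
  · simp

/-- The trace of a bilinear form does not depend on the orthonormal basis. -/
theorem sum_bilin_orthonormalBasis {E ι κ : Type*} [NormedAddCommGroup E] [InnerProductSpace ℝ E]
    [Fintype ι] [Fintype κ] (b : OrthonormalBasis ι ℝ E) (c : OrthonormalBasis κ ℝ E)
    (B : E →L[ℝ] E →L[ℝ] ℝ) : ∑ i, B (b i) (b i) = ∑ j, B (c j) (c j) := by
  classical
  have h1 : ∀ i, B (b i) (b i) =
      ∑ j, ∑ k, (⟪c j, b i⟫_ℝ * ⟪b i, c k⟫_ℝ) * B (c j) (c k) := fun i => by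
    conv_lhs => rw [← c.sum_repr' (b i)]
    simp only [map_sum, map_smul, FunLike.coe_sum, Finset.sum_apply,
      FunLike.coe_smul, Pi.smul_apply, smul_eq_mul, Finset.mul_sum]
    rw [Finset.sum_comm]
    refine Finset.sum_congr rfl fun j _ => Finset.sum_congr rfl fun k _ => ?_
    rw [real_inner_comm (b i) (c k)]
    ring
  rw [Finset.sum_congr rfl fun i _ => h1 i, Finset.sum_comm]
  refine Finset.sum_congr rfl fun j _ => ?_
  rw [Finset.sum_comm, Finset.sum_eq_single j]
  · rw [← Finset.sum_mul, b.sum_inner_mul_inner, real_inner_self_eq_norm_sq, c.norm_eq_one]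
    ring
  · intro k _ hk
    rw [← Finset.sum_mul, b.sum_inner_mul_inner, c.inner_eq_zero hk.symm, zero_mul]
  · simp

/-- The Hessian of the defining function. -/
noncomputable def hess (ρ : Sph n → ℝ) (y : Ambient n) : Ambient n →L[ℝ] Ambient n →L[ℝ] ℝ :=
  fderiv ℝ (fderiv ℝ (gauge ρ)) y

theorem hess_symm {ρ : Sph n → ℝ} (h : ContMDiff (𝓡 n) 𝓘(ℝ, ℝ) 4 ρ)
    (hρ : ∀ x, 0 < ρ x) {y : Ambient n} (hy : y ≠ 0) (v w : Ambient n) :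
    hess ρ y v w = hess ρ y w v :=
  ((contDiffAt_gauge h hρ hy).isSymmSndFDerivAt (by simp; norm_num)).eq v w

/-- The matrix of the second fundamental form with respect to tangent vectors `V`. -/
noncomputable def shapeMatrix (ρ : Sph n → ℝ) (y : Ambient n) (V : Fin n → Ambient n) :
    Matrix (Fin n) (Fin n) ℝ :=
  Matrix.of fun i j => hess ρ y (V i) (V j) / ‖gradient (gauge ρ) y‖

theorem shapeMatrix_isHermitian {ρ : Sph n → ℝ} (h : ContMDiff (𝓡 n) 𝓘(ℝ, ℝ) 4 ρ)
    (hρ : ∀ x, 0 < ρ x) {y : Ambient n} (hy : y ≠ 0) (V : Fin n → Ambient n) :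
    (shapeMatrix ρ y V).IsHermitian := by
  ext i j
  simp [shapeMatrix, hess_symm h hρ hy (V i) (V j)]

-- A change of tangent frame by `C` only multiplies the determinant of the pencil by the nonzero
-- constant `± (det C)²`.
open Polynomial in
theorem roots_det_pencil {C A : Matrix (Fin n) (Fin n) ℝ} (hC : C.det ≠ 0) (hA : A.IsHermitian) :
    (Matrix.det ((C * A * C.transpose).map Polynomial.C -
      (X : ℝ[X]) • (C * C.transpose).map Polynomial.C)).roots =
      Finset.univ.val.map hA.eigenvalues := by
  have h1 : (C * A * C.transpose).map Polynomial.C -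
      (X : ℝ[X]) • (C * C.transpose).map Polynomial.C =
      C.map Polynomial.C * (-A.charmatrix) * (C.transpose).map Polynomial.C := by
    simp only [Matrix.map_mul, Matrix.charmatrix, neg_sub, mul_sub, sub_mul]
    congr 1
    rw [Matrix.scalar_apply, ← Matrix.smul_one_eq_diagonal]
    simp
  have h2 : Matrix.det ((C * A * C.transpose).map Polynomial.C -
      (X : ℝ[X]) • (C * C.transpose).map Polynomial.C) =
      Polynomial.C (C.det * (-1) ^ n * C.det) * A.charpoly := by
    have h3 : ∀ M : Matrix (Fin n) (Fin n) ℝ, (M.map Polynomial.C).det = Polynomial.C M.det :=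
      fun M => ((Polynomial.C : ℝ →+* ℝ[X]).map_det M).symm
    rw [h1, Matrix.det_mul, Matrix.det_mul, Matrix.det_neg, h3, h3, Matrix.det_transpose,
      Matrix.charpoly]
    simp
    ring
  rw [h2, Polynomial.roots_C_mul _ (by simp [hC]), hA.roots_charpoly_eq_eigenvalues]
  rfl

/-- The principal curvatures are the eigenvalues of the second fundamental form in any orthonormal
frame of the tangent space. -/
theorem principalCurvatures_eq {ρ : Sph n → ℝ} (h : ContMDiff (𝓡 n) 𝓘(ℝ, ℝ) 4 ρ)
    (hρ : ∀ x, 0 < ρ x) (x : Sph n) {V : Fin n → Ambient n} (hV : Orthonormal ℝ V)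
    (hVN : ∀ i, ⟪V i, gradient (gauge ρ) (position ρ x)⟫_ℝ = 0)
    (hA : (shapeMatrix ρ (position ρ x) V).IsHermitian) :
    principalCurvatures ρ x = Finset.univ.val.map hA.eigenvalues := by
  set X := position ρ x with hX
  set Γ := gradient (gauge ρ) X with hΓ
  have hΓ0 : 0 < ‖Γ‖ := gradient_gauge_ne_zero h hρ x
  have hx := sph_ne_zero x
  have hX0 : X ≠ 0 := position_ne_zero hρ x
  set Y : Ambient n → Ambient n := radialExt (position ρ) with hY
  have hYx : Y x = X := radialExt_coe _ x
  have hYe : Y =ᶠ[𝓝 (x : Ambient n)] fun y => (gauge ρ y)⁻¹ • y := by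
    filter_upwards [isOpen_compl_singleton.mem_nhds hx] with y hy using radialExt_position hy
  have hPx := contDiffAt_gauge h hρ hx
  have hPx0 := gauge_pos hρ hx
  have hYc : ContDiffAt ℝ 4 Y x :=
    ((hPx.inv hPx0.ne').smul contDiffAt_id).congr_of_eventuallyEq hYe
  have hlev : ∀ᶠ y in 𝓝 (x : Ambient n), gauge ρ (Y y) = 1 := by
    filter_upwards [isOpen_compl_singleton.mem_nhds hx, hYe] with y hy hy'
    have := gauge_pos hρ hy
    rw [hy', gauge_smul ρ (inv_pos.2 this), inv_mul_cancel₀ this.ne']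
  obtain ⟨hT, hB⟩ := fderiv_level_set (P := gauge ρ) (Y := Y) (x := (x : Ambient n)) (c := 1)
    (by rw [hYx]; exact (contDiffAt_gauge h hρ hX0).of_le (by norm_num))
    (hYc.of_le (by norm_num)) hlev
  rw [hYx] at hT hB
  have hDY : ∀ v, fderiv ℝ Y x v = (gauge ρ x)⁻¹ • v +
      (-(gauge ρ x ^ 2)⁻¹ * fderiv ℝ (gauge ρ) x v) • (x : Ambient n) := fun v => by
    have h1 := (hasDerivAt_inv hPx0.ne').comp_hasFDerivAt (x : Ambient n)
      (hPx.differentiableAt (by norm_num)).hasFDerivAt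
    have h2 := h1.fun_smul (hasFDerivAt_id (x : Ambient n))
    rw [hYe.fderiv_eq]
    change fderiv ℝ (fun y => ((fun y => y⁻¹) ∘ gauge ρ) y • id y) _ v = _
    rw [h2.fderiv]
    simp
  have hN1 : ‖‖Γ‖⁻¹ • Γ‖ = 1 := by rw [norm_smul, norm_inv, norm_norm, inv_mul_cancel₀ hΓ0.ne']
  obtain ⟨b, hb0, hb⟩ := exists_orthonormalBasis_cons hV hN1 fun i => by
    rw [inner_smul_right, hVN, mul_zero]
  -- `C` expresses the image of the spherical frame in the orthonormal frame `V`.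
  set C : Matrix (Fin n) (Fin n) ℝ :=
    Matrix.of fun i k => ⟪V k, fderiv ℝ Y x (frame x i)⟫_ℝ with hC
  have hexp : ∀ w, ⟪Γ, w⟫_ℝ = 0 → w = ∑ k, ⟪V k, w⟫_ℝ • V k := fun w hw => by
    conv_lhs => rw [← b.sum_repr' w, Fin.sum_univ_succ, hb0]
    simp [hb, inner_smul_left, hw]
  have hXi : ∀ i, fderiv ℝ Y x (frame x i) = ∑ k, C i k • V k := fun i =>
    hexp _ (by rw [inner_gradient]; exact hT _)
  have hg : firstForm ρ x = C * C.transpose := by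
    ext i j
    simp only [firstForm, D1, Matrix.of_apply, Matrix.mul_apply, Matrix.transpose_apply]
    rw [← hY, hXi i, hXi j]
    simpa using hV.inner_sum (C i) (C j) Finset.univ
  -- Differentiating `P(Y) = 1` twice trades `-⟨Y_ij, ∇P⟩` for the Hessian of `P` on the tangent
  -- vectors.
  have hh : secondForm ρ x = C * shapeMatrix ρ X V * C.transpose := by
    ext i j
    have h1 := hB (frame x i) (frame x j)
    simp only [secondForm, D2, Matrix.of_apply]
    rw [← hY, normal_eq h hρ, ← hX, ← hΓ, inner_smul_right, real_inner_comm, hΓ, inner_gradient,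
      eq_neg_of_add_eq_zero_right h1, ← hΓ, hXi i, hXi j]
    simp only [map_sum, map_smul, FunLike.coe_sum, Finset.sum_apply,
      FunLike.coe_smul, Pi.smul_apply, smul_eq_mul, Matrix.mul_apply, shapeMatrix,
      Matrix.of_apply, Matrix.transpose_apply, hess, Finset.mul_sum, Finset.sum_mul, ← hΓ,
      mul_neg, neg_neg]
    refine Finset.sum_congr rfl fun k _ => Finset.sum_congr rfl fun l _ => ?_
    ring
  -- By `hDY`, the derivative of `Y` on `x^⊥` is a nonzero multiple of the identity modulo `x`,
  -- hence injective.
  have hdet : C.det ≠ 0 := by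
    intro h0
    obtain ⟨c, hc0, hc⟩ := Matrix.exists_vecMul_eq_zero_iff.2 h0
    set w : Ambient n := ∑ i, c i • (frame x i : Ambient n) with hw
    have hw1 : fderiv ℝ Y x w = 0 := by
      rw [hexp (fderiv ℝ Y x w) (by rw [inner_gradient]; exact hT _)]
      refine Finset.sum_eq_zero fun k _ => ?_
      have := congrFun hc k
      simp only [Matrix.vecMul, dotProduct, hC, Matrix.of_apply, Pi.zero_apply] at this
      rw [hw, map_sum, inner_sum]
      simp only [map_smul, inner_smul_right]
      rw [this, zero_smul]
    have hwx : ⟪w, (x : Ambient n)⟫_ℝ = 0 := by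
      rw [hw, sum_inner]
      refine Finset.sum_eq_zero fun i _ => ?_
      rw [inner_smul_left, real_inner_comm,
        Submodule.mem_orthogonal_singleton_iff_inner_right.1 (frame x i).2, mul_zero]
    have hw2 : w = 0 := by
      have h1 := congrArg (fun z => ⟪w, z⟫_ℝ) (hDY w)
      simp only [hw1, inner_zero_right, inner_add_right, inner_smul_right, hwx, mul_zero,
        add_zero] at h1
      have h2 := (mul_eq_zero.1 h1.symm).resolve_left (inv_ne_zero hPx0.ne')
      exact inner_self_eq_zero.1 h2
    apply hc0
    have h3 : ∑ i, c i • frame x i = 0 := by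
      apply Subtype.ext
      simpa [hw] using hw2
    funext i
    exact Fintype.linearIndependent_iff.1 (frame x).orthonormal.linearIndependent c h3 i
  rw [principalCurvatures, hg, hh]
  exact roots_det_pencil hdet hA

end StarShapedHypersurface

/-! ### The hypersurface as a graph over its tangent hyperplane -/

namespace StarShapedHypersurface
variable {n : ℕ}

theorem normal_norm {ρ : Sph n → ℝ} (h : ContMDiff (𝓡 n) 𝓘(ℝ, ℝ) 4 ρ)
    (hρ : ∀ x, 0 < ρ x) (x : Sph n) : ‖normal ρ x‖ = 1 := by
  rw [normal_eq h hρ, norm_smul, norm_inv, norm_norm,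
    inv_mul_cancel₀ (gradient_gauge_ne_zero h hρ x).ne']

theorem norm_smul_normal {ρ : Sph n → ℝ} (h : ContMDiff (𝓡 n) 𝓘(ℝ, ℝ) 4 ρ)
    (hρ : ∀ x, 0 < ρ x) (x : Sph n) :
    ‖gradient (gauge ρ) (position ρ x)‖ • normal ρ x = gradient (gauge ρ) (position ρ x) := by
  rw [normal_eq h hρ, smul_smul, mul_inv_cancel₀ (gradient_gauge_ne_zero h hρ x).ne', one_smul]

/-- The graph of `v` over the tangent hyperplane at `X`, with unit normal `ν`. -/
noncomputable def graphMap (X ν : Ambient n) (v : Ambient n → ℝ) (y : Ambient n) : Ambient n :=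
  X + (y - ⟪ν, y⟫_ℝ • ν) - v y • ν

theorem hasFDerivAt_graphMap (X ν : Ambient n) {v : Ambient n → ℝ} {y : Ambient n}
    (hv : DifferentiableAt ℝ v y) (w : Ambient n) :
    fderiv ℝ (graphMap X ν v) y w = (w - ⟪ν, w⟫_ℝ • ν) - fderiv ℝ v y w • ν := by
  have h1 : HasFDerivAt (fun y : Ambient n => ⟪ν, y⟫_ℝ) (innerSL ℝ ν) y :=
    (innerSL ℝ ν).hasFDerivAt
  have h2 := (((hasFDerivAt_id y).fun_sub (h1.smul_const ν)).const_add X).fun_sub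
    (hv.hasFDerivAt.smul_const ν)
  have h3 := h2.fderiv
  change fderiv ℝ (graphMap X ν v) y = _ at h3
  rw [h3]
  simp

theorem contDiffAt_graphMap (X ν : Ambient n) {v : Ambient n → ℝ} {y : Ambient n} {m : ℕ∞ω}
    (hv : ContDiffAt ℝ m v y) : ContDiffAt ℝ m (graphMap X ν v) y := by
  have hi : ContDiffAt ℝ m (fun y => ⟪ν, y⟫_ℝ) y := contDiffAt_const.inner ℝ contDiffAt_id
  exact (contDiffAt_const.add (contDiffAt_id.sub (hi.smul contDiffAt_const))).sub
    (hv.smul contDiffAt_const)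

theorem fderiv_fderiv_graphMap (X ν : Ambient n) {v : Ambient n → ℝ} {y : Ambient n}
    (hv : ContDiffAt ℝ 2 v y) (w w' : Ambient n) :
    fderiv ℝ (fderiv ℝ (graphMap X ν v)) y w w' = -(fderiv ℝ (fderiv ℝ v) y w w') • ν := by
  have hY := contDiffAt_graphMap X ν hv
  have h1 : DifferentiableAt ℝ (fderiv ℝ (graphMap X ν v)) y :=
    (hY.fderiv_right (m := 1) (by norm_num)).differentiableAt (by norm_num)
  have h2 : DifferentiableAt ℝ (fderiv ℝ v) y :=
    (hv.fderiv_right (m := 1) (by norm_num)).differentiableAt (by norm_num)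
  have h3 : (fun z => fderiv ℝ (graphMap X ν v) z w') =ᶠ[𝓝 y]
      fun z => (w' - ⟪ν, w'⟫_ℝ • ν) - fderiv ℝ v z w' • ν := by
    filter_upwards [hv.eventually (by simp)] with z hz
      using hasFDerivAt_graphMap X ν (hz.differentiableAt (by norm_num)) w'
  have h4 := (h1.hasFDerivAt.clm_apply (hasFDerivAt_const w' y)).fderiv
  have h5 := ((hasFDerivAt_const (w' - ⟪ν, w'⟫_ℝ • ν) y).fun_sub
    ((h2.hasFDerivAt.clm_apply (hasFDerivAt_const w' y)).smul_const ν)).fderiv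
  rw [h3.fderiv_eq, h5] at h4
  have h6 := congrArg (fun L : Ambient n →L[ℝ] Ambient n => L w) h4
  simpa using h6.symm

/-- Near each of its points the hypersurface is a `C⁴` graph over the tangent hyperplane. -/
theorem exists_graph {ρ : Sph n → ℝ} (h : ContMDiff (𝓡 n) 𝓘(ℝ, ℝ) 4 ρ)
    (hρ : ∀ x, 0 < ρ x) (x : Sph n) :
    ∃ v : Ambient n → ℝ, ContDiffAt ℝ 4 v 0 ∧ v 0 = 0 ∧ fderiv ℝ v 0 = 0 ∧
      ∀ᶠ y in 𝓝 0, gauge ρ (graphMap (position ρ x) (normal ρ x) v y) = 1 := by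
  set X := position ρ x with hX
  set ν := normal ρ x with hν
  set Γ := gradient (gauge ρ) X with hΓ
  have hΓ0 : 0 < ‖Γ‖ := gradient_gauge_ne_zero h hρ x
  have hΓν : ‖Γ‖ • ν = Γ := norm_smul_normal h hρ x
  have hνν : ⟪ν, ν⟫_ℝ = 1 := by
    rw [real_inner_self_eq_norm_sq, normal_norm h hρ, one_pow]
  have hX0 : X ≠ 0 := position_ne_zero hρ x
  have hPX := contDiffAt_gauge h hρ hX0
  have hP1 : gauge ρ X = 1 := gauge_position hρ x
  -- In these coordinates the normal component is `(P - 1)/|∇P|`, so the hypersurface becomes the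
  -- hyperplane `ν^⊥`. The derivative at `X` is the identity, and the inverse function theorem
  -- applies.
  set Θ : Ambient n → Ambient n := fun Z =>
    (Z - X) - ⟪ν, Z - X⟫_ℝ • ν + (‖Γ‖⁻¹ * (gauge ρ Z - 1)) • ν with hΘ
  have hΘc : ContDiffAt ℝ 4 Θ X := by
    have hs : ContDiffAt ℝ 4 (fun Z => Z - X) X := contDiffAt_id.sub contDiffAt_const
    exact (hs.sub ((contDiffAt_const.inner ℝ hs).smul contDiffAt_const)).add
      ((contDiffAt_const.mul (hPX.sub contDiffAt_const)).smul contDiffAt_const)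
  have hΘX : Θ X = 0 := by simp [hΘ, hP1]
  have hΘd : HasFDerivAt Θ
      ((ContinuousLinearEquiv.refl ℝ (Ambient n) : Ambient n ≃L[ℝ] Ambient n) :
        Ambient n →L[ℝ] Ambient n) X := by
    have h1 : HasFDerivAt (fun Z : Ambient n => Z - X) (ContinuousLinearMap.id ℝ (Ambient n)) X :=
      (hasFDerivAt_id X).sub_const X
    have h2 := (innerSL ℝ ν).hasFDerivAt.comp X h1
    have h3 := (((hPX.differentiableAt (by norm_num)).hasFDerivAt.sub_const 1).const_mul
      ‖Γ‖⁻¹).smul_const ν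
    refine ((h1.fun_sub (h2.smul_const ν)).fun_add h3).congr_fderiv ?_
    ext1 w
    have h4 : fderiv ℝ (gauge ρ) X w = ‖Γ‖ * ⟪ν, w⟫_ℝ := by
      rw [← inner_gradient, ← hΓ, ← hΓν, inner_smul_left, norm_smul, normal_norm h hρ]
      simp
    simp [h4, hΓ0.ne']
  set e := hΘc.toOpenPartialHomeomorph Θ hΘd (by norm_num) with he
  set g := hΘc.localInverse hΘd (by norm_num) with hg
  have hgc : ContDiffAt ℝ 4 g 0 := by
    rw [← hΘX]; exact hΘc.to_localInverse hΘd (by norm_num)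
  have hgX : g 0 = X := by
    rw [← hΘX]; exact hΘc.localInverse_apply_image hΘd (by norm_num)
  have hgr : ∀ᶠ z in 𝓝 (0 : Ambient n), Θ (g z) = z := by
    have h1 : (0 : Ambient n) ∈ e.target := by
      rw [← hΘX]; exact hΘc.image_mem_toOpenPartialHomeomorph_target hΘd (by norm_num)
    filter_upwards [e.open_target.mem_nhds h1] with z hz using e.right_inv hz
  set π : Ambient n → Ambient n := fun y => y - ⟪ν, y⟫_ℝ • ν with hπ
  have hπc : ContDiffAt ℝ 4 π 0 :=
    contDiffAt_id.sub ((contDiffAt_const.inner ℝ contDiffAt_id).smul contDiffAt_const)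
  have hπ0 : π 0 = 0 := by simp [hπ]
  -- The graph function is minus the height of the inverse of `Θ` over points of `ν^⊥`; composing
  -- with the projection `π` defines it on the whole space.
  have hvc : ContDiffAt ℝ 4 (fun y => -⟪ν, g (π y) - X⟫_ℝ) 0 := by
    have : ContDiffAt ℝ 4 (g ∘ π) 0 := ContDiffAt.comp 0 (by rw [hπ0]; exact hgc) hπc
    exact (contDiffAt_const.inner ℝ (this.sub contDiffAt_const)).neg
  have hv0 : -⟪ν, g (π 0) - X⟫_ℝ = 0 := by rw [hπ0, hgX]; simp
  have hlev : ∀ᶠ y in 𝓝 0,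
      gauge ρ (graphMap X ν (fun y => -⟪ν, g (π y) - X⟫_ℝ) y) = 1 := by
    have h1 : Tendsto π (𝓝 0) (𝓝 0) := by
      have := hπc.continuousAt
      rwa [ContinuousAt, hπ0] at this
    filter_upwards [h1.eventually hgr] with y hy
    have hπν : ⟪ν, π y⟫_ℝ = 0 := by
      simp only [hπ, inner_sub_right, inner_smul_right, hνν, mul_one, sub_self]
    have h2 : gauge ρ (g (π y)) = 1 := by
      have h3 := congrArg (fun z => ⟪ν, z⟫_ℝ) hy
      simp only [hΘ, inner_add_right, inner_sub_right, inner_smul_right, hνν, hπν, mul_one] at h3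
      have h4 : ‖Γ‖⁻¹ * (gauge ρ (g (π y)) - 1) = 0 := by linarith
      have := (mul_eq_zero.1 h4).resolve_left (inv_ne_zero hΓ0.ne')
      linarith
    have h5 : graphMap X ν (fun y => -⟪ν, g (π y) - X⟫_ℝ) y = g (π y) := by
      have h6 := hy
      simp only [hΘ, h2, sub_self, mul_zero, zero_smul, add_zero] at h6
      rw [graphMap]
      change X + π y - (-⟪ν, g (π y) - X⟫_ℝ) • ν = g (π y)
      generalize g (π y) = Z at h6 ⊢
      rw [← h6]
      module
    rw [h5, h2]
  refine ⟨_, hvc, hv0, ?_, hlev⟩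
  set v : Ambient n → ℝ := fun y => -⟪ν, g (π y) - X⟫_ℝ with hv
  have hY0 : graphMap X ν v 0 = X := by
    have : v 0 = 0 := hv0
    simp [graphMap, this]
  have h1 := (fderiv_level_set (P := gauge ρ) (Y := graphMap X ν v) (x := 0) (c := 1)
    (by rw [hY0]; exact hPX.of_le (by norm_num))
    ((contDiffAt_graphMap X ν hvc).of_le (by norm_num)) hlev).1
  ext w
  have h2 := h1 w
  rw [hY0, hasFDerivAt_graphMap X ν (hvc.differentiableAt (by norm_num)), ← inner_gradient, ← hΓ,
    ← hΓν] at h2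
  simp only [inner_smul_left, inner_sub_right, inner_smul_right, hνν] at h2
  have h3 : ‖Γ‖ * fderiv ℝ v 0 w = 0 := by
    simp only [conj_trivial] at h2
    linarith
  simpa [hΓ0.ne'] using h3

end StarShapedHypersurface

/-! ### Principal frames and the second fundamental form of a graph -/

namespace StarShapedHypersurface
variable {n : ℕ}

/-- At every point there is an orthonormal frame of principal directions. -/
theorem exists_principal_frame {ρ : Sph n → ℝ} (h : ContMDiff (𝓡 n) 𝓘(ℝ, ℝ) 4 ρ)
    (hρ : ∀ x, 0 < ρ x) (x : Sph n) :
    ∃ (e : Fin n → Ambient n) (κ : Fin n → ℝ), Orthonormal ℝ e ∧ (∀ i, ⟪e i, normal ρ x⟫_ℝ = 0) ∧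
      shapeMatrix ρ (position ρ x) e = Matrix.diagonal κ ∧
      principalCurvatures ρ x = Finset.univ.val.map κ := by
  set ν := normal ρ x with hν
  have hν0 : ν ≠ 0 := norm_ne_zero_iff.1 (by rw [normal_norm h hρ]; exact one_ne_zero)
  let b := OrthonormalBasis.fromOrthogonalSpanSingleton (𝕜 := ℝ) (E := Ambient n) n hν0
  let V : Fin n → Ambient n := fun i => b i
  have hV : Orthonormal ℝ V := by
    have := b.orthonormal
    exact this.comp_linearIsometry (Submodule.subtypeₗᵢ _)
  have hVν : ∀ i, ⟪V i, ν⟫_ℝ = 0 := fun i => by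
    rw [real_inner_comm]
    exact Submodule.mem_orthogonal_singleton_iff_inner_right.1 (b i).2
  have hX0 := position_ne_zero hρ x
  have hA := shapeMatrix_isHermitian h hρ hX0 V
  have hpc := principalCurvatures_eq h hρ x hV (fun i => by
    rw [← norm_smul_normal h hρ x, inner_smul_right, hVν, mul_zero]) hA
  set U : Matrix (Fin n) (Fin n) ℝ := hA.eigenvectorUnitary.1 with hU
  have hU1 : U.transpose * U = 1 := (Matrix.mem_unitaryGroup_iff').1 hA.eigenvectorUnitary.2
  refine ⟨fun i => ∑ k, U k i • V k, hA.eigenvalues, ?_, fun i => ?_, ?_, hpc⟩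
  · rw [orthonormal_iff_ite]
    intro i j
    have h1 := hV.inner_sum (fun k => U k i) (fun k => U k j) Finset.univ
    rw [h1]
    have h2 := congrFun (congrFun hU1 i) j
    simpa [Matrix.mul_apply, Matrix.one_apply] using h2
  · rw [sum_inner]
    exact Finset.sum_eq_zero fun k _ => by rw [inner_smul_left, hVν, mul_zero]
  · have h1 : shapeMatrix ρ (position ρ x) (fun i => ∑ k, U k i • V k) =
        U.transpose * shapeMatrix ρ (position ρ x) V * U := by
      ext i j
      simp only [shapeMatrix, Matrix.of_apply, Matrix.mul_apply, Matrix.transpose_apply, map_sum,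
        map_smul, FunLike.coe_sum, Finset.sum_apply, FunLike.coe_smul, Pi.smul_apply, smul_eq_mul,
        Finset.mul_sum, Finset.sum_mul, Finset.sum_div]
      refine Finset.sum_congr rfl fun k _ => Finset.sum_congr rfl fun l _ => ?_
      ring
    rw [h1]
    have h2 := hA.conjStarAlgAut_star_eigenvectorUnitary
    rw [Unitary.conjStarAlgAut_apply] at h2
    have h3 : U.transpose * shapeMatrix ρ (position ρ x) V * U =
        Matrix.diagonal (RCLike.ofReal ∘ hA.eigenvalues) := by
      rw [← h2]
      rfl
    rw [h3]
    rfl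

section Graph

/-- `√(1 + |Dv|²)`, the derivatives being taken in the directions `e`. -/
noncomputable def graphW (v : Ambient n → ℝ) (e : Fin n → Ambient n) (y : Ambient n) : ℝ :=
  √(1 + ∑ k, fderiv ℝ v y (e k) * fderiv ℝ v y (e k))

/-- The diagonal entries of the second fundamental form of a graph in the frame obtained by
rotating `e`. -/
noncomputable def graphShape (v : Ambient n → ℝ) (e : Fin n → Ambient n) (i : Fin n)
    (y : Ambient n) : ℝ :=
  (fderiv ℝ (fderiv ℝ v) y (e i) (e i) -
    2 * (graphW v e y * (graphW v e y + 1))⁻¹ * (fderiv ℝ v y (e i) *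
      ∑ k, fderiv ℝ v y (e k) * fderiv ℝ (fderiv ℝ v) y (e k) (e i)) +
    ((graphW v e y * (graphW v e y + 1))⁻¹ * fderiv ℝ v y (e i)) *
      ((graphW v e y * (graphW v e y + 1))⁻¹ * fderiv ℝ v y (e i)) *
      ∑ k, ∑ l, fderiv ℝ v y (e k) * fderiv ℝ v y (e l) *
        fderiv ℝ (fderiv ℝ v) y (e k) (e l)) * (graphW v e y)⁻¹

/-- `⟨Y, ν + Dv⟩` for the graph `Y`. -/
noncomputable def graphS (X ν : Ambient n) (v : Ambient n → ℝ) (e : Fin n → Ambient n)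
    (y : Ambient n) : ℝ :=
  ⟪ν + ∑ k, fderiv ℝ v y (e k) • e k, graphMap X ν v y⟫_ℝ

/-- The gradient of the gauge is a multiple of `ν + Dv`, which gives the support function. The
matrix `A` is the second fundamental form in an orthonormal frame depending explicitly on `Dv`, so
its diagonal can be differentiated even where eigenvalues cross. -/
theorem graph_geometry {ρ : Sph n → ℝ} (h : ContMDiff (𝓡 n) 𝓘(ℝ, ℝ) 4 ρ)
    (hρ : ∀ x, 0 < ρ x) {X ν y : Ambient n} {v : Ambient n → ℝ} {e : Fin n → Ambient n}
    (hν : ‖ν‖ = 1) (he : Orthonormal ℝ e) (heν : ∀ i, ⟪e i, ν⟫_ℝ = 0) (hv : ContDiffAt ℝ 2 v y)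
    (hlev : ∀ᶠ z in 𝓝 y, gauge ρ (graphMap X ν v z) = 1) (hS : 0 < graphS X ν v e y) :
    ∃ x : Sph n, position ρ x = graphMap X ν v y ∧
      ⟪position ρ x, normal ρ x⟫_ℝ = graphS X ν v e y * (graphW v e y)⁻¹ ∧
      ∃ (A : Matrix (Fin n) (Fin n) ℝ) (hA : A.IsHermitian),
        principalCurvatures ρ x = Finset.univ.val.map hA.eigenvalues ∧
        ∀ i, A i i = graphShape v e i y := by
  set Y := graphMap X ν v y with hY
  have hP1 : gauge ρ Y = 1 := hlev.self_of_nhds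
  have hY0 : Y ≠ 0 := fun h0 => by simp [gauge, h0] at hP1
  set x := toSph Y hY0 with hx
  have hpos : position ρ x = Y := position_toSph hY0 hP1
  refine ⟨x, hpos, ?_⟩
  set Γ := gradient (gauge ρ) Y with hΓ
  set D : Ambient n := ∑ k, fderiv ℝ v y (e k) • e k with hD
  set W := graphW v e y with hW
  have hνν : ⟪ν, ν⟫_ℝ = 1 := by rw [real_inner_self_eq_norm_sq, hν, one_pow]
  have heν' : ∀ i, ⟪ν, e i⟫_ℝ = 0 := fun i => by rw [real_inner_comm, heν]
  have hee : ∀ i j, ⟪e i, e j⟫_ℝ = if i = j then 1 else 0 := orthonormal_iff_ite.1 he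
  have hDe : ∀ i, ⟪e i, D⟫_ℝ = fderiv ℝ v y (e i) := fun i => by
    rw [hD, inner_sum]; simp [inner_smul_right, hee]
  have hDν : ⟪ν, D⟫_ℝ = 0 := by rw [hD, inner_sum]; simp [inner_smul_right, heν']
  have hW2 : W ^ 2 = 1 + ⟪D, D⟫_ℝ := by
    rw [hW, graphW, Real.sq_sqrt (by
      have := Finset.sum_nonneg fun k (_ : k ∈ Finset.univ) => mul_self_nonneg (fderiv ℝ v y (e k))
      linarith)]
    congr 1
    conv_rhs => rw [hD, sum_inner]
    refine Finset.sum_congr rfl fun k _ => ?_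
    rw [← hD, inner_smul_left, hDe]; simp
  have hW1 : 1 ≤ W := by
    rw [hW, graphW, Real.one_le_sqrt]
    have := Finset.sum_nonneg fun k (_ : k ∈ Finset.univ) => mul_self_nonneg (fderiv ℝ v y (e k))
    linarith
  obtain ⟨hT, hB⟩ := fderiv_level_set (P := gauge ρ) (Y := graphMap X ν v) (x := y) (c := 1)
    ((contDiffAt_gauge h hρ hY0).of_le (by norm_num)) (contDiffAt_graphMap X ν hv) hlev
  rw [← hY] at hT hB
  have hvd := hv.differentiableAt (by norm_num)
  set l := ⟪Γ, ν⟫_ℝ with hl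
  have hΓe : ∀ k, ⟪Γ, e k⟫_ℝ = l * fderiv ℝ v y (e k) := fun k => by
    have := hT (e k)
    rw [hasFDerivAt_graphMap X ν hvd, ← inner_gradient, ← hΓ, heν', inner_sub_right,
      inner_smul_right] at this
    simp at this
    linarith
  obtain ⟨b, hb0, hb⟩ := exists_orthonormalBasis_cons he hν heν
  have hΓD : Γ = l • (ν + D) := by
    conv_lhs => rw [← b.sum_repr' Γ, Fin.sum_univ_succ, hb0]
    simp only [hb]
    have hlν : ⟪ν, Γ⟫_ℝ = l := real_inner_comm _ _
    rw [smul_add, hD, Finset.smul_sum, hlν]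
    congr 1
    refine Finset.sum_congr rfl fun k _ => ?_
    rw [real_inner_comm, hΓe, smul_smul]
  have hSl : l * graphS X ν v e y = 1 := by
    have h1 : ⟪Γ, Y⟫_ℝ = 1 := by rw [hΓ, inner_gradient, fderiv_gauge_self h hρ hY0, hP1]
    rw [hΓD, inner_smul_left] at h1
    exact h1
  -- The sign of `graphS` makes `ν + Dv` point in the outward direction `∇P`.
  have hl0 : 0 < l := (pos_iff_pos_of_mul_pos (by rw [hSl]; exact one_pos)).2 hS
  have hΓn : ‖Γ‖ = l * W := by
    rw [hΓD, norm_smul, Real.norm_of_nonneg hl0.le]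
    congr 1
    rw [← Real.sqrt_sq (show 0 ≤ W by linarith), hW2, norm_eq_sqrt_real_inner]
    congr 1
    rw [inner_add_left, inner_add_right, inner_add_right, hνν, hDν, real_inner_comm, hDν]
    ring
  have hW0 : 0 < W := by linarith
  refine ⟨?_, ?_⟩
  · rw [inner_position_normal h hρ, hpos, ← hΓ, hΓn, mul_inv]
    congr 1
    exact inv_eq_of_mul_eq_one_right hSl
  -- With this `c`, the map `I - c D ⊗ D` is the inverse square root of the graph metric `I + D ⊗
  -- D`: its eigenvalue along `D` is `1 - c (W² - 1) = 1/W`. The pushed-forward vectors `E i` are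
  -- therefore orthonormal.
  set c := (W * (W + 1))⁻¹ with hc
  set w : Fin n → Ambient n := fun i => e i - (c * fderiv ℝ v y (e i)) • D with hw
  have hwν : ∀ i, ⟪ν, w i⟫_ℝ = 0 := fun i => by
    simp only [hw, inner_sub_right, inner_smul_right, heν', hDν, mul_zero, sub_self]
  have hDD : ⟪D, D⟫_ℝ = W ^ 2 - 1 := by linarith
  have hcW : c * (W ^ 2 - 1) = 1 - W⁻¹ := by rw [hc]; field_simp; ring
  have hDD' : fderiv ℝ v y D = W ^ 2 - 1 := by
    rw [← hDD]
    conv_lhs => rw [hD, map_sum]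
    conv_rhs => rw [hD, sum_inner]
    refine Finset.sum_congr rfl fun k _ => ?_
    rw [← hD, map_smul, inner_smul_left, hDe]; simp
  have hDw : ∀ i, fderiv ℝ v y (w i) = fderiv ℝ v y (e i) * W⁻¹ := fun i => by
    simp only [hw, map_sub, map_smul, smul_eq_mul, hDD']
    linear_combination -fderiv ℝ v y (e i) * hcW
  set E : Fin n → Ambient n := fun i => fderiv ℝ (graphMap X ν v) y (w i) with hE
  have hEi : ∀ i, E i = w i - (fderiv ℝ v y (e i) * W⁻¹) • ν := fun i => by
    simp only [hE]
    rw [hasFDerivAt_graphMap X ν hvd, hwν, hDw]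
    simp
  have hww : ∀ i j, ⟪w i, w j⟫_ℝ = (if i = j then 1 else 0) - 2 * c * fderiv ℝ v y (e i) *
      fderiv ℝ v y (e j) + c ^ 2 * (W ^ 2 - 1) * fderiv ℝ v y (e i) * fderiv ℝ v y (e j) := by
    intro i j
    simp only [hw, inner_sub_left, inner_sub_right, inner_smul_left, inner_smul_right, hee, hDe,
      hDD, conj_trivial, real_inner_comm (e j) D]
    ring
  have hEon : Orthonormal ℝ E := by
    rw [orthonormal_iff_ite]
    intro i j
    have hwν' : ⟪w i, ν⟫_ℝ = 0 := by rw [real_inner_comm, hwν]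
    have key : ∀ (a b : Ambient n) (s t : ℝ), ⟪a - s • ν, b - t • ν⟫_ℝ =
        ⟪a, b⟫_ℝ - t * ⟪a, ν⟫_ℝ - s * ⟪ν, b⟫_ℝ + s * t * ⟪ν, ν⟫_ℝ := fun a b s t => by
      simp only [inner_sub_left, inner_sub_right, inner_smul_left, inner_smul_right, conj_trivial]
      ring
    rw [hEi, hEi, key, hww, hwν, hwν', hνν]
    have h1 : -2 * c + c ^ 2 * (W ^ 2 - 1) + W⁻¹ ^ 2 = 0 := by rw [hc]; field_simp; ring
    linear_combination fderiv ℝ v y (e i) * fderiv ℝ v y (e j) * h1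
  have hEN : ∀ i, ⟪E i, gradient (gauge ρ) (position ρ x)⟫_ℝ = 0 := fun i => by
    rw [hpos, real_inner_comm, inner_gradient]
    exact hT (w i)
  have hA := shapeMatrix_isHermitian h hρ (position_ne_zero hρ x) E
  refine ⟨_, hA, principalCurvatures_eq h hρ x hEon hEN hA, fun i => ?_⟩
  have h1 := hB (w i) (w i)
  rw [fderiv_fderiv_graphMap X ν hv, map_smul, ← inner_gradient (g := gauge ρ), ← hΓ, ← hl] at h1
  simp only [shapeMatrix, Matrix.of_apply, hpos, ← hΓ, hΓn, hess]
  rw [show fderiv ℝ (fderiv ℝ (gauge ρ)) Y (E i) (E i) =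
    fderiv ℝ (fderiv ℝ v) y (w i) (w i) * l by simp only [smul_eq_mul] at h1; linarith]
  have hsymm : fderiv ℝ (fderiv ℝ v) y (e i) D = fderiv ℝ (fderiv ℝ v) y D (e i) :=
    (hv.isSymmSndFDerivAt (by simp)).eq _ _
  have h2 : fderiv ℝ (fderiv ℝ v) y D (e i) =
      ∑ k, fderiv ℝ v y (e k) * fderiv ℝ (fderiv ℝ v) y (e k) (e i) := by
    rw [hD, map_sum]; simp
  have h3 : fderiv ℝ (fderiv ℝ v) y D D = ∑ k, ∑ l, fderiv ℝ v y (e k) * fderiv ℝ v y (e l) *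
        fderiv ℝ (fderiv ℝ v) y (e k) (e l) := by
    rw [hD, map_sum]
    simp only [map_sum, map_smul, FunLike.coe_sum, Finset.sum_apply, FunLike.coe_smul,
      Pi.smul_apply, smul_eq_mul]
    rw [Finset.sum_comm]
    simp only [Finset.mul_sum]
    exact Finset.sum_congr rfl fun k _ => Finset.sum_congr rfl fun l _ => by ring
  rw [graphShape, ← hW, ← hc, ← h2, ← h3]
  simp only [hw, map_sub, map_smul, FunLike.coe_sub, Pi.sub_apply, FunLike.coe_smul,
    Pi.smul_apply, smul_eq_mul, hsymm]
  field_simp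
  ring

end Graph
end StarShapedHypersurface

/-! ### Commuting third and fourth derivatives -/

section DirectionalDerivatives
variable {E : Type*} [NormedAddCommGroup E] [NormedSpace ℝ E]

theorem fderiv_fderiv_apply {g : E → ℝ} {x : E} (hg : ContDiffAt ℝ 2 g x) (a b : E) :
    fderiv ℝ (fderiv ℝ g) x a b = fderiv ℝ (fun y => fderiv ℝ g y b) x a := by
  have h1 : DifferentiableAt ℝ (fderiv ℝ g) x :=
    (hg.fderiv_right (m := 1) (by norm_num)).differentiableAt (by norm_num)
  have := (h1.hasFDerivAt.clm_apply (hasFDerivAt_const b x)).fderiv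
  rw [this]; simp

theorem ContDiffAt.fderiv_apply_const {g : E → ℝ} {x : E} {m k : ℕ∞ω} (hg : ContDiffAt ℝ m g x)
    (hk : k + 1 ≤ m) (a : E) : ContDiffAt ℝ k (fun y => fderiv ℝ g y a) x :=
  (hg.fderiv_right hk).clm_apply contDiffAt_const

theorem eventually_fderiv_comm {g : E → ℝ} {x : E} (hg : ContDiffAt ℝ 2 g x) (a b : E) :
    (fun y => fderiv ℝ (fun z => fderiv ℝ g z b) y a) =ᶠ[𝓝 x]
      fun y => fderiv ℝ (fun z => fderiv ℝ g z a) y b := by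
  filter_upwards [hg.eventually (by simp)] with y hy
  rw [← fderiv_fderiv_apply hy, ← fderiv_fderiv_apply hy]
  exact (hy.isSymmSndFDerivAt (by simp)).eq a b

theorem Filter.EventuallyEq.fderiv_apply {g g' : E → ℝ} {x : E} (h : g =ᶠ[𝓝 x] g') (a : E) :
    (fun y => fderiv ℝ g y a) =ᶠ[𝓝 x] fun y => fderiv ℝ g' y a := by
  filter_upwards [h.fderiv (𝕜 := ℝ)] with y hy using by rw [hy]

/-- The jet of the restriction of a function to a line through the origin. -/
theorem hasJet_line {g : E → ℝ} (hg : ContDiffAt ℝ 2 g 0) (e : E) :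
    HasJet (fun t : ℝ => g (t • e)) (g 0) (fderiv ℝ g 0 e) (fderiv ℝ (fderiv ℝ g) 0 e e) := by
  have hl : ∀ t : ℝ, HasDerivAt (fun t : ℝ => t • e) e t := fun t => by
    simpa using (hasDerivAt_id t).smul_const e
  have hc : Tendsto (fun t : ℝ => t • e) (𝓝 0) (𝓝 0) := by
    simpa using (hl 0).continuousAt.tendsto
  refine ⟨by simp, fun t => fderiv ℝ g (t • e) e, ?_, by simp, ?_⟩
  · filter_upwards [hc.eventually (hg.eventually (by simp))] with t ht
    exact (ht.differentiableAt (by norm_num)).hasFDerivAt.comp_hasDerivAt t (hl t)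
  · have h1 : HasFDerivAt (fun y => fderiv ℝ g y e) (fderiv ℝ (fun y => fderiv ℝ g y e) 0)
        ((0 : ℝ) • e) := by
      rw [zero_smul]
      exact ((hg.fderiv_apply_const (k := 1) (by norm_num) e).differentiableAt
        (by norm_num)).hasFDerivAt
    rw [fderiv_fderiv_apply hg]
    exact h1.comp_hasDerivAt 0 (hl 0)

theorem fderiv_third_comm {v : E → ℝ} (hv : ContDiffAt ℝ 4 v 0) (a b : E) :
    fderiv ℝ (fderiv ℝ (fun y => fderiv ℝ v y a)) 0 b b =
      fderiv ℝ (fun y => fderiv ℝ (fderiv ℝ v) y b b) 0 a := by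
  have hc := fun z : E => hv.fderiv_apply_const (k := 3) (by norm_num) z
  have h1 : (fun y => fderiv ℝ (fderiv ℝ v) y b b) =ᶠ[𝓝 0]
      fun y => fderiv ℝ (fun z => fderiv ℝ v z b) y b := by
    filter_upwards [(hv.of_le (show (2 : ℕ∞ω) ≤ 4 by norm_num)).eventually (by simp)] with y hy
      using fderiv_fderiv_apply hy b b
  rw [fderiv_fderiv_apply ((hc a).of_le (by norm_num)), h1.fderiv_eq,
    (eventually_fderiv_comm (hv.of_le (by norm_num)) b a).fderiv_eq]
  exact (eventually_fderiv_comm ((hc b).of_le (by norm_num)) b a).self_of_nhds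

/-- Four transpositions of adjacent derivatives take `v_{aabb}` to `v_{bbaa}`, each needing only the
`C⁴` regularity. In this flat chart no curvature terms appear. -/
theorem fderiv_fourth_comm {v : E → ℝ} (hv : ContDiffAt ℝ 4 v 0) (a b : E) :
    fderiv ℝ (fderiv ℝ (fun y => fderiv ℝ (fderiv ℝ v) y a a)) 0 b b =
      fderiv ℝ (fderiv ℝ (fun y => fderiv ℝ (fderiv ℝ v) y b b)) 0 a a := by
  have hc := fun z : E => hv.fderiv_apply_const (k := 3) (by norm_num) z
  have hcc := fun z w : E => (hc z).fderiv_apply_const (k := 2) (by norm_num) w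
  have h1 : ∀ z : E, (fun y => fderiv ℝ (fderiv ℝ v) y z z) =ᶠ[𝓝 0]
      fun y => fderiv ℝ (fun x => fderiv ℝ v x z) y z := fun z => by
    filter_upwards [(hv.of_le (show (2 : ℕ∞ω) ≤ 4 by norm_num)).eventually (by simp)] with y hy
      using fderiv_fderiv_apply hy z z
  rw [(h1 a).fderiv.fderiv_eq, (h1 b).fderiv.fderiv_eq, fderiv_fderiv_apply (hcc a a),
    fderiv_fderiv_apply (hcc b b)]
  have s1 := ((eventually_fderiv_comm ((hc a).of_le (by norm_num)) b a).fderiv_apply b).self_of_nhds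
  have s2 := (eventually_fderiv_comm (hcc a b) b a).self_of_nhds
  have s3 := (((eventually_fderiv_comm (hv.of_le (by norm_num)) b a).fderiv_apply b).fderiv_apply
    a).self_of_nhds
  have s4 := ((eventually_fderiv_comm ((hc b).of_le (by norm_num)) b a).fderiv_apply a).self_of_nhds
  exact s1.trans (s2.trans (s3.trans s4))

end DirectionalDerivatives

/-! ### Jets of the geometric quantities at the centre of the graph -/

namespace StarShapedHypersurface
variable {n : ℕ} {v : Ambient n → ℝ} {e : Fin n → Ambient n} {κ : Fin n → ℝ}

theorem hasJet_fderiv (hv : ContDiffAt ℝ 4 v 0) (hdv : fderiv ℝ v 0 = 0)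
    (hκ : ∀ i j, fderiv ℝ (fderiv ℝ v) 0 (e i) (e j) = if i = j then κ i else 0) (m k : Fin n) :
    HasJet (fun t : ℝ => fderiv ℝ v (t • e m) (e k)) 0 (if m = k then κ m else 0)
      (fderiv ℝ (fun y => fderiv ℝ (fderiv ℝ v) y (e m) (e m)) 0 (e k)) := by
  refine (hasJet_line ((hv.fderiv_apply_const (k := 3) (by norm_num) (e k)).of_le (by norm_num))
    (e m)).cast (by simp [hdv]) ?_ (fderiv_third_comm hv _ _)
  rw [← fderiv_fderiv_apply (hv.of_le (by norm_num)), hκ]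

theorem hasJet_fderiv_fderiv (hv : ContDiffAt ℝ 4 v 0)
    (hκ : ∀ i j, fderiv ℝ (fderiv ℝ v) 0 (e i) (e j) = if i = j then κ i else 0)
    (m k l : Fin n) :
    HasJet (fun t : ℝ => fderiv ℝ (fderiv ℝ v) (t • e m) (e k) (e l)) (if k = l then κ k else 0)
      (fderiv ℝ (fun y => fderiv ℝ (fderiv ℝ v) y (e k) (e l)) 0 (e m))
      (fderiv ℝ (fderiv ℝ (fun y => fderiv ℝ (fderiv ℝ v) y (e k) (e l))) 0 (e m) (e m)) := by
  have hc : ContDiffAt ℝ 2 (fun y => fderiv ℝ (fderiv ℝ v) y (e k) (e l)) 0 :=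
    (((hv.fderiv_right (m := 3) (by norm_num)).fderiv_right (m := 2) (by norm_num)).clm_apply
      contDiffAt_const).clm_apply contDiffAt_const
  exact (hasJet_line hc (e m)).cast (hκ k l) rfl rfl

theorem hasJet_graphW (hv : ContDiffAt ℝ 4 v 0) (hdv : fderiv ℝ v 0 = 0)
    (hκ : ∀ i j, fderiv ℝ (fderiv ℝ v) 0 (e i) (e j) = if i = j then κ i else 0) (m : Fin n) :
    HasJet (fun t : ℝ => graphW v e (t • e m)) 1 0 (κ m ^ 2) := by
  have hs := HasJet.sum Finset.univ fun k _ =>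
    (hasJet_fderiv hv hdv hκ m k).mul (hasJet_fderiv hv hdv hκ m k)
  have h1 : HasJet (fun t : ℝ => 1 + ∑ k, fderiv ℝ v (t • e m) (e k) * fderiv ℝ v (t • e m) (e k))
      1 0 (2 * κ m ^ 2) := by
    refine ((HasJet.const 1).add hs).cast (by simp) (by simp) ?_
    simp
    ring
  exact h1.sqrt.cast rfl rfl (by ring)

/-- Since `Dv` vanishes at the centre, `1/W` contributes `-κ_i κ_m²`, the frame rotation contributes
`-2 κ_i³` when `i = m`, and the term quadratic in the rotation is of fourth order. These corrections
do the work of the Gauss and Simons commutation formulas. -/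
theorem hasJet_graphShape (hv : ContDiffAt ℝ 4 v 0) (hdv : fderiv ℝ v 0 = 0)
    (hκ : ∀ i j, fderiv ℝ (fderiv ℝ v) 0 (e i) (e j) = if i = j then κ i else 0)
    (i m : Fin n) :
    HasJet (fun t : ℝ => graphShape v e i (t • e m)) (κ i)
      (fderiv ℝ (fun y => fderiv ℝ (fderiv ℝ v) y (e i) (e i)) 0 (e m))
      (fderiv ℝ (fderiv ℝ (fun y => fderiv ℝ (fderiv ℝ v) y (e i) (e i))) 0 (e m) (e m) -
        κ i * κ m ^ 2 - if i = m then 2 * κ i ^ 3 else 0) := by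
  have hW := hasJet_graphW hv hdv hκ m
  have hp := fun k => hasJet_fderiv hv hdv hκ m k
  have hq := fun k l => hasJet_fderiv_fderiv hv hκ m k l
  have hWi := hW.inv one_pos
  have hc := (hW.mul (hW.add (HasJet.const 1))).inv (by norm_num)
  have h1 := HasJet.sum Finset.univ fun k _ => (hp k).mul (hq k i)
  have h2 := (hp i).mul h1
  have h3 := HasJet.sum Finset.univ fun k _ => HasJet.sum Finset.univ fun l _ =>
    ((hp k).mul (hp l)).mul (hq k l)
  have h4 := hc.mul (hp i)
  have h5 := (((hq i i).sub ((hc.const_mul 2).mul h2)).add ((h4.mul h4).mul h3)).mul hWi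
  refine h5.cast ?_ ?_ ?_
  · simp
  · simp
  · by_cases him : i = m
    · subst him
      simp
      ring
    · have hmi : m ≠ i := fun h => him h.symm
      simp [him, hmi]
      ring

theorem hasJet_support {X ν : Ambient n} (hν : ‖ν‖ = 1) (he : Orthonormal ℝ e)
    (heν : ∀ i, ⟪e i, ν⟫_ℝ = 0) (hv : ContDiffAt ℝ 4 v 0) (hv0 : v 0 = 0) (hdv : fderiv ℝ v 0 = 0)
    (hκ : ∀ i j, fderiv ℝ (fderiv ℝ v) 0 (e i) (e j) = if i = j then κ i else 0)
    (m : Fin n) :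
    HasJet (fun t : ℝ => graphS X ν v e (t • e m) * (graphW v e (t • e m))⁻¹) ⟪ν, X⟫_ℝ
      (⟪e m, X⟫_ℝ * κ m)
      (∑ k, ⟪e k, X⟫_ℝ * fderiv ℝ (fun y => fderiv ℝ (fderiv ℝ v) y (e m) (e m)) 0 (e k) +
        κ m - ⟪ν, X⟫_ℝ * κ m ^ 2) := by
  have hp := fun k => hasJet_fderiv hv hdv hκ m k
  have hvj : HasJet (fun t : ℝ => v (t • e m)) 0 0 (κ m) :=
    (hasJet_line (hv.of_le (by norm_num)) (e m)).cast hv0 (by simp [hdv]) (by simp [hκ])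
  have hWi := (hasJet_graphW hv hdv hκ m).inv one_pos
  have hνν : ⟪ν, ν⟫_ℝ = 1 := by rw [real_inner_self_eq_norm_sq, hν, one_pow]
  have hee : ∀ i j, ⟪e i, e j⟫_ℝ = if i = j then 1 else 0 := orthonormal_iff_ite.1 he
  have hνe : ∀ i, ⟪ν, e i⟫_ℝ = 0 := fun i => by rw [real_inner_comm, heν]
  have hS : ∀ t : ℝ, graphS X ν v e (t • e m) = ⟪ν, X⟫_ℝ - v (t • e m) +
      ∑ k, ⟪e k, X⟫_ℝ * fderiv ℝ v (t • e m) (e k) + t * fderiv ℝ v (t • e m) (e m) := by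
    intro t
    simp only [graphS, graphMap, inner_add_left, inner_add_right, inner_sub_right,
      inner_smul_right, inner_smul_left, sum_inner, hνν, hνe, heν, hee, conj_trivial]
    simp
    have h1 : ∀ k : Fin n, fderiv ℝ v (t • e m) (e k) * ⟪e k, X⟫_ℝ =
      ⟪e k, X⟫_ℝ * fderiv ℝ v (t • e m) (e k) := fun k => mul_comm _ _
    simp only [h1]
    ring
  have h1 := ((((HasJet.const ⟪ν, X⟫_ℝ).sub hvj).add (HasJet.sum Finset.univ fun k _ =>
    (hp k).const_mul ⟪e k, X⟫_ℝ)).add (HasJet.id.mul (hp m))).mul hWi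
  refine (h1.congr (.of_forall fun t => by simp only [hS])).cast ?_ ?_ ?_
  · simp
  · simp
  · simp
    ring

/-- The term `-κ m * DL(ν)` appears because the graph bends towards `-ν` with curvature `κ m`. -/
theorem hasJet_comp_graphMap {X ν : Ambient n} (heν : ∀ i, ⟪e i, ν⟫_ℝ = 0)
    (hv : ContDiffAt ℝ 4 v 0) (hv0 : v 0 = 0) (hdv : fderiv ℝ v 0 = 0)
    (hκ : ∀ i j, fderiv ℝ (fderiv ℝ v) 0 (e i) (e j) = if i = j then κ i else 0)
    {L : Ambient n → ℝ} (hL : ContDiffAt ℝ 2 L X) (m : Fin n) :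
    HasJet (fun t : ℝ => L (graphMap X ν v (t • e m))) (L X) (fderiv ℝ L X (e m))
      (fderiv ℝ (fderiv ℝ L) X (e m) (e m) - κ m * fderiv ℝ L X ν) := by
  have hY0 : graphMap X ν v 0 = X := by simp [graphMap, hv0]
  have hYc := contDiffAt_graphMap X ν (hv.of_le (show (2 : ℕ∞ω) ≤ 4 by norm_num))
  have hνe : ⟪ν, e m⟫_ℝ = 0 := by rw [real_inner_comm, heν]
  have hY1 : fderiv ℝ (graphMap X ν v) 0 (e m) = e m := by
    rw [hasFDerivAt_graphMap X ν (hv.differentiableAt (by norm_num)), hνe, hdv]; simp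
  have hL' : ContDiffAt ℝ 2 L (graphMap X ν v 0) := by rw [hY0]; exact hL
  refine (hasJet_line (g := L ∘ graphMap X ν v) (hL'.comp 0 hYc) (e m)).cast (by simp [hY0]) ?_ ?_
  · rw [fderiv_comp 0 (hL'.differentiableAt (by norm_num)) (hYc.differentiableAt (by norm_num))]
    simp [hY1, hY0]
  · rw [fderiv_fderiv_comp hL' hYc, hY1, fderiv_fderiv_graphMap X ν (hv.of_le (by norm_num)), hY0,
      hκ]
    simp
    ring

end StarShapedHypersurface

/-! ### Bounds for radial extensions; mean curvature and support function -/

namespace StarShapedHypersurface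
variable {n : ℕ}

theorem fderiv_radialExt_smul (f : Sph n → ℝ) {c : ℝ} (hc : 0 < c) (y : Ambient n) :
    fderiv ℝ (radialExt f) (c • y) = c⁻¹ • fderiv ℝ (radialExt f) y := by
  have h1 : (fun y => radialExt f (c • y)) = radialExt f := by
    funext y; exact radialExt_smul f hc y
  have h2 := fderiv_comp_smul (𝕜 := ℝ) (f := radialExt f) c (x := y)
  rw [h1] at h2
  rw [h2, smul_smul, inv_mul_cancel₀ hc.ne', one_smul]

theorem fderiv_fderiv_radialExt_smul (f : Sph n → ℝ) {c : ℝ} (hc : 0 < c) (y : Ambient n) :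
    fderiv ℝ (fderiv ℝ (radialExt f)) (c • y) =
      (c ^ 2)⁻¹ • fderiv ℝ (fderiv ℝ (radialExt f)) y := by
  have h1 : (fun y => fderiv ℝ (radialExt f) (c • y)) = fun y => c⁻¹ • fderiv ℝ (radialExt f) y :=
    funext fun y => fderiv_radialExt_smul f hc y
  have h2 := fderiv_comp_smul (𝕜 := ℝ) (f := fderiv ℝ (radialExt f)) c (x := y)
  have h4 : fderiv ℝ (fun y => c⁻¹ • fderiv ℝ (radialExt f) y) y =
      c⁻¹ • fderiv ℝ (fderiv ℝ (radialExt f)) y :=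
    congrFun (fderiv_const_smul_field (𝕜 := ℝ) (f := fderiv ℝ (radialExt f)) c⁻¹) y
  rw [h1, h4] at h2
  have h3 := congrArg (fun z => c⁻¹ • z) h2
  simp only [smul_smul, inv_mul_cancel₀ hc.ne', one_smul] at h3
  rw [← h3]
  congr 1
  ring

theorem abs_fderiv_radialExt_le {f : Sph n → ℝ} {R : ℝ} (hf : C1NormLE f R) (x : Sph n) {r : ℝ}
    (hr : 0 < r) (w : Ambient n) :
    |fderiv ℝ (radialExt f) (r • (x : Ambient n)) w| ≤ R / r * ‖w‖ := by
  rw [fderiv_radialExt_smul f hr]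
  have h1 : |fderiv ℝ (radialExt f) (x : Ambient n) w| ≤ R * ‖w‖ := by
    rw [← inner_gradient]
    exact (abs_real_inner_le_norm _ _).trans
      (mul_le_mul_of_nonneg_right (hf x).2 (norm_nonneg w))
  simp only [FunLike.coe_smul, Pi.smul_apply, smul_eq_mul, abs_mul, abs_inv, abs_of_pos hr]
  rw [inv_mul_eq_div, div_mul_eq_mul_div]
  exact div_le_div_of_nonneg_right h1 hr.le

/-- The derivative of a 0-homogeneous function is homogeneous of degree `-1`; this is Euler's
relation for it. -/
theorem fderiv_fderiv_radialExt_self {f : Sph n → ℝ} (h : ContMDiff (𝓡 n) 𝓘(ℝ, ℝ) 2 f)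
    {y : Ambient n} (hy : y ≠ 0) (w : Ambient n) :
    fderiv ℝ (fderiv ℝ (radialExt f)) y y w = -fderiv ℝ (radialExt f) y w := by
  have h1 : HasDerivAt (fun t : ℝ => t • y) y 1 := by
    simpa using (hasDerivAt_id (1 : ℝ)).smul_const y
  have hd : DifferentiableAt ℝ (fderiv ℝ (radialExt f)) y :=
    ((contDiffAt_radialExt h hy).fderiv_right (m := 1) (by norm_num)).differentiableAt (by norm_num)
  have h2 : HasFDerivAt (fderiv ℝ (radialExt f)) (fderiv ℝ (fderiv ℝ (radialExt f)) y)
      ((1 : ℝ) • y) := by simpa using hd.hasFDerivAt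
  have h3 := h2.comp_hasDerivAt 1 h1
  have h4 : HasDerivAt (fun t : ℝ => t⁻¹ • fderiv ℝ (radialExt f) y)
      (-fderiv ℝ (radialExt f) y) 1 := by
    have := (hasDerivAt_inv (one_ne_zero (α := ℝ))).smul_const (fderiv ℝ (radialExt f) y)
    simpa using this
  have h5 := h3.unique (h4.congr_of_eventuallyEq (by
    filter_upwards [lt_mem_nhds one_pos] with t ht using fderiv_radialExt_smul f ht y))
  rw [h5]; rfl

/-- The `C²` norm controls only tangential second derivatives. Splitting `w` into tangential and
radial parts adds one mixed term, which by Euler's relation is at most `2 R`; hence the factor `3`.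
-/
theorem abs_fderiv_fderiv_radialExt_le {f : Sph n → ℝ} {R : ℝ} (hR : 0 ≤ R)
    (h : ContMDiff (𝓡 n) 𝓘(ℝ, ℝ) 2 f)
    (hf : C2NormLE f R) (x : Sph n) {r : ℝ} (hr : 0 < r) {w : Ambient n} (hw : ‖w‖ = 1) :
    |fderiv ℝ (fderiv ℝ (radialExt f)) (r • (x : Ambient n)) w w| ≤ 3 * R / r ^ 2 := by
  rw [fderiv_fderiv_radialExt_smul f hr]
  have hx := sph_ne_zero x
  set s := ⟪(x : Ambient n), w⟫_ℝ with hs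
  set wT := w - s • (x : Ambient n) with hwT
  have hxx : ⟪(x : Ambient n), (x : Ambient n)⟫_ℝ = 1 := by
    rw [real_inner_self_eq_norm_sq, sph_norm, one_pow]
  have hxT : ⟪(x : Ambient n), wT⟫_ℝ = 0 := by
    rw [hwT, inner_sub_right, inner_smul_right, hxx, ← hs]; ring
  have hmem : wT ∈ tangent x := Submodule.mem_orthogonal_singleton_iff_inner_right.2 hxT
  have hs1 : |s| ≤ 1 := by
    have := abs_real_inner_le_norm (x : Ambient n) w
    rwa [sph_norm, hw, one_mul] at this
  have hwT1 : ‖wT‖ ≤ 1 := by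
    have h1 : ‖wT‖ ^ 2 = 1 - s ^ 2 := by
      rw [hwT, norm_sub_sq_real, inner_smul_right, real_inner_comm, ← hs, norm_smul, sph_norm, hw,
        Real.norm_eq_abs, mul_one, sq_abs]
      ring
    nlinarith [sq_nonneg s, norm_nonneg wT]
  have hT : |fderiv ℝ (fderiv ℝ (radialExt f)) x wT wT| ≤ R := by
    refine (hf.2 x wT hmem wT hmem).trans ?_
    have : ‖wT‖ * ‖wT‖ ≤ 1 := by nlinarith [norm_nonneg wT]
    nlinarith
  have h1T : |fderiv ℝ (radialExt f) x wT| ≤ R := by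
    have := abs_fderiv_radialExt_le hf.1 x one_pos wT
    rw [one_smul, div_one] at this
    nlinarith [norm_nonneg wT]
  have hsy : fderiv ℝ (fderiv ℝ (radialExt f)) x wT x =
      fderiv ℝ (fderiv ℝ (radialExt f)) x x wT :=
    ((contDiffAt_radialExt h hx).isSymmSndFDerivAt (by simp)).eq _ _
  have hself := fderiv_fderiv_radialExt_self h hx
  have hx0 : fderiv ℝ (radialExt f) (x : Ambient n) x = 0 :=
    fderiv_radialExt_self ((contDiffAt_radialExt h hx).differentiableAt (by norm_num))
  have hmain : fderiv ℝ (fderiv ℝ (radialExt f)) x w w =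
      fderiv ℝ (fderiv ℝ (radialExt f)) x wT wT - 2 * s * fderiv ℝ (radialExt f) x wT := by
    have hw' : w = wT + s • (x : Ambient n) := by rw [hwT]; abel
    conv_lhs => rw [hw']
    simp only [map_add, map_smul, FunLike.coe_add, Pi.add_apply, FunLike.coe_smul, Pi.smul_apply,
      smul_eq_mul, hsy, hself, hx0]
    ring
  simp only [FunLike.coe_smul, Pi.smul_apply, smul_eq_mul]
  rw [abs_mul, abs_inv, abs_of_pos (pow_pos hr 2), inv_mul_eq_div]
  refine div_le_div_of_nonneg_right ?_ (pow_pos hr 2).le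
  rw [hmain]
  refine (abs_sub _ _).trans ?_
  have h2 : |2 * s * fderiv ℝ (radialExt f) x wT| ≤ 2 * R := by
    rw [abs_mul, abs_mul, abs_two]
    have := mul_le_mul hs1 h1T (abs_nonneg _) zero_le_one
    linarith
  linarith

theorem fderiv_norm_sq_apply (y w : Ambient n) :
    fderiv ℝ (fun z : Ambient n => ‖z‖ ^ 2) y w = 2 * ⟪y, w⟫_ℝ := by
  rw [(hasStrictFDerivAt_norm_sq y).hasFDerivAt.fderiv]
  simp

theorem fderiv_fderiv_norm_sq_apply (y v w : Ambient n) :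
    fderiv ℝ (fderiv ℝ (fun z : Ambient n => ‖z‖ ^ 2)) y v w = 2 * ⟪v, w⟫_ℝ := by
  rw [fderiv_fderiv_apply (contDiff_norm_sq ℝ).contDiffAt]
  simp only [fderiv_norm_sq_apply]
  have h1 : HasFDerivAt (fun z : Ambient n => ⟪z, w⟫_ℝ) (innerSL ℝ w) y :=
    (innerSL ℝ w).hasFDerivAt.congr_of_eventuallyEq
      (.of_forall fun z => by simp [real_inner_comm])
  rw [(h1.const_mul 2).fderiv]
  simp [real_inner_comm]

/-- The sum of the principal curvatures. -/
noncomputable def meanCurv (ρ : Sph n → ℝ) (x : Sph n) : ℝ := (principalCurvatures ρ x).esymm 1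

theorem esymm_one_map (κ : Fin n → ℝ) : (Finset.univ.val.map κ).esymm 1 = ∑ i, κ i := by
  rw [← ElemSymm.E_eq_esymm, ElemSymm.E_one]

/-- The tangential trace is the full trace minus the normal entry. This expression involves no
choice of tangent frame, so it shows that the mean curvature is continuous and its maxima exist. -/
theorem meanCurv_eq {ρ : Sph n → ℝ} (h : ContMDiff (𝓡 n) 𝓘(ℝ, ℝ) 4 ρ)
    (hρ : ∀ x, 0 < ρ x) (x : Sph n) :
    meanCurv ρ x = (∑ j, hess ρ (position ρ x) (EuclideanSpace.basisFun _ ℝ j)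
      (EuclideanSpace.basisFun _ ℝ j) - hess ρ (position ρ x) (normal ρ x) (normal ρ x)) /
      ‖gradient (gauge ρ) (position ρ x)‖ := by
  obtain ⟨e, κ, he, heν, hA, hpc⟩ := exists_principal_frame h hρ x
  obtain ⟨b, hb0, hb⟩ := exists_orthonormalBasis_cons he (normal_norm h hρ x) heν
  rw [meanCurv, hpc, esymm_one_map,
    ← sum_bilin_orthonormalBasis b (EuclideanSpace.basisFun _ ℝ) (hess ρ (position ρ x)),
    Fin.sum_univ_succ, hb0, add_sub_cancel_left, Finset.sum_div]
  refine Finset.sum_congr rfl fun i _ => ?_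
  have := congrFun (congrFun hA i) i
  simp only [shapeMatrix, Matrix.of_apply, Matrix.diagonal_apply_eq] at this
  rw [hb, this]

theorem continuous_position {ρ : Sph n → ℝ} (h : ContMDiff (𝓡 n) 𝓘(ℝ, ℝ) 4 ρ) :
    Continuous (position ρ) := h.continuous.smul continuous_subtype_val

theorem continuous_gradient_gauge {ρ : Sph n → ℝ} (h : ContMDiff (𝓡 n) 𝓘(ℝ, ℝ) 4 ρ)
    (hρ : ∀ x, 0 < ρ x) : Continuous fun x => gradient (gauge ρ) (position ρ x) := by
  refine continuous_iff_continuousAt.2 fun x => ?_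
  have h1 : ContinuousAt (fderiv ℝ (gauge ρ)) (position ρ x) :=
    ((contDiffAt_gauge h hρ (position_ne_zero hρ x)).fderiv_right (m := 3)
      (by norm_num)).continuousAt
  have h2 : ContinuousAt (fun x => fderiv ℝ (gauge ρ) (position ρ x)) x :=
    ContinuousAt.comp (g := fderiv ℝ (gauge ρ)) h1 (continuous_position h).continuousAt
  exact (InnerProductSpace.toDual ℝ (Ambient n)).symm.continuous.continuousAt.comp h2

theorem continuous_normal {ρ : Sph n → ℝ} (h : ContMDiff (𝓡 n) 𝓘(ℝ, ℝ) 4 ρ)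
    (hρ : ∀ x, 0 < ρ x) : Continuous (normal ρ) := by
  rw [show normal ρ = fun x => ‖gradient (gauge ρ) (position ρ x)‖⁻¹ •
    gradient (gauge ρ) (position ρ x) from funext fun x => normal_eq h hρ x]
  have hg := continuous_gradient_gauge h hρ
  exact (hg.norm.inv₀ fun x => (gradient_gauge_ne_zero h hρ x).ne').smul hg

theorem continuous_meanCurv {ρ : Sph n → ℝ} (h : ContMDiff (𝓡 n) 𝓘(ℝ, ℝ) 4 ρ)
    (hρ : ∀ x, 0 < ρ x) : Continuous (meanCurv ρ) := by
  rw [show meanCurv ρ = _ from funext fun x => meanCurv_eq h hρ x]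
  have hh : Continuous fun x => hess ρ (position ρ x) := by
    refine continuous_iff_continuousAt.2 fun x => ?_
    have h1 : ContinuousAt (hess ρ) (position ρ x) :=
      (((contDiffAt_gauge h hρ (position_ne_zero hρ x)).fderiv_right (m := 3)
        (by norm_num)).fderiv_right (m := 2) (by norm_num)).continuousAt
    exact ContinuousAt.comp (g := hess ρ) h1 (continuous_position h).continuousAt
  have hN := continuous_normal h hρ
  refine Continuous.div ?_ (continuous_gradient_gauge h hρ).norm
    fun x => (gradient_gauge_ne_zero h hρ x).ne'
  refine Continuous.sub (continuous_finsetSum _ fun j _ => ?_) ?_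
  · exact (hh.clm_apply continuous_const).clm_apply continuous_const
  · exact (hh.clm_apply hN).clm_apply hN

/-- The support function `⟨X, ν⟩`. -/
noncomputable def support (ρ : Sph n → ℝ) (x : Sph n) : ℝ := ⟪position ρ x, normal ρ x⟫_ℝ

theorem support_pos {ρ : Sph n → ℝ} (h : ContMDiff (𝓡 n) 𝓘(ℝ, ℝ) 4 ρ)
    (hρ : ∀ x, 0 < ρ x) (x : Sph n) : 0 < support ρ x := by
  rw [support, inner_position_normal h hρ]
  exact inv_pos.2 (gradient_gauge_ne_zero h hρ x)

theorem continuous_support {ρ : Sph n → ℝ} (h : ContMDiff (𝓡 n) 𝓘(ℝ, ℝ) 4 ρ)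
    (hρ : ∀ x, 0 < ρ x) : Continuous (support ρ) :=
  (continuous_position h).inner (continuous_normal h hρ)

theorem exists_max_log_meanCurv {ρ : Sph n → ℝ} (h : ContMDiff (𝓡 n) 𝓘(ℝ, ℝ) 4 ρ)
    (hρ : ∀ x, 0 < ρ x) (hH : ∀ x, 0 < meanCurv ρ x) (x : Sph n) :
    ∃ x₀, ∀ x, Real.log (meanCurv ρ x) - Real.log (support ρ x) ≤
      Real.log (meanCurv ρ x₀) - Real.log (support ρ x₀) := by
  have hc : Continuous fun x => Real.log (meanCurv ρ x) - Real.log (support ρ x) :=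
    ((continuous_meanCurv h hρ).log fun x => (hH x).ne').sub
      ((continuous_support h hρ).log fun x => (support_pos h hρ x).ne')
  obtain ⟨x₀, -, hx₀⟩ := isCompact_univ.exists_isMaxOn ⟨x, Set.mem_univ x⟩ hc.continuousOn
  exact ⟨x₀, fun x => hx₀ (Set.mem_univ x)⟩

theorem norm_position {ρ : Sph n → ℝ} (hρ : ∀ x, 0 < ρ x) (x : Sph n) :
    ‖position ρ x‖ = ρ x := by
  rw [position, norm_smul, sph_norm, mul_one, Real.norm_of_nonneg (hρ x).le]

theorem support_le {ρ : Sph n → ℝ} (h : ContMDiff (𝓡 n) 𝓘(ℝ, ℝ) 4 ρ)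
    (hρ : ∀ x, 0 < ρ x) {R : ℝ} (hR : C1NormLE ρ R) (x : Sph n) : support ρ x ≤ R := by
  refine (real_inner_le_norm _ _).trans ?_
  rw [normal_norm h hρ, mul_one, norm_position hρ]
  exact (le_abs_self _).trans (hR x).1

/-- The support function is `ρ² / √(ρ² + |∇ρ|²)`, and the root is at most `√2 R ≤ 2 R`. -/
theorem le_support {ρ : Sph n → ℝ} (h : ContMDiff (𝓡 n) 𝓘(ℝ, ℝ) 4 ρ)
    {r R : ℝ} (hr : 0 < r) (hρr : ∀ x, r ≤ ρ x) (hR : C1NormLE ρ R) (x : Sph n) :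
    r ^ 2 / (2 * R) ≤ support ρ x := by
  have hρ : ∀ x, 0 < ρ x := fun x => hr.trans_le (hρr x)
  have hR1 : ρ x ≤ R := (le_abs_self _).trans (hR x).1
  have hR0 : 0 < R := (hρ x).trans_le hR1
  rw [support, inner_position_normal h hρ, norm_gradient_gauge h hρ, inv_div]
  have hs : 0 < √(ρ x ^ 2 + ‖sphGrad ρ x‖ ^ 2) := Real.sqrt_pos.2 (by have := hρ x; positivity)
  refine div_le_div₀ (sq_nonneg _) (pow_le_pow_left₀ hr.le (hρr x) 2) hs ?_
  rw [Real.sqrt_le_left (by positivity)]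
  have h1 := pow_le_pow_left₀ (hρ x).le hR1 2
  have h2 := pow_le_pow_left₀ (norm_nonneg _) (hR x).2 2
  nlinarith

end StarShapedHypersurface

/-! ### The curvature equation at the maximum point -/

open ElemSymm

namespace StarShapedHypersurface
variable {n : ℕ}

theorem exists_map_eq_principalCurvatures {ρ : Sph n → ℝ} (h : ContMDiff (𝓡 n) 𝓘(ℝ, ℝ) 4 ρ)
    (hρ : ∀ x, 0 < ρ x) (x : Sph n) :
    ∃ κ : Fin n → ℝ, principalCurvatures ρ x = Finset.univ.val.map κ := by
  obtain ⟨e, κ, -, -, -, hpc⟩ := exists_principal_frame h hρ x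
  exact ⟨κ, hpc⟩

theorem gar_of_isPKConvex {p k : ℕ} {ρ : Sph n → ℝ} (hK : IsPKConvex p k ρ) {x : Sph n}
    {κ : Fin n → ℝ} (hκ : principalCurvatures ρ x = Finset.univ.val.map κ) :
    Gar (idx n p) k (sums κ) := fun j h1 h2 => by
  have := hK x j h1 h2
  rwa [hκ, esymm_Lam] at this

theorem meanCurv_pos {p k : ℕ} (hp : 1 ≤ p) (hk : 1 ≤ k) {ρ : Sph n → ℝ}
    (h : ContMDiff (𝓡 n) 𝓘(ℝ, ℝ) 4 ρ) (hρ : ∀ x, 0 < ρ x) (hK : IsPKConvex p k ρ) (x : Sph n) :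
    0 < meanCurv ρ x ∧ (0 : ℝ) < (n - 1).choose (p - 1) := by
  obtain ⟨κ, hκ⟩ := exists_map_eq_principalCurvatures h hρ x
  have h1 := gar_of_isPKConvex hK hκ 1 le_rfl hk
  rw [E_one_sums hp] at h1
  rw [meanCurv, hκ, esymm_one_map]
  have h2 : (0 : ℝ) ≤ (n - 1).choose (p - 1) := Nat.cast_nonneg _
  exact ⟨pos_of_mul_pos_right h1 h2, pos_of_mul_pos_left h1
    (pos_of_mul_pos_right h1 h2).le⟩

/-- The curvature equation for the concave operator `(σ_k / σ_1)^{1/(k-1)}`. -/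
theorem G_sums_eq {p m : ℕ} {b q : ℝ} (hp : 1 ≤ p) {f ρ : Sph n → ℝ}
    (h : ContMDiff (𝓡 n) 𝓘(ℝ, ℝ) 4 ρ) (hρ : ∀ x, 0 < ρ x) (hf : ∀ x, 0 < f x)
    (hK : IsPKConvex p (m + 2) ρ) (hS : SolvesCurvatureEq p (m + 2) b q f ρ) {x : Sph n}
    {κ : Fin n → ℝ} (hκ : principalCurvatures ρ x = Finset.univ.val.map κ) :
    G (idx n p) m (sums κ) = Real.exp (((m + 1 : ℕ) : ℝ)⁻¹ *
      (Real.log (f x) + b * Real.log (ρ x) + (q - 1) * Real.log (support ρ x) -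
        (Real.log (meanCurv ρ x) - Real.log (support ρ x)) -
        Real.log ((n - 1).choose (p - 1)))) := by
  obtain ⟨hH, hc⟩ := meanCurv_pos hp (by omega) h hρ hK x
  have hu := support_pos h hρ x
  have h1 : E (idx n p) (m + 2) (sums κ) = f x * ρ x ^ b * support ρ x ^ q := by
    rw [← esymm_Lam, ← hκ, hS x, norm_position hρ, support]
  have h2 : E (idx n p) 1 (sums κ) = (n - 1).choose (p - 1) * meanCurv ρ x := by
    rw [E_one_sums hp, meanCurv, hκ, esymm_one_map]
  have hf1 := hf x
  have hb := Real.rpow_pos_of_pos (hρ x) b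
  have hq := Real.rpow_pos_of_pos hu q
  rw [G, h1, h2, Real.rpow_def_of_pos (by positivity), Real.log_div (by positivity) (by positivity),
    Real.log_mul (by positivity) (by positivity), Real.log_mul (by positivity) (by positivity),
    Real.log_mul (by positivity) (by positivity), Real.log_rpow (hρ x), Real.log_rpow hu]
  congr 1
  ring

/-- The first derivative of `log f (y / |y|) + b log |y|`. -/
noncomputable def logDeriv (f : Sph n → ℝ) (b : ℝ) (y w : Ambient n) : ℝ :=
  fderiv ℝ (radialExt f) y w / radialExt f y + b / 2 * (2 * ⟪y, w⟫_ℝ / ‖y‖ ^ 2)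

/-- The second derivative of `log f (y / |y|) + b log |y|` as a quadratic form. -/
noncomputable def logHess (f : Sph n → ℝ) (b : ℝ) (y w : Ambient n) : ℝ :=
  fderiv ℝ (fderiv ℝ (radialExt f)) y w w / radialExt f y -
    (fderiv ℝ (radialExt f) y w / radialExt f y) ^ 2 +
    b / 2 * (2 * ⟪w, w⟫_ℝ / ‖y‖ ^ 2 - (2 * ⟪y, w⟫_ℝ / ‖y‖ ^ 2) ^ 2)

/-- The curvature inequality at the maximum point of `log H - log ⟨X, ν⟩`. -/
theorem exists_curvature_bound_at_max {p m : ℕ} {b q : ℝ} (hp : 1 ≤ p) (hq : q ≤ 1)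
    {f ρ : Sph n → ℝ} (hf2 : ContMDiff (𝓡 n) 𝓘(ℝ, ℝ) 2 f)
    (h : ContMDiff (𝓡 n) 𝓘(ℝ, ℝ) 4 ρ) (hf0 : ∀ x, 0 < f x)
    (hρ : ∀ x, 0 < ρ x) (hK : IsPKConvex p (m + 2) ρ) (hS : SolvesCurvatureEq p (m + 2) b q f ρ)
    {x : Sph n} (hmax : ∀ z, Real.log (meanCurv ρ z) - Real.log (support ρ z) ≤
      Real.log (meanCurv ρ x) - Real.log (support ρ x)) :
    ∃ (e : Fin n → Ambient n) (κ : Fin n → ℝ), Orthonormal ℝ e ∧ meanCurv ρ x = ∑ i, κ i ∧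
      (∑ i, κ i ^ 2) / meanCurv ρ x ≤ 1 / support ρ x +
        ((m + 1 : ℕ) : ℝ)⁻¹ * (1 - q) / support ρ x +
        ((m + 1 : ℕ) : ℝ)⁻¹ *
          (∑ j, ⟪e j, position ρ x⟫_ℝ * logDeriv f b (position ρ x) (e j)) / support ρ x -
        ((m + 1 : ℕ) : ℝ)⁻¹ * (∑ j, (logHess f b (position ρ x) (e j) -
          κ j * logDeriv f b (position ρ x) (normal ρ x))) / meanCurv ρ x := by
  obtain ⟨hH, hc⟩ := meanCurv_pos hp (by omega) h hρ hK x
  have hu := support_pos h hρ x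
  have hr := hρ x
  set X := position ρ x with hX
  set ν := normal ρ x with hν
  set H := meanCurv ρ x with hHdef
  set u := support ρ x with hudef
  have hX0 : X ≠ 0 := position_ne_zero hρ x
  have hνn : ‖ν‖ = 1 := normal_norm h hρ x
  have hνν : ⟪ν, ν⟫_ℝ = 1 := by rw [real_inner_self_eq_norm_sq, hνn, one_pow]
  obtain ⟨e, κ, he, heν, hdiag, hpc⟩ := exists_principal_frame h hρ x
  rw [← hX] at hdiag
  rw [← hν] at heν
  obtain ⟨v, hv, hv0, hdv, hlev⟩ := exists_graph h hρ x
  rw [← hX, ← hν] at hlev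
  have hY0 : graphMap X ν v 0 = X := by simp [graphMap, hv0]
  have hνe : ∀ i, ⟪ν, e i⟫_ℝ = 0 := fun i => by rw [real_inner_comm, heν]
  have hκ : ∀ i j, fderiv ℝ (fderiv ℝ v) 0 (e i) (e j) = if i = j then κ i else 0 := by
    intro i j
    have h1 := (fderiv_level_set (P := gauge ρ) (Y := graphMap X ν v) (x := 0) (c := 1)
      (by rw [hY0]; exact (contDiffAt_gauge h hρ hX0).of_le (by norm_num))
      ((contDiffAt_graphMap X ν hv).of_le (by norm_num)) hlev).2 (e i) (e j)
    have hΓ0 : 0 < ‖gradient (gauge ρ) X‖ := gradient_gauge_ne_zero h hρ x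
    have hDν : fderiv ℝ (gauge ρ) X ν = ‖gradient (gauge ρ) X‖ := by
      rw [← inner_gradient, ← norm_smul_normal h hρ x, ← hν, inner_smul_left, hνν, norm_smul, hνn]
      simp
    have hY1 : ∀ i, fderiv ℝ (graphMap X ν v) 0 (e i) = e i := fun i => by
      rw [hasFDerivAt_graphMap X ν (hv.differentiableAt (by norm_num)), hνe, hdv]; simp
    rw [hY1, hY1, fderiv_fderiv_graphMap X ν (hv.of_le (by norm_num)), hY0, map_smul, hDν] at h1
    have h2 := congrFun (congrFun hdiag i) j
    simp only [shapeMatrix, Matrix.of_apply, Matrix.diagonal_apply, hess] at h2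
    rw [← h2, eq_div_iff hΓ0.ne']
    simp only [smul_eq_mul] at h1
    linarith
  have hKκ := gar_of_isPKConvex hK hpc
  obtain ⟨F, hF0, hFκ, hF⟩ := exists_supergradient hp hKκ
  set β : ℝ := ((m + 1 : ℕ) : ℝ)⁻¹ with hβ
  have hβ0 : 0 ≤ β := by positivity
  set c : ℝ := ((n - 1).choose (p - 1) : ℝ) with hcdef
  set T : Fin n → Fin n → ℝ := fun i m =>
    fderiv ℝ (fun y => fderiv ℝ (fderiv ℝ v) y (e i) (e i)) 0 (e m) with hT
  set Q : Fin n → Fin n → ℝ := fun i m =>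
    fderiv ℝ (fderiv ℝ (fun y => fderiv ℝ (fderiv ℝ v) y (e i) (e i))) 0 (e m) (e m) with hQ
  have hHκ : H = ∑ i, κ i := by rw [hHdef, meanCurv, hpc, esymm_one_map]
  have huX : ⟪ν, X⟫_ℝ = u := real_inner_comm _ _
  set a : Fin n → ℝ := fun i => ⟪e i, X⟫_ℝ with ha
  set L1 : Fin n → ℝ := fun m => logDeriv f b X (e m) with hL1
  set L2 : Fin n → ℝ := fun m => logHess f b X (e m) - κ m * logDeriv f b X ν with hL2
  set j1 : Fin n → ℝ := fun m => β * (L1 m + (q - 1) * (a m * κ m / u)) with hj1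
  set Hm : Fin n → ℝ := fun m => ∑ i, T i m with hHm
  set HH : Fin n → ℝ := fun m => ∑ i, Q i m - H * κ m ^ 2 - 2 * κ m ^ 3 with hHH
  set uu : Fin n → ℝ := fun m => ∑ j, a j * T m j + κ m - u * κ m ^ 2 with huu
  set w2 : Fin n → ℝ := fun m => (HH m / H - (Hm m / H) ^ 2) -
    (uu m / u - (a m * κ m / u) ^ 2) with hw2
  set j2 : Fin n → ℝ := fun m => β * (L2 m + (q - 1) * (uu m / u - (a m * κ m / u) ^ 2) - w2 m)
    with hj2
  set Ψ := G (idx n p) m (sums κ) with hΨ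
  have hΨ0 : 0 < Ψ := G_pos hKκ
  have hXr : ‖X‖ = ρ x := norm_position hρ x
  have hfX : radialExt f X = f x := by rw [hX, position, radialExt_smul_coe f hr]
  -- In each principal direction, two scalar functions of `t` have a local minimum at `0`: `-w`, and
  -- the supergradient bound minus the right-hand side of the equation.
  have hkey : ∀ m', Hm m' / H = a m' * κ m' / u ∧ w2 m' ≤ 0 ∧ (∑ i, F i * T i m' = Ψ * j1 m') ∧
      Ψ * (j2 m' + j1 m' ^ 2) ≤
        ∑ i, F i * (Q i m' - κ i * κ m' ^ 2 - if i = m' then 2 * κ i ^ 3 else 0) := by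
    intro d
    have jA : ∀ i, HasJet (fun t : ℝ => graphShape v e i (t • e d)) (κ i) (T i d)
        (Q i d - κ i * κ d ^ 2 - if i = d then 2 * κ i ^ 3 else 0) :=
      fun i => hasJet_graphShape hv hdv hκ i d
    have jH : HasJet (fun t : ℝ => ∑ i, graphShape v e i (t • e d)) H (Hm d) (HH d) := by
      refine (HasJet.sum Finset.univ fun i _ => jA i).cast hHκ.symm rfl ?_
      simp only [hHH, Finset.sum_sub_distrib, Finset.sum_ite_eq', Finset.mem_univ, if_true,
        ← Finset.sum_mul, hHκ]
    have ju : HasJet (fun t : ℝ => graphS X ν v e (t • e d) * (graphW v e (t • e d))⁻¹) u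
        (a d * κ d) (uu d) :=
      (hasJet_support hνn he heν hv hv0 hdv hκ d).cast huX rfl (by rw [huX])
    have jf := (hasJet_comp_graphMap (X := X) heν hv hv0 hdv hκ (contDiffAt_radialExt hf2 hX0)
      d).log (by rw [hfX]; exact hf0 x)
    -- The term `b log |X|` is treated as `(b/2) log |X|²`, whose argument is a polynomial.
    have jn := (hasJet_comp_graphMap (X := X) heν hv hv0 hdv hκ
      (contDiff_norm_sq ℝ (E := Ambient n) (n := 2)).contDiffAt d).log (by rw [hXr]; positivity)
    have jL : HasJet (fun t : ℝ => Real.log (radialExt f (graphMap X ν v (t • e d))) +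
        b / 2 * Real.log (‖graphMap X ν v (t • e d)‖ ^ 2))
        (Real.log (f x) + b / 2 * Real.log (ρ x ^ 2)) (L1 d) (L2 d) := by
      refine (jf.add (jn.const_mul (b / 2))).cast ?_ ?_ ?_
      · rw [hfX, hXr]
      · rw [fderiv_norm_sq_apply]
        rfl
      · rw [fderiv_norm_sq_apply, fderiv_norm_sq_apply, fderiv_fderiv_norm_sq_apply]
        simp only [hL2, logHess, logDeriv]
        ring
    have jw := (jH.log hH).sub (ju.log hu)
    have jΨ := (((((jL.add ((ju.log hu).const_mul (q - 1))).sub jw).sub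
      (HasJet.const (Real.log c))).const_mul β)).exp
    have hline : Tendsto (fun t : ℝ => t • e d) (𝓝 0) (𝓝 0) := by
      have : Continuous fun t : ℝ => t • e d := by fun_prop
      simpa using this.tendsto 0
    -- Nearby points of the graph belong to the hypersurface, so the global maximum, the convexity
    -- and the equation may be used there.
    have hgeo : ∀ᶠ t : ℝ in 𝓝 0, ∃ z : Sph n, position ρ z = graphMap X ν v (t • e d) ∧
        support ρ z = graphS X ν v e (t • e d) * (graphW v e (t • e d))⁻¹ ∧
        ∃ (A : Matrix (Fin n) (Fin n) ℝ) (hA : A.IsHermitian),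
          principalCurvatures ρ z = Finset.univ.val.map hA.eigenvalues ∧
          ∀ i, A i i = graphShape v e i (t • e d) := by
      have hupos : ∀ᶠ t : ℝ in 𝓝 0,
          0 < graphS X ν v e (t • e d) * (graphW v e (t • e d))⁻¹ := by
        exact ju.hasDerivAt.continuousAt.eventually (lt_mem_nhds (hu.trans_eq ju.value.symm))
      filter_upwards [hupos, hline.eventually hlev.eventually_nhds,
        hline.eventually ((hv.of_le (show (2 : ℕ∞ω) ≤ 4 by norm_num)).eventually (by simp))]
        with t h1 h2 h3
      refine graph_geometry h hρ hνn he heν h3 h2 (pos_of_mul_pos_left h1 ?_)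
      exact inv_nonneg.2 (Real.sqrt_nonneg _)
    have htrace : ∀ {z : Sph n} {A : Matrix (Fin n) (Fin n) ℝ} (hA : A.IsHermitian),
        principalCurvatures ρ z = Finset.univ.val.map hA.eigenvalues →
        meanCurv ρ z = ∑ i, A i i := fun {z A} hA hz => by
      rw [meanCurv, hz, esymm_one_map]
      have := hA.trace_eq_sum_eigenvalues
      simpa [Matrix.trace] using this.symm
    have hmaxw : IsLocalMin (fun t : ℝ => -(Real.log (∑ i, graphShape v e i (t • e d)) -
        Real.log (graphS X ν v e (t • e d) * (graphW v e (t • e d))⁻¹))) 0 := by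
      filter_upwards [hgeo] with t ⟨z, hz1, hz2, A, hA, hz3, hz4⟩
      have h1 := hmax z
      rw [htrace hA hz3, hz2, Finset.sum_congr rfl fun i _ => hz4 i] at h1
      rw [jw.neg.value]
      linarith
    obtain ⟨hw1, hw2'⟩ := jw.neg.of_isLocalMin hmaxw
    have jΦ := (HasJet.sum Finset.univ fun i _ => (jA i).const_mul (F i)).sub jΨ
    have hΨeq : Ψ = Real.exp (β * (Real.log (f x) + b / 2 * Real.log (ρ x ^ 2) +
        (q - 1) * Real.log u - (Real.log H - Real.log u) - Real.log c)) := by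
      rw [hΨ, G_sums_eq hp h hρ hf0 hK hS hpc, Real.log_pow]
      congr 2
      push_cast
      ring
    -- By Schur–Horn and the equation this function is nonnegative near `0`, and it vanishes at `0`
    -- by Euler's relation.
    have hΦ : IsLocalMin (fun t : ℝ => ∑ i, F i * graphShape v e i (t • e d) -
        Real.exp (β * (Real.log (radialExt f (graphMap X ν v (t • e d))) +
          b / 2 * Real.log (‖graphMap X ν v (t • e d)‖ ^ 2) +
          (q - 1) * Real.log (graphS X ν v e (t • e d) * (graphW v e (t • e d))⁻¹) -
          (Real.log (∑ i, graphShape v e i (t • e d)) -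
            Real.log (graphS X ν v e (t • e d) * (graphW v e (t • e d))⁻¹)) -
          Real.log c))) 0 := by
      filter_upwards [hgeo] with t ⟨z, hz1, hz2, A, hA, hz3, hz4⟩
      have h1 := G_eigenvalues_le hA (gar_of_isPKConvex hK hz3) hF
      rw [G_sums_eq hp h hρ hf0 hK hS hz3, htrace hA hz3, hz2] at h1
      simp only [hz4] at h1
      rw [jΦ.value, ← hΨeq, hFκ, sub_self, ← hz1, norm_position hρ, Real.log_pow,
        position, radialExt_smul_coe f (hρ z)]
      have h2 : b / 2 * ((2 : ℕ) * Real.log (ρ z)) = b * Real.log (ρ z) := by push_cast; ring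
      rw [h2]
      exact sub_nonneg.2 h1
    obtain ⟨hΦ1, hΦ2⟩ := jΦ.of_isLocalMin hΦ
    have hw1' : Hm d / H = a d * κ d / u := by linarith
    rw [← hΨeq] at hΦ1 hΦ2
    refine ⟨hw1', by linarith, ?_, ?_⟩
    · have : j1 d = β * (L1 d + (q - 1) * (a d * κ d / u) - (Hm d / H - a d * κ d / u) - 0) := by
        rw [hw1', hj1]; ring
      rw [this]; linarith
    · have h3 : j1 d = β * (L1 d + (q - 1) * (a d * κ d / u) - (Hm d / H - a d * κ d / u) - 0) := by
        rw [hw1', hj1]; ring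
      have h4 : j2 d = β * (L2 d + (q - 1) * (uu d / u - (a d * κ d / u) ^ 2) -
          ((HH d / H - (Hm d / H) ^ 2) - (uu d / u - (a d * κ d / u) ^ 2)) - 0) := by
        simp only [hj2, hw2]; ring
      rw [h3, h4]; linarith
  refine ⟨e, κ, he, hHκ, ?_⟩
  exact curvature_bound_at_max (κ := κ) (F := F) (a := a) (L1 := L1) (L2 := L2)
    (Hm := Hm) (HH := HH) (um := fun m => a m * κ m) (uu := uu) (j1 := j1) (j2 := j2) (w2 := w2)
    (T := T) (Q := Q) hH hu hΨ0 hβ0 hq hF0 hFκ hHκ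
    (fun i j => fderiv_fourth_comm hv (e i) (e j)) (fun _ => rfl) (fun _ => rfl)
    (fun _ => rfl) (fun m => (hkey m).1) (fun _ => rfl) (fun m => (hkey m).2.1)
    (fun _ => rfl) (fun _ => rfl) (fun m => (hkey m).2.2.1) (fun m => (hkey m).2.2.2)

end StarShapedHypersurface

/-! ### Explicit constants -/

namespace StarShapedHypersurface
variable {n : ℕ}

theorem abs_logDeriv_le {b Rf fmin : ℝ} (hfmin : 0 < fmin) {f : Sph n → ℝ} (hRf : C1NormLE f Rf)
    (hf : ∀ x, fmin ≤ f x) (x : Sph n) {r : ℝ} (hr : 0 < r) {w : Ambient n} (hw : ‖w‖ = 1) :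
    |logDeriv f b (r • (x : Ambient n)) w| ≤ Rf / (r * fmin) + |b| / r := by
  have hf0 : 0 < f x := hfmin.trans_le (hf x)
  have hRf0 : 0 ≤ Rf := (abs_nonneg _).trans (hRf x).1
  have hX : ‖r • (x : Ambient n)‖ = r := by
    rw [norm_smul, sph_norm, mul_one, Real.norm_of_nonneg hr.le]
  rw [logDeriv, radialExt_smul_coe f hr, hX]
  refine (abs_add_le _ _).trans (add_le_add ?_ ?_)
  · have h1 := abs_fderiv_radialExt_le hRf x hr w
    rw [hw, mul_one] at h1
    rw [abs_div, abs_of_pos hf0, ← div_div]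
    exact div_le_div₀ (by positivity) h1 hfmin (hf x)
  · have h1 := abs_real_inner_le_norm (r • (x : Ambient n)) w
    rw [hX, hw, mul_one] at h1
    have h2 : b / 2 * (2 * ⟪r • (x : Ambient n), w⟫_ℝ / r ^ 2) =
      b * (⟪r • (x : Ambient n), w⟫_ℝ / r ^ 2) := by ring
    rw [h2, abs_mul, abs_div, abs_of_pos (pow_pos hr 2), div_eq_mul_inv |b|]
    refine mul_le_mul_of_nonneg_left ?_ (abs_nonneg _)
    rwa [div_le_iff₀ (by positivity), sq, inv_mul_cancel_left₀ hr.ne']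

theorem neg_logHess_le {b Rf fmin : ℝ} (hfmin : 0 < fmin) {f : Sph n → ℝ}
    (hf2 : ContMDiff (𝓡 n) 𝓘(ℝ, ℝ) 2 f) (hRf : C2NormLE f Rf)
    (hf : ∀ x, fmin ≤ f x) (x : Sph n) {r : ℝ} (hr : 0 < r) {w : Ambient n} (hw : ‖w‖ = 1) :
    -logHess f b (r • (x : Ambient n)) w ≤
      3 * Rf / (r ^ 2 * fmin) + (Rf / (r * fmin)) ^ 2 + 3 * |b| / r ^ 2 := by
  have hf0 : 0 < f x := hfmin.trans_le (hf x)
  have hRf0 : 0 ≤ Rf := (abs_nonneg _).trans (hRf.1 x).1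
  have hX : ‖r • (x : Ambient n)‖ = r := by
    rw [norm_smul, sph_norm, mul_one, Real.norm_of_nonneg hr.le]
  rw [logHess, radialExt_smul_coe f hr, hX, real_inner_self_eq_norm_sq, hw]
  have h1 : |fderiv ℝ (fderiv ℝ (radialExt f)) (r • (x : Ambient n)) w w / f x| ≤
      3 * Rf / (r ^ 2 * fmin) := by
    have h1 := abs_fderiv_fderiv_radialExt_le hRf0 hf2 hRf x hr hw
    rw [abs_div, abs_of_pos hf0, ← div_div]
    exact div_le_div₀ (by positivity) h1 hfmin (hf x)
  have h2 : (fderiv ℝ (radialExt f) (r • (x : Ambient n)) w / f x) ^ 2 ≤ (Rf / (r * fmin)) ^ 2 := by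
    have h3 := abs_fderiv_radialExt_le hRf.1 x hr w
    rw [hw, mul_one] at h3
    rw [← sq_abs]
    refine pow_le_pow_left₀ (abs_nonneg _) ?_ 2
    rw [abs_div, abs_of_pos hf0, ← div_div]
    exact div_le_div₀ (by positivity) h3 hfmin (hf x)
  have h3 : (⟪r • (x : Ambient n), w⟫_ℝ / r ^ 2) ^ 2 ≤ 1 / r ^ 2 := by
    have h4 := abs_real_inner_le_norm (r • (x : Ambient n)) w
    rw [hX, hw, mul_one] at h4
    have h5 := pow_le_pow_left₀ (abs_nonneg _) h4 2
    rw [sq_abs] at h5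
    rw [div_pow, div_le_div_iff₀ (by positivity) (by positivity), one_mul]
    calc _ ≤ r ^ 2 * r ^ 2 := mul_le_mul_of_nonneg_right h5 (by positivity)
      _ = _ := by ring
  have h4 : 2 * b * (⟪r • (x : Ambient n), w⟫_ℝ / r ^ 2) ^ 2 ≤ 2 * |b| * (1 / r ^ 2) :=
    mul_le_mul (by linarith [le_abs_self b]) h3 (sq_nonneg _) (by positivity)
  have h5 : -(b * (1 / r ^ 2)) ≤ |b| * (1 / r ^ 2) := by
    rw [← neg_mul]; exact mul_le_mul_of_nonneg_right (neg_le_abs _) (by positivity)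
  have h6 := (neg_le_abs _).trans h1
  have h7 : b / 2 * (2 * 1 ^ 2 / r ^ 2 - (2 * ⟪r • (x : Ambient n), w⟫_ℝ / r ^ 2) ^ 2) =
      b * (1 / r ^ 2) - 2 * b * (⟪r • (x : Ambient n), w⟫_ℝ / r ^ 2) ^ 2 := by ring
  have h8 : 3 * |b| / r ^ 2 = 2 * |b| * (1 / r ^ 2) + |b| * (1 / r ^ 2) := by ring
  rw [h7, h8]
  linarith

/-- The mean curvature at the maximum point of `log H - log ⟨X, ν⟩`. -/
theorem meanCurv_div_le_at_max {p m : ℕ} {b q Rf fmin : ℝ} (hp : 1 ≤ p) (hq : q ≤ 1)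
    (hfmin : 0 < fmin) {f ρ : Sph n → ℝ} (hf2 : ContMDiff (𝓡 n) 𝓘(ℝ, ℝ) 2 f)
    (h : ContMDiff (𝓡 n) 𝓘(ℝ, ℝ) 4 ρ) (hRf : C2NormLE f Rf) (hf : ∀ x, fmin ≤ f x)
    (hρ : ∀ x, 0 < ρ x) (hK : IsPKConvex p (m + 2) ρ) (hS : SolvesCurvatureEq p (m + 2) b q f ρ)
    {x : Sph n} (hmax : ∀ z, Real.log (meanCurv ρ z) - Real.log (support ρ z) ≤
      Real.log (meanCurv ρ x) - Real.log (support ρ x)) :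
    meanCurv ρ x / n ≤ 1 / support ρ x + (1 - q) / support ρ x +
      n * (Rf / fmin + |b|) / support ρ x +
      n * (3 * Rf / (ρ x ^ 2 * fmin) + (Rf / (ρ x * fmin)) ^ 2 + 3 * |b| / ρ x ^ 2) /
        meanCurv ρ x + (Rf / (ρ x * fmin) + |b| / ρ x) := by
  have hf0 : ∀ x, 0 < f x := fun x => hfmin.trans_le (hf x)
  obtain ⟨e, κ, he, hHκ, hbound⟩ := exists_curvature_bound_at_max hp hq hf2 h hf0 hρ hK hS hmax
  have hRf0 : 0 ≤ Rf := (abs_nonneg _).trans (hRf.1 x).1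
  have hH := (meanCurv_pos hp (by omega) h hρ hK x).1
  have hu := support_pos h hρ x
  have hr := hρ x
  have hXr := norm_position hρ x
  have hD1 : ∀ w : Ambient n, ‖w‖ = 1 →
      |logDeriv f b (position ρ x) w| ≤ Rf / (ρ x * fmin) + |b| / ρ x :=
    fun w hw => abs_logDeriv_le hfmin hRf.1 hf x hr hw
  have hD2 : ∀ w : Ambient n, ‖w‖ = 1 → -logHess f b (position ρ x) w ≤
      3 * Rf / (ρ x ^ 2 * fmin) + (Rf / (ρ x * fmin)) ^ 2 + 3 * |b| / ρ x ^ 2 :=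
    fun w hw => neg_logHess_le hfmin hf2 hRf hf x hr hw
  set K1 := Rf / (ρ x * fmin) + |b| / ρ x with hK1
  set K2 := 3 * Rf / (ρ x ^ 2 * fmin) + (Rf / (ρ x * fmin)) ^ 2 + 3 * |b| / ρ x ^ 2 with hK2
  set H := meanCurv ρ x with hHdef
  set u := support ρ x with hudef
  set β : ℝ := ((m + 1 : ℕ) : ℝ)⁻¹ with hβ
  set D := ∑ j, ⟪e j, position ρ x⟫_ℝ * logDeriv f b (position ρ x) (e j) with hD
  have hβ0 : 0 ≤ β := by positivity
  have hβ1 : β ≤ 1 := by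
    rw [hβ]; exact inv_le_one_of_one_le₀ (by push_cast; linarith [m.cast_nonneg (α := ℝ)])
  have hK10 : 0 ≤ K1 := by positivity
  have hK20 : 0 ≤ K2 := by positivity
  -- Cauchy–Schwarz makes the left-hand side of the curvature inequality grow linearly in `H`.
  have hA2 : H ^ 2 / n ≤ ∑ i, κ i ^ 2 := by
    have h1 := sq_sum_le_card_mul_sum_sq (s := Finset.univ) (f := κ)
    rw [← hHκ, Finset.card_univ, Fintype.card_fin] at h1
    exact div_le_of_le_mul₀ (Nat.cast_nonneg n) (Finset.sum_nonneg fun i _ => sq_nonneg _)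
      (by linarith)
  have hS1 : D ≤ n * (Rf / fmin + |b|) := by
    refine (Finset.sum_le_card_nsmul _ _ (Rf / fmin + |b|) fun j _ => ?_).trans
      (le_of_eq (by rw [Finset.card_univ, Fintype.card_fin, nsmul_eq_mul]))
    have h1 := abs_real_inner_le_norm (e j) (position ρ x)
    rw [he.1, one_mul, hXr] at h1
    refine (le_abs_self _).trans ?_
    rw [abs_mul]
    refine (mul_le_mul h1 (hD1 _ (he.1 j)) (abs_nonneg _) hr.le).trans (le_of_eq ?_)
    rw [hK1]
    field_simp
  have hS2 : -∑ j, (logHess f b (position ρ x) (e j) -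
      κ j * logDeriv f b (position ρ x) (normal ρ x)) ≤ n * K2 + H * K1 := by
    have h1 : -∑ j, (logHess f b (position ρ x) (e j) -
        κ j * logDeriv f b (position ρ x) (normal ρ x)) =
        ∑ j, -logHess f b (position ρ x) (e j) +
          H * logDeriv f b (position ρ x) (normal ρ x) := by
      rw [hHκ, Finset.sum_mul, ← Finset.sum_add_distrib, ← Finset.sum_neg_distrib]
      exact Finset.sum_congr rfl fun i _ => by ring
    rw [h1]
    refine add_le_add ?_ (mul_le_mul_of_nonneg_left
      ((le_abs_self _).trans (hD1 _ (normal_norm h hρ x))) hH.le)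
    exact (Finset.sum_le_card_nsmul _ _ _ fun j _ => hD2 _ (he.1 j)).trans
      (le_of_eq (by rw [Finset.card_univ, Fintype.card_fin, nsmul_eq_mul]))
  have g1 : H / n ≤ (∑ i, κ i ^ 2) / H := by
    rw [le_div_iff₀ hH]
    exact le_trans (le_of_eq (by ring)) hA2
  have g2 : β * (1 - q) / u ≤ (1 - q) / u :=
    div_le_div_of_nonneg_right (mul_le_of_le_one_left (sub_nonneg.2 hq) hβ1) hu.le
  have g3 : β * D / u ≤ n * (Rf / fmin + |b|) / u := by
    refine div_le_div_of_nonneg_right ?_ hu.le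
    exact (mul_le_mul_of_nonneg_left hS1 hβ0).trans (mul_le_of_le_one_left (by positivity) hβ1)
  have g4 : -(β * (∑ j, (logHess f b (position ρ x) (e j) -
      κ j * logDeriv f b (position ρ x) (normal ρ x))) / H) ≤ n * K2 / H + K1 := by
    have h2 := div_le_div_of_nonneg_right ((mul_le_mul_of_nonneg_left hS2 hβ0).trans
      (mul_le_of_le_one_left (by positivity) hβ1)) hH.le
    rw [add_div, mul_div_cancel_left₀ _ hH.ne'] at h2
    exact le_trans (le_of_eq (by ring)) h2
  linarith

/-- The mean curvature estimate for `k ≥ 2`. -/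
theorem meanCurv_le {p m : ℕ} {b q Rρ Rf fmin ρmin : ℝ} (hp : 1 ≤ p) (hn : 1 ≤ n) (hq : q ≤ 1)
    (hfmin : 0 < fmin) (hρmin : 0 < ρmin) {f ρ : Sph n → ℝ}
    (hf2 : ContMDiff (𝓡 n) 𝓘(ℝ, ℝ) 2 f) (h : ContMDiff (𝓡 n) 𝓘(ℝ, ℝ) 4 ρ)
    (hRρ : C1NormLE ρ Rρ) (hRf : C2NormLE f Rf) (hf : ∀ x, fmin ≤ f x) (hρ : ∀ x, ρmin ≤ ρ x)
    (hK : IsPKConvex p (m + 2) ρ) (hS : SolvesCurvatureEq p (m + 2) b q f ρ) (x : Sph n) :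
    meanCurv ρ x ≤ (1 + n * ((2 - q + n * (Rf / fmin + |b|)) / (ρmin ^ 2 / (2 * Rρ)) +
      n * (3 * Rf / (ρmin ^ 2 * fmin) + (Rf / (ρmin * fmin)) ^ 2 + 3 * |b| / ρmin ^ 2) +
      (Rf / (ρmin * fmin) + |b| / ρmin))) * Rρ / (ρmin ^ 2 / (2 * Rρ)) := by
  have hρ0 : ∀ x, 0 < ρ x := fun x => hρmin.trans_le (hρ x)
  have hRρ0 : 0 < Rρ := (hρ0 x).trans_le ((le_abs_self _).trans (hRρ x).1)
  have hRf0 : 0 ≤ Rf := (abs_nonneg _).trans (hRf.1 x).1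
  have hH : ∀ x, 0 < meanCurv ρ x := fun x => (meanCurv_pos hp (by omega) h hρ0 hK x).1
  obtain ⟨y, hy⟩ := exists_max_log_meanCurv h hρ0 hH x
  have hbound := meanCurv_div_le_at_max hp hq hfmin hf2 h hRf hf hρ0 hK hS hy
  have hu := support_pos h hρ0
  have hu1 := le_support h hρmin hρ hRρ y
  set us := ρmin ^ 2 / (2 * Rρ) with hus
  have hus0 : 0 < us := by positivity
  set c := 2 - q + n * (Rf / fmin + |b|) with hc
  have hc0 : 0 ≤ c := by
    have : 0 ≤ (n : ℝ) * (Rf / fmin + |b|) := by positivity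
    linarith
  set K1 := Rf / (ρmin * fmin) + |b| / ρmin with hK1
  set K2 := 3 * Rf / (ρmin ^ 2 * fmin) + (Rf / (ρmin * fmin)) ^ 2 + 3 * |b| / ρmin ^ 2 with hK2
  have hK10 : 0 ≤ K1 := by positivity
  have hK20 : 0 ≤ K2 := by positivity
  have hn0 : (0 : ℝ) < n := by exact_mod_cast hn
  have hy0 := hρ0 y
  have hr := hρ y
  have e1 : Rf / (ρ y * fmin) + |b| / ρ y ≤ K1 := by
    rw [hK1]; gcongr
  have e2 : 3 * Rf / (ρ y ^ 2 * fmin) + (Rf / (ρ y * fmin)) ^ 2 + 3 * |b| / ρ y ^ 2 ≤ K2 := by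
    rw [hK2]; gcongr
  have hmain : meanCurv ρ y ≤ 1 + n * (c / us + n * K2 + K1) := by
    -- Either `H ≤ 1` at the maximum point, or the term divided by `H` is bounded; the summand `1`
    -- in the constant covers the first case.
    rcases le_or_gt (meanCurv ρ y) 1 with h1 | h1
    · have : 0 ≤ n * (c / us + n * K2 + K1) := by positivity
      linarith
    · have e3 : n * (3 * Rf / (ρ y ^ 2 * fmin) + (Rf / (ρ y * fmin)) ^ 2 + 3 * |b| / ρ y ^ 2) /
          meanCurv ρ y ≤ n * K2 :=
        (div_le_self (by positivity) h1.le).trans (mul_le_mul_of_nonneg_left e2 hn0.le)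
      have e4 : 1 / support ρ y + (1 - q) / support ρ y +
          n * (Rf / fmin + |b|) / support ρ y ≤ c / us := by
        rw [← add_div, ← add_div, show 1 + (1 - q) + n * (Rf / fmin + |b|) = c by rw [hc]; ring]
        exact div_le_div_of_nonneg_left hc0 hus0 hu1
      have e5 : meanCurv ρ y / n ≤ c / us + n * K2 + K1 := by linarith
      rw [div_le_iff₀ hn0] at e5
      linarith
  -- Maximality at `y` says `H(x)/u(x) ≤ H(y)/u(y)`; the bounds on `u` then give the estimate at
  -- `x`.
  have h1 := hy x
  rw [← Real.log_div (hH x).ne' (hu x).ne', ← Real.log_div (hH y).ne' (hu y).ne',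
    Real.log_le_log_iff (div_pos (hH x) (hu x)) (div_pos (hH y) (hu y)),
    div_le_div_iff₀ (hu x) (hu y)] at h1
  rw [le_div_iff₀ hus0]
  calc meanCurv ρ x * us ≤ meanCurv ρ x * support ρ y :=
        mul_le_mul_of_nonneg_left hu1 (hH x).le
    _ ≤ meanCurv ρ y * support ρ x := h1
    _ ≤ _ := mul_le_mul hmain (support_le h hρ0 hRρ x) (hu x).le (by positivity)

/-- The exponents `b` and `q` may have either sign, so either endpoint can be the larger. -/
theorem rpow_le_max_rpow {x r R s : ℝ} (hr : 0 < r) (h1 : r ≤ x) (h2 : x ≤ R) :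
    x ^ s ≤ max (r ^ s) (R ^ s) := by
  rcases le_total 0 s with hs | hs
  · exact (Real.rpow_le_rpow (hr.le.trans h1) h2 hs).trans (le_max_right _ _)
  · exact (Real.rpow_le_rpow_of_nonpos hr h1 hs).trans (le_max_left _ _)

/-- The mean curvature estimate for `k = 1`. -/
theorem meanCurv_le_of_linear {p : ℕ} {b q Rρ fmax ρmin : ℝ} (hp : 1 ≤ p)
    (hρmin : 0 < ρmin) {f ρ : Sph n → ℝ} (h : ContMDiff (𝓡 n) 𝓘(ℝ, ℝ) 4 ρ)
    (hRρ : C1NormLE ρ Rρ) (hf0 : ∀ x, 0 ≤ f x) (hf : ∀ x, f x ≤ fmax) (hρ : ∀ x, ρmin ≤ ρ x)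
    (hK : IsPKConvex p 1 ρ) (hS : SolvesCurvatureEq p 1 b q f ρ) (x : Sph n) :
    meanCurv ρ x ≤ fmax * max (ρmin ^ b) (Rρ ^ b) *
      max ((ρmin ^ 2 / (2 * Rρ)) ^ q) (Rρ ^ q) := by
  have hρ0 : ∀ x, 0 < ρ x := fun x => hρmin.trans_le (hρ x)
  have hRx : ρ x ≤ Rρ := (le_abs_self _).trans (hRρ x).1
  have hRρ0 : 0 < Rρ := (hρ0 x).trans_le hRx
  obtain ⟨hH, hc⟩ := meanCurv_pos hp le_rfl h hρ0 hK x
  obtain ⟨κ, hκ⟩ := exists_map_eq_principalCurvatures h hρ0 x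
  have h1 := hS x
  rw [hκ, esymm_Lam, E_one_sums hp, ← esymm_one_map, ← hκ, norm_position hρ0] at h1
  -- A positive binomial coefficient is at least one, which keeps the bound independent of `p`.
  have hc1 : (1 : ℝ) ≤ (n - 1).choose (p - 1) := by exact_mod_cast Nat.cast_pos.1 hc
  have h2 : meanCurv ρ x ≤ f x * ρ x ^ b * support ρ x ^ q := by
    refine le_trans ?_ h1.le
    exact le_mul_of_one_le_left hH.le hc1
  refine h2.trans ?_
  have h3 := Real.rpow_nonneg (hρ0 x).le b
  have h4 := Real.rpow_nonneg (support_pos h hρ0 x).le q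
  refine mul_le_mul (mul_le_mul (hf x) (rpow_le_max_rpow hρmin (hρ x) hRx) h3
    ((hf0 x).trans (hf x))) (rpow_le_max_rpow (by positivity) (le_support h hρmin hρ hRρ x)
    (support_le h hρ0 hRρ x)) h4 ?_
  exact mul_nonneg ((hf0 x).trans (hf x)) (h3.trans (rpow_le_max_rpow hρmin (hρ x) hRx))

end StarShapedHypersurface

open StarShapedHypersurface in
theorem theorem3p4 (n k : ℕ) (b q : ℝ) (hk : 1 ≤ k) (hq : q ≤ 1)
    (Rρ Rf fmin fmax ρmin : ℝ) (hfmin : 0 < fmin) (hρmin : 0 < ρmin) :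
    ∃ C : ℝ, ∀ p : ℕ, 1 ≤ p → p ≤ n → k ≤ n.choose p →
      ∀ f ρ : Sph n → ℝ,
        ContMDiff (𝓡 n) 𝓘(ℝ, ℝ) 2 f → ContMDiff (𝓡 n) 𝓘(ℝ, ℝ) 4 ρ →
        C1NormLE ρ Rρ → C2NormLE f Rf →
        (∀ x, fmin ≤ f x ∧ f x ≤ fmax) → (∀ x, ρmin ≤ ρ x) →
        IsPKConvex p k ρ → SolvesCurvatureEq p k b q f ρ →
        ∀ x, (principalCurvatures ρ x).esymm 1 ≤ C := by
  -- For `k = 1` the exponent `1/(k-1)` is meaningless and the equation gives `H` directly. In both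
  -- cases the bound does not involve `p`, `f` or `ρ`, so it can serve as `C`.
  obtain rfl | ⟨m, rfl⟩ : k = 1 ∨ ∃ m, k = m + 2 := by
    rcases Nat.lt_or_ge k 2 with h | h
    · exact Or.inl (by omega)
    · exact Or.inr ⟨k - 2, by omega⟩
  · exact ⟨_, fun p hp _ _ f ρ _ h hRρ _ hf hρ hK hS x => meanCurv_le_of_linear hp hρmin h hRρ
      (fun x => hfmin.le.trans (hf x).1) (fun x => (hf x).2) hρ hK hS x⟩
  · exact ⟨_, fun p hp hpn _ f ρ hf2 h hRρ hRf hf hρ hK hS x => meanCurv_le hp (hp.trans hpn) hq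
      hfmin hρmin hf2 h hRρ hRf (fun x => (hf x).1) hρ hK hS x⟩
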